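/- **Definitions.** For a finite sequence $S=(a_1,\dots,a_m)$ in $\{+1,-1\}$ put $\overline S=(-a_m,\dots,-a_1)$. The empty sequence is the only $0$-folding sequence, and the $(n+1)$-folding sequences are the sequences $(\overline S,a,S)$ with $S$ an $n$-folding sequence and $a=\pm1$. An $\infty$-folding sequence is a sequence $(a_k)_{k\ge 1}$ such that $(a_1,\dots,a_{2^n-1})$ is $n$-folding for every $n$. A complete folding sequence is a sequence $(a_k)_{k\in\mathbb Z}$ each of whose finite blocks of consecutive terms is a block of consecutive terms of an $n$-folding sequence for some $n$. A curve associated to a sequence $(a_k)$ is a sequence of oriented segments $C_k=[x_k,x_k+\varepsilon_k]$ with $x_k\in\mathbb Z+i\mathbb Z$, $\varepsilon_k\in\{1,-1,i,-i\}$, $x_{k+1}=x_k+\varepsilon_k$ and $\varepsilon_{k+1}=i^{a_k}\varepsilon_k$ (the curve being rounded at its vertices). It is called an $\infty$-folding curve, resp. a complete folding curve, if $(a_k)_{k\geq 1}$ is an $\infty$-folding sequence, resp. $(a_k)_{k\in\mathbb Z}$ is a complete folding sequence. A *covering by folding curves* is a set $\mathcal C$ of complete folding curves such that each nonoriented interval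 $[z,z+\varepsilon]$ with $z\in\mathbb Z+i\mathbb Z$, $\varepsilon\in\{1,i\}$ is the support of exactly one segment of exactly one curve of $\mathcal C$. A *bounded pattern* of $\mathcal C$ is a finite set of (oriented) segments of curves of $\mathcal C$, together with the relation "$B$ follows $A$ in a curve of $\mathcal C$" on it. $\mathcal C$ has the *local isomorphism property* if for each bounded pattern of $\mathcal C$ there is $s$ such that each square of side $s$ with sides parallel to the axes and vertices in $\mathbb Z+i\mathbb Z$ contains a translate of it that is a bounded pattern of $\mathcal C$. Two coverings are *locally isomorphic* if they have the same bounded patterns up to translation. Let $H$ be an $\infty$-folding curve associated to $S$, with origin $X$. The four images of $H$ under the rotations of angles $0,\pi/2,\pi,3\pi/2$ about $X$ can be connected at $X$ in two ways to form two complete curves, both associated to $(\overline S,+1,S)$ or both associated to $(\overline S,-1,S)$. A *covering generated by $H$* is a covering by folding curves which has the local isomorphism property and contains two curves obtained in one of these two ways. **Theorem 4.** Let $\mathcal C$ be a covering by folding curves which has the local isomorphism property. Then $\mathcal C$ is locally isomorphic to a covering generated by a curve associated to an $\infty$-folding sequence. Moreover this covering is essentially unique: if $\mathcal D_1,\mathcal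 D_2$ are coverings locally isomorphic to $\mathcal C$ and generated by $\infty$-folding curves with origins $X_1,X_2$ respectively, then the translation $X_1\mapsto X_2$ maps $\mathcal D_1$ onto $\mathcal D_2$, except that the connections between segments at $X_1$ may have to be changed. -/

import Mathlib

namespace Paperfolding

/-- The Gaussian integer `i`. -/
def I : GaussianInt := ⟨0, 1⟩

/-! ### Folding sequences -/

/-- For `S = (a₁, …, aₘ)`, the sequence `(-aₘ, …, -a₁)`. -/
def bar (S : List ℤˣ) : List ℤˣ := (S.map fun a => -a).reverse

/-- `n`-folding sequences: the first fold of the strip produces the middle term, and the other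
`n - 1` folds act on both halves at once, one of the halves being turned over. -/
inductive IsFolding : ℕ → List ℤˣ → Prop
  | zero : IsFolding 0 []
  | succ (n : ℕ) (S : List ℤˣ) (a : ℤˣ) (h : IsFolding n S) : IsFolding (n + 1) (bar S ++ a :: S)

/-- `∞`-folding sequences; the term `a k` of the Lean sequence is `a_{k+1}` in the usual
numbering, so that the initial segments considered are `(a₁, …, a_{2ⁿ-1})`. -/
def IsInftyFolding (a : ℕ → ℤˣ) : Prop :=
  ∀ n : ℕ, IsFolding n ((List.range (2 ^ n - 1)).map a)

/-- Complete folding sequences: each block `(a_{k+1}, …, a_{k+l})` of consecutive terms is a block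
of consecutive terms of some `n`-folding sequence. -/
def IsCompleteFolding (a : ℤ → ℤˣ) : Prop :=
  ∀ (k : ℤ) (l : ℕ), ∃ (n : ℕ) (S : List ℤˣ), IsFolding n S ∧
    (List.range l).map (fun j : ℕ => a (k + 1 + j)) <:+: S

/-! ### Curves

A curve is given by the sequence `x` of its vertices; its `k`-th segment is the oriented interval
from `x k` to `x (k + 1)`. -/

/-- The four possible values of the direction of a segment. -/
def IsDirection (e : GaussianInt) : Prop := e = 1 ∨ e = -1 ∨ e = I ∨ e = -I

/-- `x` is a complete curve associated to `a`. Note that `i ^ a = a * i` for `a = ±1`. -/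
def IsCompleteCurveOf (a : ℤ → ℤˣ) (x : ℤ → GaussianInt) : Prop :=
  ∀ k : ℤ, IsDirection (x (k + 1) - x k) ∧
    x (k + 2) - x (k + 1) = ((a k : ℤ) : GaussianInt) * I * (x (k + 1) - x k)

/-- `x` is a curve with a first segment, infinite in the other direction, associated to `a`. Its
origin is `x 0`. -/
def IsInftyCurveOf (a : ℕ → ℤˣ) (x : ℕ → GaussianInt) : Prop :=
  ∀ k : ℕ, IsDirection (x (k + 1) - x k) ∧
    x (k + 2) - x (k + 1) = ((a k : ℤ) : GaussianInt) * I * (x (k + 1) - x k)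

/-- Complete folding curves. -/
def IsCompleteFoldingCurve (x : ℤ → GaussianInt) : Prop :=
  ∃ a : ℤ → ℤˣ, IsCompleteFolding a ∧ IsCompleteCurveOf a x

/-- `∞`-folding curves. -/
def IsInftyFoldingCurve (x : ℕ → GaussianInt) : Prop :=
  ∃ a : ℕ → ℤˣ, IsInftyFolding a ∧ IsInftyCurveOf a x

/-! ### Coverings -/

/-- Each nonoriented unit interval of the grid is the support of exactly one segment of exactly one
curve of `𝒞`. (As the curves turn by a right angle at each vertex, and are rounded there, this also
says that they are self-avoiding and disjoint.) -/
def CoversPlane (𝒞 : Set (ℤ → GaussianInt)) : Prop :=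
  ∀ z e : GaussianInt, e = 1 ∨ e = I →
    ∃! p : (ℤ → GaussianInt) × ℤ, p.1 ∈ 𝒞 ∧ s(p.1 p.2, p.1 (p.2 + 1)) = s(z, z + e)

/-- A covering of the plane by complete folding curves. -/
def IsFoldingCovering (𝒞 : Set (ℤ → GaussianInt)) : Prop :=
  (∀ x ∈ 𝒞, IsCompleteFoldingCurve x) ∧ CoversPlane 𝒞

/-! ### Local isomorphism

A bounded set of curves contained in `𝒞` is given by the finite set `F` of its (oriented) segments,
two of them being consecutive in it exactly when they are consecutive in a curve of `𝒞`. -/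

/-- The pair `A = (initial point, terminal point)` is a segment of a curve of `𝒞`. -/
def IsSegment (𝒞 : Set (ℤ → GaussianInt)) (A : GaussianInt × GaussianInt) : Prop :=
  ∃ x ∈ 𝒞, ∃ k : ℤ, A = (x k, x (k + 1))

/-- `A` and `B` are consecutive segments, in this order, of a curve of `𝒞`. -/
def IsConsecutive (𝒞 : Set (ℤ → GaussianInt)) (A B : GaussianInt × GaussianInt) : Prop :=
  ∃ x ∈ 𝒞, ∃ k : ℤ, A = (x k, x (k + 1)) ∧ B = (x (k + 1), x (k + 2))

/-- The translation by `u` acting on segments. -/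
def shift (u : GaussianInt) (A : GaussianInt × GaussianInt) : GaussianInt × GaussianInt :=
  (A.1 + u, A.2 + u)

/-- The translation by `u` maps the bounded set of curves of `𝒞` with set of segments `F` onto a
bounded set of curves of `𝒟`. -/
def IsCopy (𝒞 𝒟 : Set (ℤ → GaussianInt)) (F : Finset (GaussianInt × GaussianInt))
    (u : GaussianInt) : Prop :=
  (∀ A ∈ F, IsSegment 𝒟 (shift u A)) ∧
    ∀ A ∈ F, ∀ B ∈ F, IsConsecutive 𝒞 A B ↔ IsConsecutive 𝒟 (shift u A) (shift u B)

/-- `𝒞` and `𝒟` contain the same bounded sets of curves up to translation. -/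
def LocallyIsomorphic (𝒞 𝒟 : Set (ℤ → GaussianInt)) : Prop :=
  (∀ F : Finset (GaussianInt × GaussianInt), (∀ A ∈ F, IsSegment 𝒞 A) → ∃ u, IsCopy 𝒞 𝒟 F u) ∧
    ∀ F : Finset (GaussianInt × GaussianInt), (∀ A ∈ F, IsSegment 𝒟 A) → ∃ u, IsCopy 𝒟 𝒞 F u

/-- `z` belongs to the square with lower left corner `c` and side `s`. -/
def InSquare (c : GaussianInt) (s : ℕ) (z : GaussianInt) : Prop :=
  c.re ≤ z.re ∧ z.re ≤ c.re + s ∧ c.im ≤ z.im ∧ z.im ≤ c.im + s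

/-- The local isomorphism property: for each bounded set of curves of `𝒞` there is a size `s` such
that each square of side `s` contains a translate of it which is again a set of curves of `𝒞`. -/
def LocalIsomorphismProperty (𝒞 : Set (ℤ → GaussianInt)) : Prop :=
  ∀ F : Finset (GaussianInt × GaussianInt), (∀ A ∈ F, IsSegment 𝒞 A) →
    ∃ s : ℕ, ∀ c : GaussianInt, ∃ u : GaussianInt, IsCopy 𝒞 𝒞 F u ∧
      ∀ A ∈ F, InSquare c s (shift u A).1 ∧ InSquare c s (shift u A).2

/-! ### Coverings generated by an `∞`-folding curve -/

/-- Let `h` be an infinite curve with origin `h 0`, associated to `S`, and let `η, σ = ±1`. Traverse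
backwards the image of `h` under the rotation `z ↦ η i σ z` about `h 0`, then traverse the image of
`h` under the rotation `z ↦ σ z` about `h 0`. The result is a complete curve associated to
`(bar S, η, S)`. The choices `σ = 1` and `σ = -1` together use each of the four images of `h` under
the rotations of angles `0, π/2, π, 3π/2` once; `η` is the choice of the connections at `h 0`. -/
def joined (h : ℕ → GaussianInt) (η σ : ℤˣ) (k : ℤ) : GaussianInt :=
  if 0 ≤ k then h 0 + ((σ : ℤ) : GaussianInt) * (h k.toNat - h 0)
  else h 0 + ((η : ℤ) : GaussianInt) * I * ((σ : ℤ) : GaussianInt) * (h (-k).toNat - h 0)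

/-- `𝒟` is a covering generated by the curve `h`: a covering by complete folding curves with the
local isomorphism property which contains, up to the numbering of their segments, the two complete
curves obtained by connecting at `h 0`, in one of the two possible ways, the four images of `h`
under the rotations of angles `0, π/2, π, 3π/2` about `h 0`. -/
def IsGeneratedBy (𝒟 : Set (ℤ → GaussianInt)) (h : ℕ → GaussianInt) : Prop :=
  IsFoldingCovering 𝒟 ∧ LocalIsomorphismProperty 𝒟 ∧
    ∃ η : ℤˣ, ∀ σ : ℤˣ, ∃ y ∈ 𝒟, ∃ m : ℤ, ∀ k : ℤ, y k = joined h η σ (k + m)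

/-- The translation by `u` maps `𝒟₁` onto `𝒟₂`, except that the connections between segments may
be different at the point `p` of `𝒟₁` and its image. -/
def EqualUpToConnectionsAt (𝒟₁ 𝒟₂ : Set (ℤ → GaussianInt)) (u p : GaussianInt) : Prop :=
  (∀ A, IsSegment 𝒟₁ A ↔ IsSegment 𝒟₂ (shift u A)) ∧
    ∀ A B, A.2 ≠ p → (IsConsecutive 𝒟₁ A B ↔ IsConsecutive 𝒟₂ (shift u A) (shift u B))

end Paperfolding

open Paperfolding

/-! An `n`-folding sequence is a window of a sequence on `ℤ` that alternates on the odd multiples of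
`2 ^ j` for each `j < n` (`Toep`). This structure passes to the plane by rescaling: if the turns at
the odd vertices of a curve alternate, its even vertices form a curve multiplied by `ϖ = 1 + i`
(`Crv.derived`). By iteration, indices divisible by `2 ^ n` match displacements divisible by `ϖ ^
n`, and the turns are read off a function on the Gaussian integers that alternates on each level `ϖ
^ j` about a centre (`PT`). Conversely, curves guided by such a function are folding curves
(`Crv.exists_pt`, `Crv.exists_toep`).

A covering with the local isomorphism property therefore reduces to a type `e`, which orients every
edge, and one turn function `t` with a centre `c n` at each level (`exists_models`). The bridge is
that a single complete folding curve contains, up to translation, every finite set of segments of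
its type (`FC.exists_shift_on`), so that every pattern recurs on one curve. This is proved by
unfolding: neighbouring segments come from neighbouring parents, and after suitable translations at
most three unfoldings merge the first two segments of a walk, which allows induction on its length.

Existence: the centres are coherent modulo powers of `ϖ`, hence `t' z = lim t (c n + z)` exists for
`z ≠ 0` and is centred at `0` on all levels. Moreover `t' (i z) = -t' z`, which is exactly what
makes the four rotated half-curves from `0` join into curves guided by `t'`. Level `j` of a turn
function has period `ϖ ^ (j + 2)` and each level takes both signs, so a finite pattern around the
centre, whatever the turn there, is reproduced elsewhere; this gives local isomorphism
(`locallyIsomorphic_of_limit`).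

Uniqueness: the centre modulo `ϖ ^ n` is detected by finitely many values (`PT.dvd_of_local`).
Copies of large patterns thus carry centre to centre modulo high powers of `ϖ`, and all turns are
determined except the one at the origin (`eq_of_locally_isomorphic`). -/

namespace Paperfolding

/-! ### Gaussian integers -/

/-- The prime `1 + i`. -/
def ϖ : GaussianInt := 1 + I

theorem I_mul_I : I * I = -1 := by decide

@[simp] theorem I_re : I.re = 0 := rfl
@[simp] theorem I_im : I.im = 1 := rfl
@[simp] theorem varpi_re : ϖ.re = 1 := rfl
@[simp] theorem varpi_im : ϖ.im = 1 := rfl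

theorem varpi_ne_zero : ϖ ≠ 0 := by decide

theorem varpi_pow_ne_zero (n : ℕ) : ϖ ^ n ≠ 0 := pow_ne_zero n varpi_ne_zero

theorem two_eq : (2 : GaussianInt) = ϖ * (ϖ * (-I)) := by decide

/-- Exact division by `1 + i`. -/
def divϖ (z : GaussianInt) : GaussianInt := ⟨(z.re + z.im) / 2, (z.im - z.re) / 2⟩

@[simp] theorem divϖ_mul (w : GaussianInt) : divϖ (ϖ * w) = w := by
  ext <;> simp [divϖ] <;> omega

theorem varpi_dvd_iff {z : GaussianInt} : ϖ ∣ z ↔ 2 ∣ z.re + z.im := by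
  constructor
  · rintro ⟨w, rfl⟩
    exact ⟨w.re, by simp; ring⟩
  · intro h
    refine ⟨divϖ z, ?_⟩
    ext <;> simp [divϖ] <;> omega

theorem mul_divϖ {z : GaussianInt} (h : ϖ ∣ z) : ϖ * divϖ z = z := by
  obtain ⟨w, rfl⟩ := h
  simp

theorem two_dvd_iff {z : GaussianInt} : 2 ∣ z ↔ 2 ∣ z.re ∧ 2 ∣ z.im := by
  have := Zsqrtd.intCast_dvd (d := -1) 2 z
  simpa using this

/-- Up to a unit, `2` is `ϖ ^ 2`. Congruences of types modulo `2` are thus handled as divisibility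
by `ϖ`. -/
theorem two_dvd_mul_varpi {z : GaussianInt} : 2 ∣ ϖ * z ↔ ϖ ∣ z := by
  rw [two_dvd_iff, varpi_dvd_iff]
  simp
  omega

theorem varpi_dvd_two : ϖ ∣ 2 := ⟨_, two_eq⟩

theorem varpi_dvd_of_two_dvd {z : GaussianInt} (h : 2 ∣ z) : ϖ ∣ z := varpi_dvd_two.trans h

/-- The residue field at `ϖ` has two elements. -/
theorem not_dvd_iff {z : GaussianInt} : ¬ ϖ ∣ z ↔ ∃ w, z = 1 + ϖ * w := by
  constructor
  · intro h
    have : ϖ ∣ z - 1 := by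
      rw [varpi_dvd_iff] at *
      simp
      omega
    obtain ⟨w, hw⟩ := this
    exact ⟨w, by rw [← hw]; ring⟩
  · rintro ⟨w, rfl⟩
    rw [varpi_dvd_iff]
    simp
    omega

theorem not_dvd_one_add (w : GaussianInt) : ¬ ϖ ∣ 1 + ϖ * w := not_dvd_iff.2 ⟨w, rfl⟩

/-- Two elements of the odd class differ by an even element. -/
theorem dvd_sub_of_not_dvd {y z : GaussianInt} (hy : ¬ ϖ ∣ y) (hz : ¬ ϖ ∣ z) : ϖ ∣ y - z := by
  rw [varpi_dvd_iff] at *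
  simp
  omega

theorem dvd_add_of_not_dvd {y z : GaussianInt} (hy : ¬ ϖ ∣ y) (hz : ¬ ϖ ∣ z) : ϖ ∣ y + z := by
  rw [varpi_dvd_iff] at *
  simp
  omega

theorem not_pow_dvd {n j : ℕ} (h : j < n) (w : GaussianInt) : ¬ ϖ ^ n ∣ ϖ ^ j * (1 + ϖ * w) := by
  intro h'
  have h2 : ϖ ^ (j + 1) ∣ ϖ ^ j * (1 + ϖ * w) := (pow_dvd_pow ϖ h).trans h'
  rw [pow_succ, mul_dvd_mul_iff_left (varpi_pow_ne_zero j)] at h2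
  exact not_dvd_one_add w h2

theorem varpi_pow_dvd_two_pow (n : ℕ) : ϖ ^ n ∣ 2 ^ n := pow_dvd_pow_of_dvd varpi_dvd_two n

/-- The decomposition of a Gaussian integer along the powers of `1 + i`, up to a given level. -/
theorem dvd_or_eq (n : ℕ) (z : GaussianInt) :
    ϖ ^ n ∣ z ∨ ∃ j < n, ∃ w, z = ϖ ^ j * (1 + ϖ * w) := by
  induction n with
  | zero => simp
  | succ n ih =>
    rcases ih with ⟨y, rfl⟩ | ⟨j, hj, w, hw⟩
    · by_cases h : ϖ ∣ y
      · left
        rw [pow_succ]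
        exact mul_dvd_mul_left _ h
      · obtain ⟨w, rfl⟩ := not_dvd_iff.1 h
        exact Or.inr ⟨n, by omega, w, rfl⟩
    · exact Or.inr ⟨j, by omega, w, hw⟩

theorem norm_varpi_pow (n : ℕ) : Zsqrtd.norm (ϖ ^ n) = 2 ^ n := by
  induction n with
  | zero => simp
  | succ n ih => rw [pow_succ, Zsqrtd.norm_mul, ih, pow_succ]; rfl

/-- A nonzero Gaussian integer is `(1 + i) ^ j` times an odd one. -/
theorem exists_eq_of_ne_zero {z : GaussianInt} (hz : z ≠ 0) :
    ∃ (j : ℕ) (w : GaussianInt), z = ϖ ^ j * (1 + ϖ * w) := by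
  obtain ⟨n, hn⟩ : ∃ n : ℕ, z.norm.natAbs < 2 ^ n := ⟨_, Nat.lt_two_pow_self⟩
  rcases dvd_or_eq n z with ⟨y, rfl⟩ | ⟨j, -, w, hw⟩
  · exfalso
    rw [Zsqrtd.norm_mul, norm_varpi_pow, Int.natAbs_mul, Int.natAbs_pow] at hn
    have hy : y ≠ 0 := by rintro rfl; simp at hz
    have : 0 < y.norm := GaussianInt.norm_pos.2 hy
    have h1 : 0 < y.norm.natAbs := by omega
    exact absurd hn (not_lt.2 (Nat.le_mul_of_pos_right _ h1))
  · exact ⟨j, w, hw⟩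

/-- The character of order `2` of the Gaussian integers whose kernel is generated by `1 + i`. -/
def χ (w : GaussianInt) : ℤˣ := Int.negOnePow (w.re + w.im)

@[simp] theorem χ_zero : χ 0 = 1 := rfl

theorem χ_add (v w : GaussianInt) : χ (v + w) = χ v * χ w := by
  rw [χ, χ, χ, ← Int.negOnePow_add]
  congr 1
  simp
  ring

@[simp] theorem χ_varpi_mul (w : GaussianInt) : χ (ϖ * w) = 1 := by
  rw [χ]
  apply Int.negOnePow_even
  exact ⟨w.re, by simp⟩

theorem χ_of_not_dvd {w : GaussianInt} (h : ¬ ϖ ∣ w) : χ w = -1 := by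
  rw [χ]
  apply Int.negOnePow_odd
  rw [varpi_dvd_iff] at h
  rw [← Int.not_even_iff_odd, even_iff_two_dvd]
  exact h

/-! ### Directions -/

theorem IsDirection.neg {d : GaussianInt} (h : IsDirection d) : IsDirection (-d) := by
  rcases h with rfl | rfl | rfl | rfl <;> simp [IsDirection]

theorem IsDirection.I_mul {d : GaussianInt} (h : IsDirection d) : IsDirection (I * d) := by
  rcases h with rfl | rfl | rfl | rfl <;> simp [IsDirection, I_mul_I]

theorem IsDirection.turn {d : GaussianInt} (h : IsDirection d) (s : ℤˣ) :
    IsDirection (((s : ℤ) : GaussianInt) * I * d) := by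
  rcases Int.units_eq_one_or s with rfl | rfl
  · simpa using h.I_mul
  · simpa using h.I_mul.neg

theorem IsDirection.not_dvd {d : GaussianInt} (h : IsDirection d) : ¬ ϖ ∣ d := by
  rw [varpi_dvd_iff]
  rcases h with rfl | rfl | rfl | rfl <;> simp

theorem IsDirection.χ_eq {d : GaussianInt} (h : IsDirection d) : χ d = -1 := χ_of_not_dvd h.not_dvd

theorem IsDirection.ne_zero {d : GaussianInt} (h : IsDirection d) : d ≠ 0 := by
  rintro rfl
  exact h.not_dvd (dvd_zero _)

theorem IsDirection.eq_or_eq_neg {d d' : GaussianInt} (h : IsDirection d) (h' : IsDirection d')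
    (h2 : 2 ∣ d - d') : d' = d ∨ d' = -d := by
  rw [two_dvd_iff] at h2
  rcases h with rfl | rfl | rfl | rfl <;> rcases h' with rfl | rfl | rfl | rfl <;>
    first | (left; rfl) | (right; decide) | (exfalso; revert h2; decide)

theorem IsDirection.cases_of {d d' : GaussianInt} (h : IsDirection d) (h' : IsDirection d') :
    d' = d ∨ d' = -d ∨ d' = I * d ∨ d' = -(I * d) := by
  rcases h with rfl | rfl | rfl | rfl <;> rcases h' with rfl | rfl | rfl | rfl <;> decide

theorem sign_mul_self (s : ℤˣ) : ((s : ℤ) : GaussianInt) * ((s : ℤ) : GaussianInt) = 1 := by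
  rw [← Int.cast_mul, ← Units.val_mul, Int.units_mul_self]
  simp

/-- If a descending sequence of properties is satisfied at each level by some element of a finite
set, then one of these elements satisfies all of them. -/
theorem exists_forall_of_antitone {α : Type*} (S : Set α) (hS : S.Finite) (P : ℕ → α → Prop)
    (hP : ∀ m n a, m ≤ n → P n a → P m a) (h : ∀ n, ∃ a ∈ S, P n a) : ∃ a ∈ S, ∀ n, P n a := by
  by_contra! H
  choose! N hN using H
  obtain ⟨M, hM⟩ := (hS.image N).bddAbove
  obtain ⟨a, ha, hPa⟩ := h M
  exact hN a ha (hP _ _ _ (hM ⟨a, ha, rfl⟩) hPa)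

/-! ### Folding sequences as Toeplitz sequences -/

/-- `b` alternates on the odd multiples of `2 ^ j` for each `j < n`. -/
def Toep (n : ℕ) (b : ℤ → ℤˣ) : Prop :=
  ∀ j < n, ∀ m : ℤ, b (2 ^ j * (2 * m + 1)) = m.negOnePow * b (2 ^ j)

/-- The sequences which are, at each level, Toeplitz sequences up to a shift. -/
def CF (b : ℤ → ℤˣ) : Prop := ∀ n, ∃ r : ℤ, Toep n fun k => b (r + k)

theorem Toep.mono {m n : ℕ} {b : ℤ → ℤˣ} (h : Toep n b) (hmn : m ≤ n) : Toep m b :=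
  fun j hj => h j (hj.trans_le hmn)

theorem int_dvd_or_eq (n : ℕ) (k : ℤ) : 2 ^ n ∣ k ∨ ∃ j < n, ∃ m : ℤ, k = 2 ^ j * (2 * m + 1) := by
  induction n with
  | zero => simp
  | succ n ih =>
    rcases ih with ⟨y, rfl⟩ | ⟨j, hj, w, hw⟩
    · rcases Int.even_or_odd' y with ⟨m, rfl | rfl⟩
      · exact Or.inl ⟨m, by ring⟩
      · exact Or.inr ⟨n, by omega, m, rfl⟩
    · exact Or.inr ⟨j, by omega, w, hw⟩

/-- Negation sends `2m + 1` to `2(-(m + 1)) + 1`, which flips the sign. This antisymmetry is the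
operation `bar`. -/
theorem Toep.neg_apply {n : ℕ} {b : ℤ → ℤˣ} (h : Toep n b) {k : ℤ} (hk : ¬ 2 ^ n ∣ k) :
    b (-k) = -b k := by
  rcases int_dvd_or_eq n k with h' | ⟨j, hj, m, rfl⟩
  · exact absurd h' hk
  · rw [show -(2 ^ j * (2 * m + 1)) = 2 ^ j * (2 * (-(m + 1)) + 1) by ring, h j hj, h j hj,
      Int.negOnePow_neg, Int.negOnePow_succ, neg_mul]

/-- A centre matters only modulo `2 ^ n`: at each level `j < n` the shift changes both indices
compared by the same amount, and the two signs cancel. -/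
theorem Toep.shift {n : ℕ} {b : ℤ → ℤˣ} (h : Toep n b) (y : ℤ) :
    Toep n fun k => b (2 ^ n * y + k) := by
  intro j hj m
  obtain ⟨i, rfl⟩ := Nat.exists_eq_add_of_lt hj
  simp only
  rw [show (2 : ℤ) ^ (j + i + 1) * y + 2 ^ j * (2 * m + 1) = 2 ^ j * (2 * (m + 2 ^ i * y) + 1) by
    ring, show (2 : ℤ) ^ (j + i + 1) * y + 2 ^ j = 2 ^ j * (2 * (2 ^ i * y) + 1) by ring, h j hj,
    h j hj, Int.negOnePow_add, mul_assoc]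

theorem toep_succ_iff {n : ℕ} {b : ℤ → ℤˣ} :
    Toep (n + 1) b ↔ Toep 1 b ∧ Toep n fun k => b (2 * k) := by
  constructor
  · intro h
    refine ⟨h.mono (by omega), fun j hj m => ?_⟩
    have := h (j + 1) (by omega) m
    simp only
    rwa [show (2 : ℤ) * (2 ^ j * (2 * m + 1)) = 2 ^ (j + 1) * (2 * m + 1) by ring,
      show (2 : ℤ) * 2 ^ j = 2 ^ (j + 1) by ring]
  · rintro ⟨h1, h2⟩ j hj m
    cases j with
    | zero => exact h1 0 (by omega) m
    | succ j =>
      have := h2 j (by omega) m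
      simp only at this
      rwa [show (2 : ℤ) * (2 ^ j * (2 * m + 1)) = 2 ^ (j + 1) * (2 * m + 1) by ring,
        show (2 : ℤ) * 2 ^ j = 2 ^ (j + 1) by ring] at this

theorem toep_one_iff {b : ℤ → ℤˣ} : Toep 1 b ↔ ∀ m, b (2 * m + 1) = m.negOnePow * b 1 := by
  constructor
  · intro h m
    simpa using h 0 (by omega) m
  · intro h j hj m
    obtain rfl : j = 0 := by omega
    simpa using h m

theorem toep_one_of_forall {b : ℤ → ℤˣ} (h : ∀ m, b (2 * m + 3) = -b (2 * m + 1)) : Toep 1 b := by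
  rw [toep_one_iff]
  intro m
  induction m using Int.induction_on with
  | zero => simp
  | succ k ih =>
    have := h k
    rw [show (2 * ((k : ℤ) + 1) + 1) = 2 * k + 3 by ring, this, ih, Int.negOnePow_succ, neg_mul]
  | pred k ih =>
    have := h (-(k : ℤ) - 1)
    rw [show 2 * (-(k : ℤ) - 1) + 3 = 2 * (-k) + 1 by ring, ih] at this
    rw [Int.negOnePow_sub, Int.negOnePow_one]
    rw [← neg_eq_iff_eq_neg.2 this]
    simp

theorem Toep.alternate {n : ℕ} {b : ℤ → ℤˣ} (h : Toep (n + 1) b) (m : ℤ) :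
    b (2 * m + 3) = -b (2 * m + 1) := by
  have h1 := toep_one_iff.1 (h.mono (by omega : 1 ≤ n + 1))
  rw [show 2 * m + 3 = 2 * (m + 1) + 1 by ring, h1, h1, Int.negOnePow_succ, neg_mul]

/-- The centre of a Toeplitz sequence is unique. -/
theorem Toep.dvd_of_shift {n : ℕ} {b : ℤ → ℤˣ} {r : ℤ} (h : Toep (n + 1) b)
    (hr : Toep n fun k => b (r + k)) : 2 ^ n ∣ r := by
  rcases int_dvd_or_eq n r with h' | ⟨j, hj, y, rfl⟩
  · exact h'
  · exfalso
    -- The places `r + 2 ^ j (2s + 1)`, for one parity of `s`, are odd multiples of `2 ^ (j + 1)`.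
    -- Replacing `s` by `s + 2` preserves the value according to the centre `r`, but flips it
    -- according to the centre `0`.
    have key : ∀ s a : ℤ, 2 * y + 1 + (2 * s + 1) = 2 * (2 * a + 1) → False := by
      intro s a hs
      have e1 := hr j hj s
      have e2 := hr j hj (s + 2)
      have e3 := h (j + 1) (by omega) a
      have e4 := h (j + 1) (by omega) (a + 1)
      simp only at e1 e2
      rw [show (2 : ℤ) ^ j * (2 * y + 1) + 2 ^ j * (2 * s + 1) = 2 ^ (j + 1) * (2 * a + 1) by
        rw [pow_succ]; linear_combination 2 ^ j * hs, e3] at e1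
      rw [show (2 : ℤ) ^ j * (2 * y + 1) + 2 ^ j * (2 * (s + 2) + 1)
        = 2 ^ (j + 1) * (2 * (a + 1) + 1) by rw [pow_succ]; linear_combination 2 ^ j * hs, e4,
        Int.negOnePow_succ, Int.negOnePow_add, Int.negOnePow_even 2 (by decide), mul_one, neg_mul,
        e1] at e2
      exact units_ne_neg_self _ e2.symm
    rcases Int.even_or_odd' y with ⟨m, rfl | rfl⟩
    · exact key 0 m (by ring)
    · exact key (-1) m (by ring)

theorem CF.shift {b : ℤ → ℤˣ} (h : CF b) (s : ℤ) : CF fun k => b (s + k) := by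
  intro n
  obtain ⟨r, hr⟩ := h n
  refine ⟨r - s, ?_⟩
  convert hr using 3
  ring

/-- The derived sequence of a complete folding sequence. -/
theorem CF.exists_derived {b : ℤ → ℤˣ} (h : CF b) :
    ∃ r : ℤ, (Toep 1 fun k => b (r + k)) ∧ CF fun k => b (r + 2 * k) := by
  -- The centre may depend on the level; its parity can be chosen the same for all levels.
  obtain ⟨r, -, hr⟩ := exists_forall_of_antitone ({0, 1} : Set ℤ) (Set.toFinite _)
    (fun n r => ∃ q : ℤ, Toep n fun k => b (r + 2 * q + k))
    (fun m n r hmn ⟨q, hq⟩ => ⟨q, hq.mono hmn⟩) (by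
      intro n
      obtain ⟨r, hr⟩ := h n
      rcases Int.even_or_odd' r with ⟨q, rfl | rfl⟩
      · exact ⟨0, by simp, q, by simpa using hr⟩
      · exact ⟨1, by simp, q, by simpa [add_comm] using hr⟩)
  refine ⟨r, ?_, fun n => ?_⟩
  · obtain ⟨q, hq⟩ := hr 1
    have := hq.shift (-q)
    convert this using 3
    ring
  · obtain ⟨q, hq⟩ := hr (n + 1)
    refine ⟨q, ?_⟩
    convert (toep_succ_iff.1 hq).2 using 3
    ring

/-- Toeplitz sequences have no period. -/
theorem CF.not_periodic {b : ℤ → ℤˣ} (h : CF b) {N : ℤ} (hN : ∀ k, b (k + N) = b k) : N = 0 := by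
  by_contra hne
  obtain ⟨n, hn⟩ : ∃ n : ℕ, N.natAbs < 2 ^ n := ⟨_, Nat.lt_two_pow_self⟩
  rcases int_dvd_or_eq n N with h' | ⟨j, hj, m, rfl⟩
  · have := Int.natAbs_dvd_natAbs.2 h'
    rw [Int.natAbs_pow] at this
    have := Nat.le_of_dvd (by omega) this
    simp at this
    omega
  · obtain ⟨r, hr⟩ := h n
    -- Twice the supposed period `N = 2 ^ j (2m + 1)` moves the index at level `j` by an odd amount,
    -- hence flips the value.
    have e := hr j hj (2 * m + 1)
    simp only at e
    rw [show r + 2 ^ j * (2 * (2 * m + 1) + 1) = r + 2 ^ j + 2 ^ j * (2 * m + 1) + 2 ^ j * (2 * m + 1)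
      by ring, hN, hN, Int.negOnePow_odd _ ⟨m, rfl⟩, neg_one_mul] at e
    exact units_ne_neg_self _ e

/-! ### Finite folding sequences as windows of Toeplitz sequences -/

theorem bar_map_range (f : ℤ → ℤˣ) (m : ℕ) :
    bar ((List.range m).map fun k : ℕ => f (k + 1)) =
      (List.range m).map fun k : ℕ => -f (m - k) := by
  rw [bar]
  apply List.ext_getElem
  · simp
  · intro i h1 h2
    simp at h1 h2 ⊢
    congr 1
    omega

theorem map_range_split {α : Type*} (F : ℕ → α) (m : ℕ) :
    (List.range (m + (1 + m))).map F =
      (List.range m).map F ++ F m :: (List.range m).map fun k => F (m + 1 + k) := by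
  rw [List.range_add, List.range_add]
  simp [Function.comp_def, add_assoc]

theorem two_pow_split (n : ℕ) : 2 ^ (n + 1) - 1 = (2 ^ n - 1) + (1 + (2 ^ n - 1)) := by
  have := Nat.one_le_two_pow (n := n)
  omega

theorem cast_two_pow_sub_one (n : ℕ) : ((2 ^ n - 1 : ℕ) : ℤ) = 2 ^ n - 1 := by
  push_cast [Nat.one_le_two_pow (n := n)]
  ring

/-- The window of radius `2 ^ n - 1` about the centre gains one fold because level `n` leaves the
middle term `g 0` free, while the left half is the `bar` of the right half by antisymmetry. The
right half is itself a window about `2 ^ n`, at one level lower, so induction applies. -/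
theorem Toep.isFolding_succ {n : ℕ} : ∀ {g : ℤ → ℤˣ}, Toep n g →
    IsFolding (n + 1) ((List.range (2 ^ (n + 1) - 1)).map fun k : ℕ => g (k + 1 - 2 ^ n)) := by
  have key : ∀ {n : ℕ} {g : ℤ → ℤˣ}, Toep n g →
      IsFolding n ((List.range (2 ^ n - 1)).map fun k : ℕ => g (k + 1)) →
      IsFolding (n + 1)
        ((List.range (2 ^ (n + 1) - 1)).map fun k : ℕ => g (k + 1 - 2 ^ n)) := by
    intro n g hg h
    have := IsFolding.succ n _ (g 0) h
    rw [bar_map_range] at this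
    convert this using 1
    have h1 := cast_two_pow_sub_one n
    rw [two_pow_split, map_range_split]
    congr 1
    · apply List.map_congr_left
      intro k hk
      have hk : k < 2 ^ n - 1 := List.mem_range.1 hk
      rw [h1, ← hg.neg_apply]
      · congr 1
        ring
      · intro hd
        have := Int.le_of_dvd (by zify [Nat.one_le_two_pow (n := n)] at hk; linarith) hd
        linarith
    · congr 1
      · rw [h1]
        congr 1
        ring
      · apply List.map_congr_left
        intro k _
        congr 1
        push_cast [h1]
        ring
  intro g hg
  refine key hg ?_
  induction n generalizing g with
  | zero => exact IsFolding.zero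
  | succ n ih =>
    have h1 : Toep n fun k => g (2 ^ n + k) := by
      simpa using (hg.mono (Nat.le_succ n)).shift 1
    have := key h1 (ih h1)
    simpa using this

theorem Toep.isFolding {n : ℕ} {g : ℤ → ℤˣ} (hg : Toep n g) :
    IsFolding n ((List.range (2 ^ n - 1)).map fun k : ℕ => g (k + 1)) := by
  cases n with
  | zero => exact IsFolding.zero
  | succ n =>
    have h1 : Toep n fun k => g (2 ^ n + k) := by
      simpa using (hg.mono (Nat.le_succ n)).shift 1
    simpa using h1.isFolding_succ

theorem IsFolding.exists_toep {n : ℕ} {S : List ℤˣ} (h : IsFolding n S) :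
    ∃ f : ℤ → ℤˣ, Toep n f ∧ S = (List.range (2 ^ n - 1)).map fun k : ℕ => f (k + 1) := by
  induction h with
  | zero => exact ⟨fun _ => 1, fun j hj => absurd hj (by omega), rfl⟩
  | succ n S a h ih =>
    obtain ⟨f, hf, rfl⟩ := ih
    have hg : Toep n fun k => f (k - 2 ^ n) := by
      convert hf.shift (-1) using 3
      ring
    classical
    -- The new fold occupies the multiples of `2 ^ n`. At `2 ^ n (2m + 1)` the two divisions return
    -- `m`, which gives the required alternation; the values at even multiples do not matter.
    refine ⟨fun k => if 2 ^ n ∣ k then (k / 2 ^ n / 2).negOnePow * a else f (k - 2 ^ n), ?_, ?_⟩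
    · intro j hj m
      rcases Nat.lt_succ_iff_lt_or_eq.1 hj with hj | rfl
      · have hnd : ∀ m : ℤ, ¬ (2 : ℤ) ^ n ∣ 2 ^ j * (2 * m + 1) := by
          intro m hd
          have : (2 : ℤ) ^ (j + 1) ∣ 2 ^ j * (2 * m + 1) := (pow_dvd_pow 2 hj).trans hd
          rw [pow_succ, mul_dvd_mul_iff_left (by positivity)] at this
          omega
        have h0 := hnd 0
        rw [mul_zero, zero_add, mul_one] at h0
        simp only
        rw [if_neg (hnd m), if_neg h0]
        exact hg j hj m
      · have e1 : ((2 : ℤ) ^ j * (2 * m + 1)) / 2 ^ j = 2 * m + 1 :=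
          Int.mul_ediv_cancel_left _ (by positivity)
        have e2 : ((2 : ℤ) ^ j) / 2 ^ j = 1 := Int.ediv_self (by positivity)
        simp only
        rw [if_pos (dvd_mul_right _ _), if_pos dvd_rfl, e1, e2,
          show (2 * m + 1) / 2 = m by omega]
        simp
    · rw [bar_map_range]
      have h1 := cast_two_pow_sub_one n
      have hnd : ∀ k : ℕ, k < 2 ^ n - 1 → ¬ (2 : ℤ) ^ n ∣ (k : ℤ) + 1 := by
        intro k hk hd
        have := Int.le_of_dvd (by positivity) hd
        zify [Nat.one_le_two_pow (n := n)] at hk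
        linarith
      rw [two_pow_split, map_range_split]
      congr 1
      · apply List.map_congr_left
        intro k hk
        have hk : k < 2 ^ n - 1 := List.mem_range.1 hk
        simp only
        rw [if_neg (hnd k hk), h1, ← hf.neg_apply]
        · congr 1
          ring
        · intro hd
          refine hnd k hk ?_
          have := dvd_sub (dvd_refl ((2 : ℤ) ^ n)) hd
          rwa [show (2 : ℤ) ^ n - (2 ^ n - 1 - k) = k + 1 by ring] at this
      · congr 1
        · simp only
          rw [h1, sub_add_cancel, if_pos dvd_rfl, Int.ediv_self (by positivity)]
          simp
        · apply List.map_congr_left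
          intro k hk
          have hk : k < 2 ^ n - 1 := List.mem_range.1 hk
          simp only
          rw [show ((2 ^ n - 1 + 1 + k : ℕ) : ℤ) + 1 = 2 ^ n + (k + 1) by push_cast [h1]; ring,
            if_neg]
          · congr 1
            ring
          · rw [dvd_add_right dvd_rfl]
            exact hnd k hk

theorem isInftyFolding_of_toep {b : ℤ → ℤˣ} (h : ∀ n, Toep n b) :
    IsInftyFolding fun k : ℕ => b (k + 1) :=
  fun n => (h n).isFolding

theorem IsInftyFolding.toep_prefix {a : ℕ → ℤˣ} (h : IsInftyFolding a) (n : ℕ) :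
    ∃ f : ℤ → ℤˣ, Toep n f ∧ ∀ k : ℕ, k < 2 ^ n - 1 → a k = f (k + 1) := by
  obtain ⟨f, hf, e⟩ := (h n).exists_toep
  refine ⟨f, hf, fun k hk => ?_⟩
  exact List.map_inj_left.1 e k (List.mem_range.2 hk)

theorem isCompleteFolding_of_cf {a : ℤ → ℤˣ} (h : CF a) : IsCompleteFolding a := by
  intro k l
  obtain ⟨n, hn⟩ : ∃ n : ℕ, l < 2 ^ n := ⟨_, Nat.lt_two_pow_self⟩
  obtain ⟨r, hr⟩ := h n
  -- A translated centre within `2 ^ n` to the right of `k`: the window of radius `2 ^ n - 1` around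
  -- it contains the block, since `l < 2 ^ n`.
  obtain ⟨M, hM1, hM2⟩ : ∃ M : ℤ, k + 1 ≤ r + 2 ^ n * M ∧ r + 2 ^ n * M ≤ k + 2 ^ n := by
    have hpos : (0 : ℤ) < 2 ^ n := by positivity
    refine ⟨-((r - k - 1) / 2 ^ n), ?_, ?_⟩
    · have := Int.mul_ediv_self_le (x := r - k - 1) (k := 2 ^ n) (by positivity)
      linarith
    · have := Int.lt_mul_ediv_self_add (x := r - k - 1) hpos
      linarith
  refine ⟨n + 1, _, (hr.shift M).isFolding_succ, ?_⟩
  obtain ⟨p, hp⟩ := Int.eq_ofNat_of_zero_le (a := k - (r + 2 ^ n * M) + 2 ^ n) (by linarith)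
  have hle : p + l ≤ 2 ^ (n + 1) - 1 := by
    apply Nat.le_sub_of_add_le
    zify at hn ⊢
    rw [← hp, pow_succ]
    linarith
  obtain ⟨q, hq⟩ := Nat.exists_eq_add_of_le hle
  rw [hq, List.range_add, List.range_add, List.map_append, List.map_append]
  refine ⟨_, _, congrArg₂ _ (congrArg₂ _ rfl ?_) rfl⟩
  rw [List.map_map]
  apply List.map_congr_left
  intro j _
  simp only [Function.comp]
  congr 1
  push_cast
  linarith

/-- Compactness: each window `[-L, L]` has a centre among the `2 ^ n` residues, and some residue
serves all windows. -/
theorem IsCompleteFolding.cf {a : ℤ → ℤˣ} (h : IsCompleteFolding a) : CF a := by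
  intro n
  obtain ⟨r, -, hr⟩ := exists_forall_of_antitone (Set.Ico (0 : ℤ) (2 ^ n)) (Set.finite_Ico _ _)
    (fun L r => ∃ f : ℤ → ℤˣ, Toep n f ∧ ∀ k : ℤ, |k| ≤ L → a k = f (k - r))
    (fun L L' r hL ⟨f, hf, h⟩ => ⟨f, hf, fun k hk => h k (hk.trans (by exact_mod_cast hL))⟩) (by
      intro L
      -- The `2 ^ n` additional terms only serve to force `n ≤ N`.
      obtain ⟨N, S, hS, hinf⟩ := h (-L - 1) (2 * L + 1 + 2 ^ n)
      obtain ⟨f, hf, rfl⟩ := hS.exists_toep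
      obtain ⟨s, t, hst⟩ := hinf
      have hlen := congrArg List.length hst
      simp at hlen
      have hnN : n ≤ N := by
        by_contra hlt
        have : 2 ^ N ≤ 2 ^ n := Nat.pow_le_pow_right (by omega) (by omega)
        have := Nat.one_le_two_pow (n := N)
        omega
      have hval : ∀ j : ℕ, j < 2 * L + 1 + 2 ^ n → a (-L - 1 + 1 + j) = f (s.length + j + 1) := by
        intro j hj
        have e := congrArg (fun l => l[s.length + j]?) hst
        simp only [List.append_assoc] at e
        rw [List.getElem?_append_right (by omega), List.getElem?_append_left (by simp; omega)] at e
        have e2 : s.length + j < 2 ^ N - 1 := by omega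
        simpa [hj, e2] using e
      set r : ℤ := -L - s.length - 1 with hr
      refine ⟨r % 2 ^ n, ⟨Int.emod_nonneg _ (by positivity), Int.emod_lt_of_pos _ (by positivity)⟩,
        fun k => f (2 ^ n * (-(r / 2 ^ n)) + k), (hf.mono hnN).shift _, fun k hk => ?_⟩
      rw [abs_le] at hk
      obtain ⟨j, hj⟩ := Int.eq_ofNat_of_zero_le (a := k + L) (by omega)
      have := hval j (by zify; have : (0 : ℤ) < 2 ^ n := by positivity
                         linarith)
      rw [show (-(L : ℤ) - 1 + 1 + j) = k by linarith] at this
      rw [this]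
      simp only
      congr 1
      have := Int.mul_ediv_add_emod r (2 ^ n)
      linarith)
  refine ⟨r, fun j hj m => ?_⟩
  obtain ⟨f, hf, hfa⟩ := hr (|r + 2 ^ j * (2 * m + 1)| + |r + 2 ^ j|).toNat
  rw [Int.toNat_of_nonneg (by positivity)] at hfa
  have := hf j hj m
  simp only
  rw [hfa _ (le_add_of_nonneg_right (abs_nonneg _)), hfa _ (le_add_of_nonneg_left (abs_nonneg _))]
  simpa using this

/-! ### Types of segments -/

/-- `A` is a unit segment of type `e`. The type, which is `1` or `i` modulo `2`, is constant along a
curve; there are two types, which correspond to the two orientations of each interval. -/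
def IsSeg (e : GaussianInt) (A : GaussianInt × GaussianInt) : Prop :=
  IsDirection (A.2 - A.1) ∧ 2 ∣ A.2 + I * A.1 - e

theorem IsSeg.odd {e : GaussianInt} {A : GaussianInt × GaussianInt} (h : IsSeg e A) : ¬ ϖ ∣ e := by
  intro he
  apply h.1.not_dvd
  have h1 := varpi_dvd_of_two_dvd h.2
  have := dvd_sub (dvd_add h1 he) (dvd_mul_right ϖ A.1)
  convert this using 1
  rw [ϖ]
  ring

theorem two_dvd_sign_add_one (s : ℤˣ) (z : GaussianInt) :
    2 ∣ (((s : ℤ) : GaussianInt) + 1) * z := by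
  rcases Int.units_eq_one_or s with rfl | rfl
  · exact ⟨z, by push_cast; ring⟩
  · exact ⟨0, by push_cast; ring⟩

/-- Passing to the next segment adds `(s + 1) * I * d` to `A.2 + I * A.1`, and `s + 1` is `0` or
`2`. -/
theorem isSeg_next_iff {e z d : GaussianInt} (s : ℤˣ) :
    IsSeg e (z + d, z + d + ((s : ℤ) : GaussianInt) * I * d) ↔ IsSeg e (z, z + d) := by
  simp only [IsSeg, add_sub_cancel_left]
  constructor
  · rintro ⟨h1, h2⟩
    constructor
    · have := (h1.turn s).neg
      convert this using 1
      have h3 : ((s : ℤ) : GaussianInt) * ((s : ℤ) : GaussianInt) = 1 := sign_mul_self _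
      linear_combination (-d) * h3 + d * ((s : ℤ) : GaussianInt) * (s : ℤ) * I_mul_I
    · have := dvd_sub h2 (two_dvd_sign_add_one s (I * d))
      convert this using 1
      ring
  · rintro ⟨h1, h2⟩
    refine ⟨h1.turn s, ?_⟩
    have := dvd_add h2 (two_dvd_sign_add_one s (I * d))
    convert this using 1
    ring

theorem IsSeg.congr {e e' : GaussianInt} {A : GaussianInt × GaussianInt} (h : IsSeg e A)
    (he : 2 ∣ e' - e) : IsSeg e' A := by
  refine ⟨h.1, ?_⟩
  have := dvd_sub h.2 he
  convert this using 1
  ring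

theorem isSeg_shift_iff {e u : GaussianInt} {A : GaussianInt × GaussianInt} :
    IsSeg e (shift u A) ↔ IsSeg (e - ϖ * u) A := by
  simp only [IsSeg, shift]
  rw [show A.2 + u - (A.1 + u) = A.2 - A.1 by ring,
    show A.2 + u + I * (A.1 + u) - e = A.2 + I * A.1 - (e - ϖ * u) by rw [ϖ]; ring]

theorem IsSeg.shift {e u : GaussianInt} {A : GaussianInt × GaussianInt} (h : IsSeg e A)
    (hu : ϖ ∣ u) : IsSeg e (shift u A) := by
  rw [isSeg_shift_iff]
  refine h.congr ?_
  have := two_dvd_mul_varpi.2 hu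
  rw [← dvd_neg] at this
  convert this using 1
  ring

theorem IsSeg.two_dvd_sub {e e' : GaussianInt} {A : GaussianInt × GaussianInt} (h : IsSeg e A)
    (h' : IsSeg e' A) : 2 ∣ e' - e := by
  have := dvd_sub h.2 h'.2
  convert this using 1
  ring

theorem odd_eq_mod_two {d e : GaussianInt} (hd : ¬ ϖ ∣ d) (he : ¬ ϖ ∣ e) :
    2 ∣ d - e ∨ 2 ∣ d - e - ϖ := by
  obtain ⟨w, hw⟩ := dvd_sub_of_not_dvd hd he
  by_cases h : ϖ ∣ w
  · left
    rw [hw]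
    exact two_dvd_mul_varpi.2 h
  · right
    obtain ⟨v, rfl⟩ := not_dvd_iff.1 h
    rw [hw, show ϖ * (1 + ϖ * v) - ϖ = ϖ * (ϖ * v) by ring]
    exact two_dvd_mul_varpi.2 ⟨v, rfl⟩

/-- Each unit interval has exactly one orientation of the given type. -/
theorem isSeg_or_isSeg {e z d : GaussianInt} (he : ¬ ϖ ∣ e) (hd : IsDirection d) :
    IsSeg e (z, z + d) ∨ IsSeg e (z + d, z) := by
  have h1 : ¬ ϖ ∣ e - ϖ * z := by
    rwa [dvd_sub_left (dvd_mul_right ϖ z)]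
  rcases odd_eq_mod_two hd.not_dvd h1 with h | h
  · left
    refine ⟨by simpa using hd, ?_⟩
    convert h using 1
    simp only [ϖ]
    ring
  · right
    refine ⟨by simpa using hd.neg, ?_⟩
    have h2 : 2 ∣ ϖ * (1 + I * d) :=
      two_dvd_mul_varpi.2 (dvd_add_of_not_dvd (IsDirection.not_dvd (Or.inl rfl)) hd.I_mul.not_dvd)
    have := dvd_add h h2
    convert this using 1
    simp only [ϖ]
    linear_combination (-d) * I_mul_I

theorem IsSeg.not_swap {e y z : GaussianInt} (h : IsSeg e (y, z)) : ¬ IsSeg e (z, y) := by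
  intro h'
  have h1 := dvd_sub h.2 h'.2
  have h2 : 2 ∣ ϖ * (-I * (z - y)) := by
    convert h1 using 1
    simp only [ϖ]
    linear_combination (y - z) * I_mul_I
  rw [two_dvd_mul_varpi] at h2
  refine h.1.I_mul.neg.not_dvd ?_
  convert h2 using 1
  ring

/-- Two segments of the same type with the same origin or end have parallel directions. -/
theorem IsSeg.end_eq {e p v v' : GaussianInt} (h : IsSeg e (p, v)) (h' : IsSeg e (p, v')) :
    v' = v ∨ v' - p = -(v - p) := by
  have h2 := dvd_sub h.2 h'.2
  have := IsDirection.eq_or_eq_neg h.1 h'.1 (by convert h2 using 1; simp)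
  simpa using this

theorem IsSeg.start_eq {e p p' v : GaussianInt} (h : IsSeg e (p, v)) (h' : IsSeg e (p', v)) :
    p' = p ∨ v - p' = -(v - p) := by
  have h2 := dvd_mul_of_dvd_right (dvd_sub h.2 h'.2) I
  have := IsDirection.eq_or_eq_neg h.1 h'.1 (by
    convert h2 using 1
    simp only
    linear_combination (p' - p) * I_mul_I)
  simpa using this

theorem exists_isSeg_to {e : GaussianInt} (he : ¬ ϖ ∣ e) (v : GaussianInt) :
    ∃ p, IsSeg e (p, v) := by
  rcases isSeg_or_isSeg (z := v) he (d := 1) (Or.inl rfl) with h | h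
  · have := isSeg_next_iff (z := v - I) (d := I) (e := e) (-1)
    simp only [sub_add_cancel, Units.val_neg, Units.val_one, Int.cast_neg, Int.cast_one, neg_mul,
      one_mul, I_mul_I, neg_neg] at this
    exact ⟨v - I, this.1 h⟩
  · exact ⟨_, h⟩

theorem sign_cancel {s s' : ℤˣ} {d : GaussianInt} (hd : d ≠ 0)
    (h : ((s : ℤ) : GaussianInt) * I * d = ((s' : ℤ) : GaussianInt) * I * d) : s = s' := by
  have h1 := mul_right_cancel₀ (by decide : I ≠ 0) (mul_right_cancel₀ hd h)
  exact Units.ext (Int.cast_injective h1)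

/-! ### Curves -/

/-- `x` is a complete curve whose turn at the vertex `x k` is `b k`. -/
def Crv (b : ℤ → ℤˣ) (x : ℤ → GaussianInt) : Prop :=
  ∀ k : ℤ, IsDirection (x (k + 1) - x k) ∧
    x (k + 2) - x (k + 1) = ((b (k + 1) : ℤ) : GaussianInt) * I * (x (k + 1) - x k)

/-- The turn at the vertex `x (k + 1)` is `a k` on one side and `b (k + 1)` on the other, whence the
offset. -/
theorem IsCompleteCurveOf.crv {a : ℤ → ℤˣ} {x : ℤ → GaussianInt} (h : IsCompleteCurveOf a x) :
    Crv (fun k => a (-1 + k)) x := by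
  intro k
  simpa using h k

theorem Crv.isCompleteCurveOf {b : ℤ → ℤˣ} {x : ℤ → GaussianInt} (h : Crv b x) :
    IsCompleteCurveOf (fun k => b (1 + k)) x := by
  intro k
  simpa [add_comm] using h k

theorem Crv.shift {b : ℤ → ℤˣ} {x : ℤ → GaussianInt} (h : Crv b x) (r : ℤ) :
    Crv (fun k => b (r + k)) fun k => x (r + k) := by
  intro k
  simpa [add_assoc] using h (r + k)

theorem Crv.isSeg {b : ℤ → ℤˣ} {x : ℤ → GaussianInt} {e : GaussianInt} (h : Crv b x)
    {k : ℤ} (hk : IsSeg e (x k, x (k + 1))) (l : ℤ) : IsSeg e (x l, x (l + 1)) := by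
  have step : ∀ l, IsSeg e (x (l + 1), x (l + 2)) ↔ IsSeg e (x l, x (l + 1)) := by
    intro l
    have := isSeg_next_iff (e := e) (z := x l) (d := x (l + 1) - x l) (b (l + 1))
    rwa [add_sub_cancel, ← (h l).2, add_sub_cancel] at this
  have main : ∀ m : ℤ, IsSeg e (x (k + m), x (k + m + 1)) := by
    intro m
    induction m using Int.induction_on with
    | zero => simpa using hk
    | succ m ih => simpa [add_assoc] using (step _).2 ih
    | pred m ih =>
      apply (step _).1
      convert ih using 3 <;> ring
  simpa using main (l - k)

/-- Two steps of a curve. -/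
theorem Crv.two_step {b : ℤ → ℤˣ} {x : ℤ → GaussianInt} (h : Crv b x) (k : ℤ) :
    ∃ d, IsDirection d ∧ x (k + 2) = x k + ϖ * d := by
  obtain ⟨h1, h2⟩ := h k
  rcases Int.units_eq_one_or (b (k + 1)) with hb | hb
  · refine ⟨_, h1, ?_⟩
    rw [hb] at h2
    simp only [ϖ]
    push_cast at h2
    linear_combination h2
  · refine ⟨_, h1.I_mul.neg, ?_⟩
    rw [hb] at h2
    simp only [ϖ]
    push_cast at h2
    linear_combination h2 + (x (k + 1) - x k) * I_mul_I

theorem Crv.two_mul_dvd {b : ℤ → ℤˣ} {x : ℤ → GaussianInt} (h : Crv b x) (k : ℤ) :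
    ϖ ∣ x (2 * k) - x 0 := by
  induction k using Int.induction_on with
  | zero => simp
  | succ k ih =>
    obtain ⟨d, -, hd⟩ := h.two_step (2 * k)
    rw [show (2 : ℤ) * (k + 1) = 2 * k + 2 by ring, hd, add_sub_right_comm]
    exact dvd_add ih (dvd_mul_right _ _)
  | pred k ih =>
    obtain ⟨d, -, hd⟩ := h.two_step (2 * (-k - 1))
    rw [show (2 : ℤ) * (-k - 1) + 2 = 2 * -k by ring] at hd
    rw [hd, add_sub_right_comm] at ih
    exact (dvd_add_left (dvd_mul_right _ _)).1 ih

/-- A step `d` followed by a turn `±1` has sum `ϖ * d` or `ϖ * (-I * d)`. Since the turns at `2k +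
1` and `2k + 3` are opposite, the net rotation from one such sum to the next is the turn at `2k +
2`. -/
theorem Crv.derived {b : ℤ → ℤˣ} {x : ℤ → GaussianInt} (h : Crv b x) (hb : Toep 1 b) :
    ∃ x' : ℤ → GaussianInt, x' 0 = 0 ∧ (∀ k, x (2 * k) = x 0 + ϖ * x' k) ∧
      Crv (fun k => b (2 * k)) x' := by
  choose x' hx' using h.two_mul_dvd
  refine ⟨x', ?_, fun k => by rw [← hx']; ring, fun k => ?_⟩
  · have := hx' 0
    simp only [mul_zero, sub_self] at this
    exact (mul_eq_zero.1 this.symm).resolve_left varpi_ne_zero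
  have e0 := hx' k
  have e1 := hx' (k + 1)
  have e2 := hx' (k + 2)
  rw [show (2 : ℤ) * (k + 1) = 2 * k + 2 by ring] at e1
  rw [show (2 : ℤ) * (k + 2) = 2 * k + 4 by ring] at e2
  obtain ⟨d1, s1⟩ := h (2 * k)
  obtain ⟨-, s2⟩ := h (2 * k + 1)
  obtain ⟨-, s3⟩ := h (2 * k + 2)
  have hs := hb.alternate k
  rw [show 2 * k + 1 + 1 = 2 * k + 2 by ring, show 2 * k + 1 + 2 = 2 * k + 3 by ring] at s2
  rw [show 2 * k + 2 + 1 = 2 * k + 3 by ring, show 2 * k + 2 + 2 = 2 * k + 4 by ring, hs] at s3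
  simp only [show 2 * (k + 1) = 2 * k + 2 by ring]
  set c : GaussianInt := ((b (2 * k + 2) : ℤ) : GaussianInt)
  rcases Int.units_eq_one_or (b (2 * k + 1)) with hb | hb
  · rw [hb] at s1 s3
    push_cast at s1 s3
    have f : x' (k + 1) - x' k = x (2 * k + 1) - x (2 * k) := by
      apply mul_left_cancel₀ varpi_ne_zero
      simp only [ϖ] at *
      linear_combination e0 - e1 + s1
    refine ⟨f ▸ d1, ?_⟩
    rw [f]
    apply mul_left_cancel₀ varpi_ne_zero
    simp only [ϖ] at *
    linear_combination e1 - e2 + s3 + (1 - I) * s2 + (1 - I) * c * I * s1 -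
      (x (2 * k + 1) - x (2 * k)) * c * I * I_mul_I
  · rw [hb] at s1 s3
    push_cast at s1 s3
    have f : x' (k + 1) - x' k = -(I * (x (2 * k + 1) - x (2 * k))) := by
      apply mul_left_cancel₀ varpi_ne_zero
      simp only [ϖ] at *
      linear_combination e0 - e1 + s1 + (x (2 * k + 1) - x (2 * k)) * I_mul_I
    refine ⟨f ▸ d1.I_mul.neg, ?_⟩
    rw [f]
    apply mul_left_cancel₀ varpi_ne_zero
    simp only [ϖ] at *
    linear_combination e1 - e2 + s3 + (1 + I) * s2 + (1 + I) * c * I * s1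

/-! ### Toeplitz functions on the plane -/

/-- `t` alternates on the odd multiples of `(1 + i) ^ j` about the centre `c` for each `j < n`. -/
def PT (n : ℕ) (c : GaussianInt) (t : GaussianInt → ℤˣ) : Prop :=
  ∀ j < n, ∀ w, t (c + ϖ ^ j * (1 + ϖ * w)) = χ w * t (c + ϖ ^ j)

theorem PT.mono {m n : ℕ} {c : GaussianInt} {t : GaussianInt → ℤˣ} (h : PT n c t) (hmn : m ≤ n) :
    PT m c t := fun j hj => h j (hj.trans_le hmn)

theorem PT.apply_add {n : ℕ} {c : GaussianInt} {t : GaussianInt → ℤˣ} (h : PT n c t) {j : ℕ}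
    (hj : j < n) (w y : GaussianInt) :
    t (c + ϖ ^ j * (1 + ϖ * w) + ϖ ^ (j + 1) * y) = χ y * t (c + ϖ ^ j * (1 + ϖ * w)) := by
  rw [show c + ϖ ^ j * (1 + ϖ * w) + ϖ ^ (j + 1) * y = c + ϖ ^ j * (1 + ϖ * (y + w)) by ring,
    h j hj, h j hj, χ_add, mul_assoc]

/-- The character `χ` is trivial on multiples of `ϖ`. This period is why a finite pattern avoiding
the centre sees only finitely many levels and can be copied. -/
theorem PT.periodic {n : ℕ} {c : GaussianInt} {t : GaussianInt → ℤˣ} (h : PT n c t) {j : ℕ}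
    (hj : j < n) (w : GaussianInt) {y : GaussianInt} (hy : ϖ ^ (j + 2) ∣ y) :
    t (c + ϖ ^ j * (1 + ϖ * w) + y) = t (c + ϖ ^ j * (1 + ϖ * w)) := by
  obtain ⟨v, rfl⟩ := hy
  rw [show ϖ ^ (j + 2) * v = ϖ ^ (j + 1) * (ϖ * v) by ring, h.apply_add hj]
  simp

theorem PT.congr_centre {n : ℕ} {c c' : GaussianInt} {t : GaussianInt → ℤˣ} (h : PT n c t)
    (hc : ϖ ^ n ∣ c' - c) : PT n c' t := by
  obtain ⟨y, hy⟩ := hc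
  intro j hj w
  obtain ⟨i, rfl⟩ := Nat.exists_eq_add_of_lt hj
  have e : c' = c + ϖ ^ (j + i + 1) * y := by rw [← hy]; ring
  rw [show c' + ϖ ^ j * (1 + ϖ * w) = c + ϖ ^ j * (1 + ϖ * (w + ϖ ^ i * y)) by rw [e]; ring,
    show c' + ϖ ^ j = c + ϖ ^ j * (1 + ϖ * (ϖ ^ i * y)) by rw [e]; ring, h j hj, h j hj, χ_add,
    mul_assoc]

theorem PT.translate {n : ℕ} {c : GaussianInt} {t : GaussianInt → ℤˣ} (h : PT n c t)
    (u : GaussianInt) : PT n (c - u) fun z => t (z + u) := by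
  intro j hj w
  have := h j hj w
  simp only
  rwa [show c - u + ϖ ^ j * (1 + ϖ * w) + u = c + ϖ ^ j * (1 + ϖ * w) by ring,
    show c - u + ϖ ^ j + u = c + ϖ ^ j by ring]

theorem pt_succ_iff {n : ℕ} {c : GaussianInt} {t : GaussianInt → ℤˣ} :
    PT (n + 1) c t ↔ PT 1 c t ∧ PT n 0 fun w => t (c + ϖ * w) := by
  have e : ∀ j w, c + ϖ * (0 + ϖ ^ j * w) = c + ϖ ^ (j + 1) * w := fun j w => by ring
  have e' : ∀ j, c + ϖ * (0 + ϖ ^ j) = c + ϖ ^ (j + 1) := fun j => by ring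
  constructor
  · intro h
    refine ⟨h.mono (by omega), fun j hj w => ?_⟩
    simp only [e, e']
    exact h (j + 1) (by omega) w
  · rintro ⟨h1, h2⟩ j hj w
    cases j with
    | zero => exact h1 0 (by omega) w
    | succ j =>
      have := h2 j (by omega) w
      simpa only [e, e'] using this

/-- A Toeplitz function has, at each level, only one centre, and it is determined by finitely many
values. -/
theorem PT.dvd_of_local {n : ℕ} {c y : GaussianInt} {t : GaussianInt → ℤˣ} (h : PT (n + 1) c t)
    (hy : ∀ j < n, ∀ w ∈ ({0, I, ϖ, I + ϖ} : Set GaussianInt),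
      t (y + ϖ ^ j * (1 + ϖ * w)) = χ w * t (y + ϖ ^ j)) : ϖ ^ n ∣ y - c := by
  rcases dvd_or_eq n (y - c) with h' | ⟨j, hj, a, ha⟩
  · exact h'
  exfalso
  -- For a suitable `s`, the point `y + ϖ ^ j (1 + ϖ s)` has exact level `j + 1` about `c`.
  -- Replacing `s` by `s + ϖ` adds `ϖ ^ (j + 2)`: the hypothesis on `y` keeps the value, the centre
  -- `c` flips it. The four test points cover both parities of `a`.
  have key : ∀ s w, s ∈ ({0, I, ϖ, I + ϖ} : Set GaussianInt) →
      s + ϖ ∈ ({0, I, ϖ, I + ϖ} : Set GaussianInt) →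
      1 + ϖ * a + (1 + ϖ * s) = ϖ * (1 + ϖ * w) → False := by
    intro s w hs hs' hsw
    have e1 := hy j hj s hs
    have e2 := hy j hj _ hs'
    rw [χ_add, show χ ϖ = 1 from rfl, mul_one, ← e1] at e2
    have e3 := h.apply_add (show j + 1 < n + 1 by omega) w 1
    rw [show c + ϖ ^ (j + 1) * (1 + ϖ * w) = y + ϖ ^ j * (1 + ϖ * s) by
      linear_combination (-ha) - ϖ ^ j * hsw] at e3
    rw [show y + ϖ ^ j * (1 + ϖ * (s + ϖ)) = y + ϖ ^ j * (1 + ϖ * s) + ϖ ^ (j + 1 + 1) * 1 by ring,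
      e3, show χ 1 = -1 from rfl, neg_one_mul] at e2
    exact units_ne_neg_self _ e2.symm
  by_cases hd : ϖ ∣ a
  · obtain ⟨v, rfl⟩ := hd
    refine key I v (by simp) (by simp) ?_
    simp only [ϖ]
    linear_combination (I_mul_I)
  · obtain ⟨v, rfl⟩ := not_dvd_iff.1 hd
    refine key 0 (v - I) (by simp) (by simp) ?_
    simp only [ϖ]
    linear_combination (2 + I) * I_mul_I

theorem PT.dvd_centre {n : ℕ} {c c' : GaussianInt} {t : GaussianInt → ℤˣ} (h : PT (n + 1) c t)
    (h' : PT n c' t) : ϖ ^ n ∣ c' - c := h.dvd_of_local fun j hj w _ => h' j hj w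

/-! ### Toeplitz functions and curves -/

/-- A curve associated to a Toeplitz sequence is guided by a Toeplitz function on the plane. -/
theorem Crv.exists_pt {n : ℕ} : ∀ {b : ℤ → ℤˣ} {x : ℤ → GaussianInt}, Crv b x → Toep n b →
    ∃ t, PT n (x 0) t ∧ ∀ k, ¬ ϖ ^ n ∣ x k - x 0 → t (x k) = b k := by
  induction n with
  | zero => exact fun _ _ => ⟨fun _ => 1, fun j hj => absurd hj (by omega), fun k hk => by simp at hk⟩
  | succ n ih =>
    intro b x hx hb
    obtain ⟨hb1, hb2⟩ := toep_succ_iff.1 hb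
    obtain ⟨x', hx0, hx', hc⟩ := hx.derived hb1
    obtain ⟨t', ht', htb⟩ := ih hc hb2
    classical
    -- Along odd vertices each double step is `ϖ * d` with `χ d = -1`, in agreement with the
    -- alternating turns.
    have hodd : ∀ m : ℤ, ∃ w, x (2 * m + 1) = x 1 + ϖ * w ∧ b (2 * m + 1) = χ w * b 1 := by
      intro m
      induction m using Int.induction_on with
      | zero => exact ⟨0, by simp, by simp⟩
      | succ k ih =>
        obtain ⟨w, hw, hbw⟩ := ih
        obtain ⟨d, hd, hxd⟩ := hx.two_step (2 * k + 1)
        refine ⟨d + w, ?_, ?_⟩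
        · rw [show (2 : ℤ) * (k + 1) + 1 = 2 * k + 1 + 2 by ring, hxd, hw]
          ring
        · rw [show (2 : ℤ) * (k + 1) + 1 = 2 * k + 3 by ring, hb.alternate, hbw, χ_add, hd.χ_eq]
          simp
      | pred k ih =>
        obtain ⟨w, hw, hbw⟩ := ih
        obtain ⟨d, hd, hxd⟩ := hx.two_step (2 * (-k - 1) + 1)
        have hal := hb.alternate (-(k : ℤ) - 1)
        rw [show (2 : ℤ) * (-k - 1) + 1 + 2 = 2 * -k + 1 by ring, hw] at hxd
        rw [show (2 : ℤ) * (-k - 1) + 3 = 2 * -k + 1 by ring, hbw] at hal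
        refine ⟨-d + w, by linear_combination -hxd, ?_⟩
        rw [χ_add, hd.neg.χ_eq, neg_one_mul, neg_mul, hal, neg_neg]
    have h01 : ¬ ϖ ∣ x 1 - x 0 := by simpa using (hx 0).1.not_dvd
    -- On the class of `x 0` the function comes from the derived curve; on the other class it is the
    -- character `χ`, based at `x 1`.
    refine ⟨fun z => if ϖ ∣ z - x 0 then t' (divϖ (z - x 0)) else χ (divϖ (z - x 1)) * b 1, ?_, ?_⟩
    · rw [pt_succ_iff]
      constructor
      · intro j hj w
        obtain rfl : j = 0 := by omega
        obtain ⟨a, ha⟩ := dvd_sub_of_not_dvd (show ¬ ϖ ∣ 1 from Or.inl rfl |> IsDirection.not_dvd) h01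
        have h1 : ¬ ϖ ∣ x 0 + ϖ ^ 0 * (1 + ϖ * w) - x 0 := by
          simpa using not_dvd_one_add w
        have h2 : ¬ ϖ ∣ x 0 + ϖ ^ 0 - x 0 := by
          simpa using IsDirection.not_dvd (Or.inl rfl)
        simp only
        rw [if_neg h1, if_neg h2,
          show x 0 + ϖ ^ 0 * (1 + ϖ * w) - x 1 = ϖ * (w + a) by linear_combination ha,
          show x 0 + ϖ ^ 0 - x 1 = ϖ * a by linear_combination ha, divϖ_mul, divϖ_mul, χ_add,
          mul_assoc]
      · have : (fun w => if ϖ ∣ x 0 + ϖ * w - x 0 then t' (divϖ (x 0 + ϖ * w - x 0))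
            else χ (divϖ (x 0 + ϖ * w - x 1)) * b 1) = t' := by
          funext w
          simp
        rw [this, ← hx0]
        exact ht'
    · intro k hk
      rcases Int.even_or_odd' k with ⟨m, rfl | rfl⟩
      · rw [hx', add_sub_cancel_left] at hk
        rw [hx']
        simp only [dvd_mul_right, if_true, divϖ_mul, add_sub_cancel_left]
        apply htb
        rwa [hx0, sub_zero, ← mul_dvd_mul_iff_left varpi_ne_zero, ← pow_succ']
      · obtain ⟨w, hw, hbw⟩ := hodd m
        rw [hw, hbw]
        simp only
        rw [if_neg, add_sub_cancel_left, divϖ_mul]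
        rw [add_sub_right_comm, dvd_add_left (dvd_mul_right _ _)]
        exact h01

/-- A curve guided by a Toeplitz function is associated to a Toeplitz sequence. -/
theorem Crv.exists_toep {n : ℕ} : ∀ {c : GaussianInt} {t : GaussianInt → ℤˣ} {x : ℤ → GaussianInt},
    Crv (fun k => t (x k)) x → PT n c t →
    ∃ r : ℤ, ϖ ^ n ∣ x r - c ∧ Toep n fun k => t (x (r + k)) := by
  induction n with
  | zero => exact fun _ _ => ⟨0, by simp, fun j hj => absurd hj (by omega)⟩
  | succ n ih =>
    intro c t x hx ht
    obtain ⟨q, hq⟩ : ∃ q : ℤ, ϖ ∣ x q - c := by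
      by_cases h : ϖ ∣ x 0 - c
      · exact ⟨0, h⟩
      · refine ⟨1, ?_⟩
        have := dvd_add_of_not_dvd h (hx 0).1.not_dvd
        simpa using this
    obtain ⟨ht1, ht2⟩ := pt_succ_iff.1 ht
    have hxq := hx.shift q
    -- Odd vertices are off the class of `c`, where a displacement `ϖ * d` flips `t`. The derived
    -- curve is then guided by `w ↦ t (c + ϖ * w)`.
    have halt : Toep 1 fun k => t (x (q + k)) := by
      apply toep_one_of_forall
      intro m
      obtain ⟨d, hd, hxd⟩ := hx.two_step (q + (2 * m + 1))
      have hodd : ¬ ϖ ∣ x (q + (2 * m + 1)) - c := by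
        intro h
        have hev := (hx.shift q).two_mul_dvd m
        simp only [add_zero] at hev
        apply (hx (q + 2 * m)).1.not_dvd
        have := dvd_sub h (dvd_add hev hq)
        rwa [sub_add_sub_cancel, sub_sub_sub_cancel_right, ← add_assoc] at this
      obtain ⟨w, hw⟩ := not_dvd_iff.1 hodd
      have e : x (q + (2 * m + 1)) = c + ϖ ^ 0 * (1 + ϖ * w) := by rw [pow_zero, one_mul, ← hw]; ring
      have := ht1.apply_add (show 0 < 1 by omega) w d
      rw [← e, hd.χ_eq, neg_one_mul, zero_add, pow_one, ← hxd] at this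
      rw [← this]
      congr 2
      ring
    obtain ⟨x', hx0, hx', hc⟩ := hxq.derived halt
    simp only [add_zero] at hx'
    obtain ⟨a, ha⟩ := hq
    have hx'' : ∀ k, x (q + 2 * k) = c + ϖ * (a + x' k) := fun k => by
      rw [hx']
      linear_combination ha
    have hcrv : Crv (fun k => t (c + ϖ * (a + x' k))) fun k => a + x' k := by
      intro k
      have := hc k
      simp only at this ⊢
      rw [hx''] at this
      simpa using this
    obtain ⟨r, hr, hT⟩ := ih hcrv ht2
    refine ⟨q + 2 * r, ?_, toep_succ_iff.2 ⟨?_, ?_⟩⟩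
    · rw [hx'', add_sub_cancel_left, pow_succ']
      exact mul_dvd_mul_left _ (by simpa using hr)
    · convert halt.shift r using 4
      ring
    · convert hT using 3
      rw [← hx'']
      congr 1
      ring

/-- Each passage to the derived curve halves the index and divides the displacement by `ϖ`; odd
indices give displacements prime to `ϖ`. -/
theorem Crv.pow_dvd_iff {n : ℕ} : ∀ {b : ℤ → ℤˣ} {x : ℤ → GaussianInt}, Crv b x → Toep n b →
    ∀ k : ℤ, ϖ ^ n ∣ x k - x 0 ↔ 2 ^ n ∣ k := by
  induction n with
  | zero => simp
  | succ n ih =>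
    intro b x hx hb k
    obtain ⟨hb1, hb2⟩ := toep_succ_iff.1 hb
    obtain ⟨x', hx0, hx', hc⟩ := hx.derived hb1
    rcases Int.even_or_odd' k with ⟨m, rfl | rfl⟩
    · have := ih hc hb2 m
      rw [hx0, sub_zero] at this
      rw [hx', add_sub_cancel_left, pow_succ', pow_succ', mul_dvd_mul_iff_left varpi_ne_zero, this,
        mul_dvd_mul_iff_left two_ne_zero]
    · constructor
      · intro h
        have h1 := (dvd_pow_self ϖ (Nat.succ_ne_zero n)).trans h
        have h2 := dvd_sub h1 (hx.two_mul_dvd m)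
        rw [sub_sub_sub_cancel_right] at h2
        exact absurd h2 (hx (2 * m)).1.not_dvd
      · intro h
        have := (dvd_pow_self (2 : ℤ) (Nat.succ_ne_zero n)).trans h
        omega

/-- The centre of a Toeplitz function on a curve is the centre of the associated sequence. -/
theorem Crv.toep_of_pt {n : ℕ} {t : GaussianInt → ℤˣ} {x : ℤ → GaussianInt}
    (hx : Crv (fun k => t (x k)) x) (ht : PT n (x 0) t) : Toep n fun k => t (x k) := by
  obtain ⟨r, hr, hT⟩ := hx.exists_toep ht
  have h1 := ((hx.shift r).pow_dvd_iff hT (-r)).1 (by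
    simp only [add_neg_cancel, add_zero]
    rwa [← dvd_neg, neg_sub])
  obtain ⟨y, hy⟩ := h1
  convert hT.shift y using 4
  linarith

theorem Crv.turn_unique {b b' : ℤ → ℤˣ} {x : ℤ → GaussianInt} (h : Crv b x) (h' : Crv b' x) :
    b = b' := by
  funext k
  have h1 := (h (k - 1)).2
  rw [(h' (k - 1)).2] at h1
  rw [sub_add_cancel] at h1
  have hd := (h (k - 1)).1.ne_zero
  rw [sub_add_cancel] at hd
  exact (sign_cancel hd h1).symm

/-! ### The segments of a folding curve contain translates of all bounded sets of segments -/

open Classical in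
/-- The alternating turn equal to `1` at `z₀`, on the vertices congruent to `z₀` modulo `1 + i`. -/
noncomputable def sgn (z₀ z : GaussianInt) : ℤˣ := if 2 ∣ z - z₀ then 1 else -1

theorem sgn_add {z₀ z y : GaussianInt} (hy : 2 ∣ y) : sgn z₀ (z + y) = sgn z₀ z := by
  rw [sgn, sgn, add_sub_right_comm]
  by_cases h : 2 ∣ z - z₀
  · rw [if_pos h, if_pos ((dvd_add_left hy).2 h)]
  · rw [if_neg h, if_neg (mt (dvd_add_left hy).1 h)]

theorem sgn_add_varpi_mul {z₀ z d : GaussianInt} (hz : ϖ ∣ z - z₀) (hd : ¬ ϖ ∣ d) :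
    sgn z₀ (z + ϖ * d) = -sgn z₀ z := by
  obtain ⟨w, hw⟩ := hz
  rw [sgn, sgn, add_sub_right_comm, hw, ← mul_add, two_dvd_mul_varpi, two_dvd_mul_varpi]
  by_cases h : ϖ ∣ w
  · rw [if_pos h, if_neg]
    rwa [dvd_add_right h]
  · rw [if_neg h, if_pos (dvd_add_of_not_dvd h hd), neg_neg]

/-- `P` is the segment which, after folding along the turns `sgn z₀` and rescaling about `c`, gives
two consecutive segments one of which is `A`. -/
def Par (c z₀ : GaussianInt) (A P : GaussianInt × GaussianInt) : Prop :=
  (ϖ ∣ A.2 - z₀ ∧ c + ϖ * P.1 = A.1 ∧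
    c + ϖ * P.2 = A.2 + ((sgn z₀ A.2 : ℤ) : GaussianInt) * I * (A.2 - A.1)) ∨
  (ϖ ∣ A.1 - z₀ ∧ c + ϖ * P.2 = A.2 ∧
    c + ϖ * P.1 = A.1 + ((sgn z₀ A.1 : ℤ) : GaussianInt) * I * (A.2 - A.1))

theorem IsDirection.dvd_sub_iff {p q z : GaussianInt} (h : IsDirection (q - p)) :
    ϖ ∣ q - z ↔ ¬ ϖ ∣ p - z := by
  have := h.not_dvd
  simp only [varpi_dvd_iff, Zsqrtd.re_sub, Zsqrtd.im_sub] at this ⊢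
  omega

theorem IsDirection.dvd_add_turn {d : GaussianInt} (h : IsDirection d) (s : ℤˣ) :
    ϖ ∣ d + ((s : ℤ) : GaussianInt) * I * d :=
  dvd_add_of_not_dvd h.not_dvd (h.turn s).not_dvd

theorem exists_par {c z₀ e : GaussianInt} (hc : ¬ ϖ ∣ c - z₀) {A : GaussianInt × GaussianInt}
    (hA : IsSeg e A) : ∃ P, Par c z₀ A P := by
  by_cases h : ϖ ∣ A.2 - z₀
  · have h1 := hA.1.dvd_sub_iff.1 h
    have h2 := dvd_sub_of_not_dvd h1 hc
    rw [sub_sub_sub_cancel_right] at h2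
    have h3 := dvd_add h2 (hA.1.dvd_add_turn (sgn z₀ A.2))
    obtain ⟨p, hp⟩ := h2
    obtain ⟨q, hq⟩ := h3
    exact ⟨(p, q), Or.inl ⟨h, by linear_combination -hp, by linear_combination -hq⟩⟩
  · have h1 : ϖ ∣ A.1 - z₀ := by
      by_contra h1
      exact h (hA.1.dvd_sub_iff.2 h1)
    have h2 := dvd_sub_of_not_dvd h hc
    rw [sub_sub_sub_cancel_right] at h2
    have h3 := dvd_sub h2 (hA.1.dvd_add_turn (-sgn z₀ A.1))
    obtain ⟨q, hq⟩ := h2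
    obtain ⟨p, hp⟩ := h3
    refine ⟨(p, q), Or.inr ⟨h1, by linear_combination -hq, ?_⟩⟩
    push_cast at hp
    linear_combination -hp

/-- All parents have the same type whatever `A` is, so the parents of a walk can again form a walk.
-/
theorem Par.isSeg {c z₀ e : GaussianInt} {A P : GaussianInt × GaussianInt} (hA : IsSeg e A)
    (h : Par c z₀ A P) : IsSeg (z₀ - c) P := by
  -- Where `sgn z₀` is `-1`, the difference with `z₀` is an odd multiple of `ϖ`; one more odd
  -- multiple makes it divisible by `2`.
  have hodd : ∀ z, ϖ ∣ z - z₀ → ¬ 2 ∣ z - z₀ → ∀ d, IsDirection d → 2 ∣ z - z₀ + ϖ * d := by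
    rintro z ⟨w, hw⟩ h2 d hd
    rw [hw, two_dvd_mul_varpi] at h2
    rw [hw, ← mul_add, two_dvd_mul_varpi]
    exact dvd_add_of_not_dvd h2 hd.not_dvd
  have hd := hA.1
  rcases h with ⟨h1, h2, h3⟩ | ⟨h1, h2, h3⟩
  · rw [sgn] at h3
    split_ifs at h3 with h
    · push_cast at h3
      have e1 : P.2 - P.1 = A.2 - A.1 := by
        apply mul_left_cancel₀ varpi_ne_zero
        simp only [ϖ] at *
        linear_combination h3 - h2
      refine ⟨e1 ▸ hd, ?_⟩
      convert h using 1
      simp only [ϖ] at *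
      linear_combination h2 + e1
    · push_cast at h3
      have e1 : P.2 - P.1 = -(I * (A.2 - A.1)) := by
        apply mul_left_cancel₀ varpi_ne_zero
        simp only [ϖ] at *
        linear_combination h3 - h2 + (A.2 - A.1) * I_mul_I
      refine ⟨e1 ▸ hd.I_mul.neg, ?_⟩
      convert hodd _ h1 h _ hd.neg using 1
      simp only [ϖ] at *
      linear_combination h2 + e1
  · rw [sgn] at h3
    split_ifs at h3 with h
    · push_cast at h3
      have e1 : P.2 - P.1 = -(I * (A.2 - A.1)) := by
        apply mul_left_cancel₀ varpi_ne_zero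
        simp only [ϖ] at *
        linear_combination h2 - h3 + (A.2 - A.1) * I_mul_I
      refine ⟨e1 ▸ hd.I_mul.neg, ?_⟩
      convert h using 1
      simp only [ϖ] at *
      linear_combination h3 + e1
    · push_cast at h3
      have e1 : P.2 - P.1 = A.2 - A.1 := by
        apply mul_left_cancel₀ varpi_ne_zero
        simp only [ϖ] at *
        linear_combination h2 - h3
      refine ⟨e1 ▸ hd, ?_⟩
      convert hodd _ h1 h _ hd.I_mul.neg using 1
      simp only [ϖ] at *
      linear_combination h3 + e1 + (A.2 - A.1) * I_mul_I

theorem Par.shift {c z₀ u : GaussianInt} {A P : GaussianInt × GaussianInt} (h : Par c z₀ A P)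
    (hu : ϖ ∣ u) : Par c z₀ (shift (ϖ * u) A) (shift u P) := by
  have h2 : 2 ∣ ϖ * u := two_dvd_mul_varpi.2 hu
  rcases h with ⟨h1, h3, h4⟩ | ⟨h1, h3, h4⟩
  · left
    simp only [Paperfolding.shift, sgn_add h2]
    refine ⟨?_, by linear_combination h3, by linear_combination h4⟩
    rw [add_sub_right_comm]
    exact dvd_add h1 (dvd_mul_right _ _)
  · right
    simp only [Paperfolding.shift, sgn_add h2]
    refine ⟨?_, by linear_combination h3, by linear_combination h4⟩
    rw [add_sub_right_comm]
    exact dvd_add h1 (dvd_mul_right _ _)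

theorem Par.of_dvd_snd {c z₀ e : GaussianInt} {A P : GaussianInt × GaussianInt} (hA : IsSeg e A)
    (h : Par c z₀ A P) (h2 : ϖ ∣ A.2 - z₀) : c + ϖ * P.1 = A.1 ∧
      c + ϖ * P.2 = A.2 + ((sgn z₀ A.2 : ℤ) : GaussianInt) * I * (A.2 - A.1) := by
  rcases h with ⟨-, h⟩ | ⟨h1, -⟩
  · exact h
  · exact absurd h1 (hA.1.dvd_sub_iff.1 h2)

theorem Par.of_dvd_fst {c z₀ e : GaussianInt} {A P : GaussianInt × GaussianInt} (hA : IsSeg e A)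
    (h : Par c z₀ A P) (h1 : ϖ ∣ A.1 - z₀) : c + ϖ * P.2 = A.2 ∧
      c + ϖ * P.1 = A.1 + ((sgn z₀ A.1 : ℤ) : GaussianInt) * I * (A.2 - A.1) := by
  rcases h with ⟨h2, -⟩ | ⟨-, h⟩
  · exact absurd h1 (hA.1.dvd_sub_iff.1 h2)
  · exact h

theorem eq_of_varpi_mul {c y z : GaussianInt} (h : c + ϖ * y = c + ϖ * z) : y = z :=
  mul_left_cancel₀ varpi_ne_zero (add_left_cancel h)

/-- `A` and `B` are opposite sides of a unit square, with opposite directions. -/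
def Opp (A B : GaussianInt × GaussianInt) : Prop :=
  ∃ s : ℤˣ, B.1 = A.2 + ((s : ℤ) : GaussianInt) * I * (A.2 - A.1) ∧
    B.2 = A.1 + ((s : ℤ) : GaussianInt) * I * (A.2 - A.1)

/-- `A` and `B` are equal, have a vertex in common and can be consecutive, or are opposite. -/
def Near (A B : GaussianInt × GaussianInt) : Prop :=
  A = B ∨ A.2 = B.1 ∨ B.2 = A.1 ∨ Opp A B ∨ Opp B A

theorem Near.symm {A B : GaussianInt × GaussianInt} (h : Near A B) : Near B A := by
  rcases h with h | h | h | h | h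
  · exact Or.inl h.symm
  · exact Or.inr (Or.inr (Or.inl h))
  · exact Or.inr (Or.inl h)
  · exact Or.inr (Or.inr (Or.inr (Or.inr h)))
  · exact Or.inr (Or.inr (Or.inr (Or.inl h)))

theorem Par.eq_of_follow {c z₀ e : GaussianInt} {A B P Q : GaussianInt × GaussianInt}
    (hA : IsSeg e A) (hB : IsSeg e B) (hP : Par c z₀ A P) (hQ : Par c z₀ B Q) (hAB : A.2 = B.1)
    (hz : ϖ ∣ A.2 - z₀)
    (hf : B.2 = A.2 + ((sgn z₀ A.2 : ℤ) : GaussianInt) * I * (A.2 - A.1)) : P = Q := by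
  obtain ⟨p1, p2⟩ := hP.of_dvd_snd hA hz
  obtain ⟨q1, q2⟩ := hQ.of_dvd_fst hB (hAB ▸ hz)
  rw [← hAB] at q2
  have hs : ((sgn z₀ A.2 : ℤ) : GaussianInt) * ((sgn z₀ A.2 : ℤ) : GaussianInt) = 1 := sign_mul_self _
  ext1
  · apply eq_of_varpi_mul (c := c)
    rw [q2, p1, hf]
    linear_combination (A.2 - A.1) * hs - (A.2 - A.1) * ((sgn z₀ A.2 : ℤ) : GaussianInt) *
      ((sgn z₀ A.2 : ℤ) : GaussianInt) * I_mul_I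
  · apply eq_of_varpi_mul (c := c)
    rw [p2, q1, hf]

theorem IsSeg.exists_turn {e : GaussianInt} {A B : GaussianInt × GaussianInt}
    (hA : IsSeg e A) (hB : IsSeg e B) (hAB : A.2 = B.1) :
    ∃ s : ℤˣ, B.2 = A.2 + ((s : ℤ) : GaussianInt) * I * (A.2 - A.1) := by
  have h1 : IsSeg e (B.1, A.2 + ((1 : ℤˣ) : ℤ) * I * (A.2 - A.1)) := by
    have := (isSeg_next_iff (e := e) (z := A.1) (d := A.2 - A.1) 1).2 (by simpa using hA)
    simpa [hAB] using this
  rcases h1.end_eq hB with h | h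
  · exact ⟨1, h⟩
  · refine ⟨-1, ?_⟩
    rw [← hAB] at h
    push_cast at h ⊢
    linear_combination h

/-- At a folded vertex the right turn gives two halves of one parent. The wrong turn gives the two
halves of opposite sides of a square, which is why `Near` has to include `Opp`. -/
theorem Par.of_follow {c z₀ e : GaussianInt} {A B P Q : GaussianInt × GaussianInt}
    (hA : IsSeg e A) (hB : IsSeg e B) (hP : Par c z₀ A P) (hQ : Par c z₀ B Q) (hAB : A.2 = B.1)
    (hz : ϖ ∣ A.2 - z₀) : P = Q ∨ Opp P Q := by
  obtain ⟨s, hs⟩ := hA.exists_turn hB hAB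
  by_cases h : s = sgn z₀ A.2
  · exact Or.inl (hP.eq_of_follow hA hB hQ hAB hz (h ▸ hs))
  right
  have h : s = -sgn z₀ A.2 := by
    rcases Int.units_eq_one_or s with h1 | h1 <;>
      rcases Int.units_eq_one_or (sgn z₀ A.2) with h2 | h2 <;> simp_all
  obtain ⟨p1, p2⟩ := hP.of_dvd_snd hA hz
  obtain ⟨q1, q2⟩ := hQ.of_dvd_fst hB (hAB ▸ hz)
  rw [← hAB] at q2
  rw [h] at hs
  have hss : ((sgn z₀ A.2 : ℤ) : GaussianInt) * ((sgn z₀ A.2 : ℤ) : GaussianInt) = 1 := sign_mul_self _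
  refine ⟨-sgn z₀ A.2, ?_, ?_⟩
  · apply eq_of_varpi_mul (c := c)
    push_cast at *
    generalize ((sgn z₀ A.2 : ℤ) : GaussianInt) = σ at *
    rw [q2, hs]
    linear_combination (-1) * p2 + σ * I * (p2 - p1)
  · apply eq_of_varpi_mul (c := c)
    push_cast at *
    generalize ((sgn z₀ A.2 : ℤ) : GaussianInt) = σ at *
    rw [q1, hs]
    linear_combination (-1) * p1 + σ * I * (p2 - p1) + (A.2 - A.1) * (σ * σ * I_mul_I - hss)

/-- A vertex outside the folded class survives the rescaling and remains the common vertex of the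
parents. -/
theorem Par.of_follow_of_not_dvd {c z₀ e : GaussianInt} {A B P Q : GaussianInt × GaussianInt}
    (hA : IsSeg e A) (hB : IsSeg e B) (hP : Par c z₀ A P) (hQ : Par c z₀ B Q) (hAB : A.2 = B.1)
    (hz : ¬ ϖ ∣ A.2 - z₀) : c + ϖ * P.2 = A.2 ∧ P.2 = Q.1 := by
  have h1 : ϖ ∣ A.1 - z₀ := by
    by_contra h
    exact hz (hA.1.dvd_sub_iff.2 h)
  have h2 : ϖ ∣ B.2 - z₀ := hB.1.dvd_sub_iff.2 (hAB ▸ hz)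
  obtain ⟨p1, p2⟩ := hP.of_dvd_fst hA h1
  obtain ⟨q1, q2⟩ := hQ.of_dvd_snd hB h2
  exact ⟨p1, eq_of_varpi_mul (c := c) (by rw [p1, q1, hAB])⟩

theorem Par.of_opp {c z₀ e : GaussianInt} {A B P Q : GaussianInt × GaussianInt}
    (hA : IsSeg e A) (hB : IsSeg e B) (hP : Par c z₀ A P) (hQ : Par c z₀ B Q) (h : Opp A B) :
    P.2 = Q.1 ∨ Q.2 = P.1 := by
  obtain ⟨s, h1, h2⟩ := h
  have hdir : IsDirection (A.2 - A.1) := hA.1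
  -- Corresponding ends of opposite sides differ by a diagonal of the square, an odd multiple of
  -- `ϖ`. Hence `sgn z₀` takes opposite values there, and the two parents meet head to tail.
  have key : B.2 = A.2 + ϖ * (divϖ (-(A.2 - A.1) + ((s : ℤ) : GaussianInt) * I * (A.2 - A.1))) ∧
      B.1 = A.1 + ϖ * (divϖ ((A.2 - A.1) + ((s : ℤ) : GaussianInt) * I * (A.2 - A.1))) ∧
      ¬ ϖ ∣ divϖ (-(A.2 - A.1) + ((s : ℤ) : GaussianInt) * I * (A.2 - A.1)) ∧
      ¬ ϖ ∣ divϖ ((A.2 - A.1) + ((s : ℤ) : GaussianInt) * I * (A.2 - A.1)) := by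
    rw [mul_divϖ (hdir.dvd_add_turn s), mul_divϖ (dvd_add_of_not_dvd hdir.neg.not_dvd
      (hdir.turn s).not_dvd)]
    refine ⟨by linear_combination h2, by linear_combination h1, ?_, ?_⟩
    · rcases Int.units_eq_one_or s with rfl | rfl
      · rw [show -(A.2 - A.1) + (((1 : ℤˣ) : ℤ) : GaussianInt) * I * (A.2 - A.1) =
          ϖ * (I * (A.2 - A.1)) by
            push_cast; simp only [ϖ]; linear_combination (-(A.2 - A.1)) * I_mul_I, divϖ_mul]
        exact hdir.I_mul.not_dvd
      · rw [show -(A.2 - A.1) + (((-1 : ℤˣ) : ℤ) : GaussianInt) * I * (A.2 - A.1) =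
          ϖ * (-(A.2 - A.1)) by push_cast; simp only [ϖ]; ring, divϖ_mul]
        exact hdir.neg.not_dvd
    · rcases Int.units_eq_one_or s with rfl | rfl
      · rw [show (A.2 - A.1) + (((1 : ℤˣ) : ℤ) : GaussianInt) * I * (A.2 - A.1) =
          ϖ * (A.2 - A.1) by push_cast; simp only [ϖ]; ring, divϖ_mul]
        exact hdir.not_dvd
      · rw [show (A.2 - A.1) + (((-1 : ℤˣ) : ℤ) : GaussianInt) * I * (A.2 - A.1) =
          ϖ * (-(I * (A.2 - A.1))) by
            push_cast; simp only [ϖ]; linear_combination ((A.2 - A.1)) * I_mul_I, divϖ_mul]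
        exact hdir.I_mul.neg.not_dvd
  obtain ⟨k1, k2, k3, k4⟩ := key
  by_cases hz : ϖ ∣ A.2 - z₀
  · have hz' : ϖ ∣ B.2 - z₀ := by
      rw [k1, add_sub_right_comm]
      exact dvd_add hz (dvd_mul_right _ _)
    have hsg := sgn_add_varpi_mul hz k3
    rw [← k1] at hsg
    obtain ⟨p1, p2⟩ := hP.of_dvd_snd hA hz
    obtain ⟨q1, q2⟩ := hQ.of_dvd_snd hB hz'
    rw [hsg] at q2
    by_cases hs : sgn z₀ A.2 = s
    · left
      apply eq_of_varpi_mul (c := c)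
      rw [p2, q1, h1, hs]
    · have hs : sgn z₀ A.2 = -s := by
        rcases Int.units_eq_one_or s with h1 | h1 <;>
          rcases Int.units_eq_one_or (sgn z₀ A.2) with h2 | h2 <;> simp_all
      right
      apply eq_of_varpi_mul (c := c)
      rw [p1, q2, hs, h1, h2, neg_neg]
      ring
  · have hz1 : ϖ ∣ A.1 - z₀ := by
      by_contra h
      exact hz (hA.1.dvd_sub_iff.2 h)
    have hz' : ϖ ∣ B.1 - z₀ := by
      rw [k2, add_sub_right_comm]
      exact dvd_add hz1 (dvd_mul_right _ _)
    have hsg := sgn_add_varpi_mul hz1 k4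
    rw [← k2] at hsg
    obtain ⟨p1, p2⟩ := hP.of_dvd_fst hA hz1
    obtain ⟨q1, q2⟩ := hQ.of_dvd_fst hB hz'
    rw [hsg] at q2
    by_cases hs : sgn z₀ A.1 = s
    · right
      apply eq_of_varpi_mul (c := c)
      rw [p2, q1, h2, hs]
    · have hs : sgn z₀ A.1 = -s := by
        rcases Int.units_eq_one_or s with h1 | h1 <;>
          rcases Int.units_eq_one_or (sgn z₀ A.1) with h2 | h2 <;> simp_all
      left
      apply eq_of_varpi_mul (c := c)
      rw [p1, q2, hs, h1, h2, neg_neg]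
      ring

theorem Par.near {c z₀ e : GaussianInt} {A B P Q : GaussianInt × GaussianInt}
    (hA : IsSeg e A) (hB : IsSeg e B) (hP : Par c z₀ A P) (hQ : Par c z₀ B Q) (h : Near A B) :
    Near P Q := by
  have follow : ∀ {A B P Q : GaussianInt × GaussianInt}, IsSeg e A → IsSeg e B → Par c z₀ A P →
      Par c z₀ B Q → A.2 = B.1 → Near P Q := by
    intro A B P Q hA hB hP hQ hAB
    by_cases hz : ϖ ∣ A.2 - z₀
    · rcases hP.of_follow hA hB hQ hAB hz with h | h
      · exact Or.inl h
      · exact Or.inr (Or.inr (Or.inr (Or.inl h)))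
    · exact Or.inr (Or.inl (hP.of_follow_of_not_dvd hA hB hQ hAB hz).2)
  rcases h with rfl | h | h | h | h
  · left
    by_cases hz : ϖ ∣ A.2 - z₀
    · obtain ⟨p1, p2⟩ := hP.of_dvd_snd hA hz
      obtain ⟨q1, q2⟩ := hQ.of_dvd_snd hA hz
      exact Prod.ext (eq_of_varpi_mul (p1.trans q1.symm)) (eq_of_varpi_mul (p2.trans q2.symm))
    · have hz1 : ϖ ∣ A.1 - z₀ := by
        by_contra h
        exact hz (hA.1.dvd_sub_iff.2 h)
      obtain ⟨p1, p2⟩ := hP.of_dvd_fst hA hz1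
      obtain ⟨q1, q2⟩ := hQ.of_dvd_fst hA hz1
      exact Prod.ext (eq_of_varpi_mul (p2.trans q2.symm)) (eq_of_varpi_mul (p1.trans q1.symm))
  · exact follow hA hB hP hQ h
  · exact (follow hB hA hQ hP h).symm
  · rcases hP.of_opp hA hB hQ h with h | h
    · exact Or.inr (Or.inl h)
    · exact Or.inr (Or.inr (Or.inl h))
  · rcases hQ.of_opp hB hA hP h with h | h
    · exact Or.inr (Or.inr (Or.inl h))
    · exact Or.inr (Or.inl h)

/-- Two segments which can be consecutive at a vertex of the folded class come from the same segment
after a translation. -/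
theorem exists_shift_par_eq (c : GaussianInt) {z₀ e : GaussianInt}
    {A B : GaussianInt × GaussianInt} (hA : IsSeg e A) (hB : IsSeg e B) (hAB : A.2 = B.1)
    (hz : ϖ ∣ A.2 - z₀) : ∃ β, ϖ ∣ β ∧ ∀ P Q, Par c z₀ (shift β A) P → Par c z₀ (shift β B) Q →
      P = Q := by
  obtain ⟨s, hs⟩ := hA.exists_turn hB hAB
  have main : ∀ β, ϖ ∣ β → sgn z₀ (A.2 + β) = s → ∀ P Q, Par c z₀ (shift β A) P →
      Par c z₀ (shift β B) Q → P = Q := by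
    intro β hβ hsg P Q hP hQ
    refine hP.eq_of_follow (hA.shift hβ) (hB.shift hβ) hQ ?_ ?_ ?_
    · simp [shift, hAB]
    · simp only [shift]
      rw [add_sub_right_comm]
      exact dvd_add hz hβ
    · simp only [shift]
      rw [hsg]
      linear_combination hs
  by_cases h : sgn z₀ A.2 = s
  · exact ⟨0, dvd_zero _, main 0 (dvd_zero _) (by simpa using h)⟩
  · refine ⟨ϖ * 1, dvd_mul_right _ _, main _ (dvd_mul_right _ _) ?_⟩
    rw [sgn_add_varpi_mul hz (IsDirection.not_dvd (Or.inl rfl))]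
    rcases Int.units_eq_one_or s with h1 | h1 <;>
      rcases Int.units_eq_one_or (sgn z₀ A.2) with h2 | h2 <;> simp_all

/-! ### Unfolding a complete folding curve -/

/-- `x` is a complete folding curve with segments of type `e`. -/
def FC (e : GaussianInt) (x : ℤ → GaussianInt) : Prop :=
  ∃ b, CF b ∧ Crv b x ∧ ∀ k, IsSeg e (x k, x (k + 1))

/-- `A` is a segment of `x`. -/
def On (x : ℤ → GaussianInt) (A : GaussianInt × GaussianInt) : Prop := ∃ k : ℤ, A = (x k, x (k + 1))

/-- The segments of `x` are obtained by folding those of `x'` along the turns `sgn z₀`. -/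
def Folds (e : GaussianInt) (x : ℤ → GaussianInt) (c z₀ : GaussianInt) (x' : ℤ → GaussianInt) :
    Prop :=
  ¬ ϖ ∣ c - z₀ ∧ FC (z₀ - c) x' ∧ ∀ A P, IsSeg e A → Par c z₀ A P → On x' P → On x A

theorem two_add_sign_mul_ne {d : GaussianInt} (hd : d ≠ 0) (s s' : ℤˣ) :
    2 * d + (((s : ℤ) : GaussianInt) + ((s' : ℤ) : GaussianInt)) * I * d ≠ 0 := by
  rw [← add_mul]
  refine mul_ne_zero ?_ hd
  rcases Int.units_eq_one_or s with rfl | rfl <;> rcases Int.units_eq_one_or s' with rfl | rfl <;>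
    decide

/-- The derived curve serves as `x'`, with `c` a vertex of the even class. A segment whose parent is
on `x'` shares an end and its type with one of the two halves of that parent on `x`, so it equals
this half or points the opposite way; the latter is incompatible with the other end of the parent.
-/
theorem FC.exists_folds {e : GaussianInt} {x : ℤ → GaussianInt} (h : FC e x) :
    ∃ c z₀ x', Folds e x c z₀ x' := by
  obtain ⟨b, hb, hx, hseg⟩ := h
  obtain ⟨r, hr, hCF⟩ := hb.exists_derived
  have hy := hx.shift r
  have hyseg : ∀ k, IsSeg e (x (r + k), x (r + (k + 1))) := fun k => by
    simpa [add_assoc] using hseg (r + k)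
  obtain ⟨x', hx0, hx', hc⟩ := hy.derived hr
  have hd : IsDirection (x (r + 1) - x (r + 0)) := by simpa using (hy 0).1
  have e1 := hx' 1
  have s1 := (hy 0).2
  simp only [zero_add, mul_one] at e1 s1
  -- The first odd vertex itself if the turn there is `1`, its translate by `ϖ` if it is `-1`: then
  -- `sgn z₀` is the turn at that vertex, and the type of `x'` is `z₀ - c`.
  obtain ⟨z₀, hz, hz'⟩ : ∃ z₀, ¬ ϖ ∣ x (r + 0) - z₀ ∧ IsSeg (z₀ - x (r + 0)) (x' 0, x' (0 + 1)) := by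
    have hd' := (hc 0).1
    have hneg : ¬ ϖ ∣ x (r + 0) - x (r + 1) := by
      have := hd.neg.not_dvd
      rwa [neg_sub] at this
    rw [zero_add, hx0] at hd' ⊢
    rcases Int.units_eq_one_or (b (r + 1)) with hb | hb
    · rw [hb] at s1
      push_cast at s1
      have f : x' 1 = x (r + 1) - x (r + 0) := by
        apply mul_left_cancel₀ varpi_ne_zero
        simp only [ϖ] at *
        linear_combination s1 - e1
      exact ⟨x (r + 1), hneg, hd', by simp [f]⟩
    · rw [hb] at s1
      push_cast at s1
      have f : x' 1 = -(I * (x (r + 1) - x (r + 0))) := by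
        apply mul_left_cancel₀ varpi_ne_zero
        simp only [ϖ] at *
        linear_combination s1 - e1 + (x (r + 1) - x (r + 0)) * I_mul_I
      refine ⟨x (r + 1) + ϖ, ?_, hd', ?_⟩
      · rwa [← sub_sub, dvd_sub_left dvd_rfl]
      · have h2 : 2 ∣ ϖ * (x (r + 1) - x (r + 0) + 1) :=
          two_dvd_mul_varpi.2 (dvd_add_of_not_dvd hd.not_dvd (IsDirection.not_dvd (Or.inl rfl)))
        rw [← dvd_neg] at h2
        convert h2 using 1
        simp only [f, ϖ]
        ring
  refine ⟨x (r + 0), z₀, x', hz, ⟨_, hCF, hc, hc.isSeg hz'⟩, ?_⟩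
  rintro A P hA hP ⟨k, rfl⟩
  have s := (hy (2 * k)).2
  have c0 := hx' k
  have c1 := hx' (k + 1)
  rw [show 2 * (k + 1) = 2 * k + 2 by ring] at c1
  simp only at s
  rcases hP with ⟨-, h2, h3⟩ | ⟨-, h2, h3⟩
  · rw [← c0] at h2
    rw [← c1] at h3
    have hs := hyseg (2 * k)
    rw [h2] at hs
    refine ⟨r + 2 * k, ?_⟩
    rcases hs.end_eq hA with h | h
    · rw [add_assoc, ← h, h2]
    · exfalso
      rw [h2] at s
      refine two_add_sign_mul_ne hA.1.ne_zero (sgn z₀ A.2) (b (r + (2 * k + 1))) ?_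
      linear_combination s - h3 + (1 + ((b (r + (2 * k + 1)) : ℤ) : GaussianInt) * I) * h
  · rw [← c0] at h3
    rw [← c1] at h2
    have hs := hyseg (2 * k + 1)
    rw [add_assoc, one_add_one_eq_two, h2] at hs
    refine ⟨r + 2 * k + 1, ?_⟩
    rcases hs.start_eq hA with h | h
    · rw [show r + 2 * k + 1 + 1 = r + (2 * k + 2) by ring, add_assoc, h2, ← h]
    · exfalso
      rw [h2] at s
      have hbb : ((b (r + (2 * k + 1)) : ℤ) : GaussianInt) *
          ((b (r + (2 * k + 1)) : ℤ) : GaussianInt) = 1 := sign_mul_self _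
      refine two_add_sign_mul_ne hA.1.ne_zero (-sgn z₀ A.1) (-b (r + (2 * k + 1))) ?_
      push_cast
      generalize ((b (r + (2 * k + 1)) : ℤ) : GaussianInt) = σ at *
      generalize ((sgn z₀ A.1 : ℤ) : GaussianInt) = τ at *
      have s' : x (r + (2 * k + 1)) - x (r + 2 * k) = -(σ * I * (A.2 - x (r + (2 * k + 1)))) := by
        linear_combination σ * I * s + (x (r + (2 * k + 1)) - x (r + 2 * k)) *
          (σ * σ * I_mul_I - hbb)
      linear_combination h3 + s' + (1 - σ * I) * h

/-- Every second step is parallel to `d`. If `d` never occurred, these steps would all equal `-d`,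
forcing opposite turns in each pair of vertices between them; this contradicts the first two
Toeplitz levels. -/
theorem FC.exists_direction {e d : GaussianInt} {x : ℤ → GaussianInt} (h : FC e x)
    (hd : IsDirection d) : ∃ k, x (k + 1) - x k = d := by
  obtain ⟨b, hb, hx, -⟩ := h
  have hcast : ∀ s s' : ℤˣ, ∀ z : GaussianInt, ((s : ℤ) : GaussianInt) * I *
      (((s' : ℤ) : GaussianInt) * I * z) = ((-(s * s') : ℤˣ) : ℤ) * z := by
    intro s s' z
    push_cast
    linear_combination ((s : ℤ) : GaussianInt) * ((s' : ℤ) : GaussianInt) * z * I_mul_I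
  have step : ∀ k, x (k + 3) - x (k + 2) =
      (((-(b (k + 2) * b (k + 1)) : ℤˣ) : ℤ) : GaussianInt) * (x (k + 1) - x k) := by
    intro k
    have h1 := (hx k).2
    have h2 := (hx (k + 1)).2
    rw [add_assoc, add_assoc, one_add_one_eq_two, show (1 : ℤ) + 2 = 3 by rfl, h1, hcast] at h2
    exact h2
  obtain ⟨r, hr⟩ : ∃ r : ℤ, x (r + 1) - x r = d ∨ x (r + 1) - x r = -d := by
    rcases hd.cases_of (hx 0).1 with h | h | h | h
    · exact ⟨0, Or.inl h⟩
    · exact ⟨0, Or.inr h⟩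
    all_goals
      refine ⟨1, ?_⟩
      have h2 := (hx 0).2
      rw [one_add_one_eq_two]
      rw [h] at h2
      rcases Int.units_eq_one_or (b (0 + 1)) with hb | hb <;> rw [hb] at h2
    · right
      push_cast at h2
      linear_combination h2 + d * I_mul_I
    · left
      push_cast at h2
      linear_combination h2 - d * I_mul_I
    · left
      push_cast at h2
      linear_combination h2 - d * I_mul_I
    · right
      push_cast at h2
      linear_combination h2 + d * I_mul_I
  by_contra! H
  have hall : ∀ m : ℤ, x (r + 2 * m + 1) - x (r + 2 * m) = -d := by
    have h0 : x (r + 1) - x r = -d := hr.resolve_left (H r)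
    have hstep : ∀ k, x (k + 3) - x (k + 2) = -d ↔ x (k + 1) - x k = -d := by
      intro k
      have h1 := step k
      have h2 := H (k + 2)
      have h3 := H k
      rw [add_assoc, show (2 : ℤ) + 1 = 3 by rfl] at h2
      rcases Int.units_eq_one_or (-(b (k + 2) * b (k + 1))) with hs | hs <;> rw [hs] at h1 <;>
        push_cast at h1
      · rw [h1, one_mul]
      · constructor
        · intro h
          exact absurd (by linear_combination h1 - h) h3
        · intro h
          exact absurd (by linear_combination h1 - h) h2
    intro m
    induction m using Int.induction_on with
    | zero => simpa using h0
    | succ m ih =>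
      have := (hstep _).2 ih
      convert this using 3 <;> ring
    | pred m ih =>
      apply (hstep _).1
      convert ih using 3 <;> ring
  have hprod : ∀ m : ℤ, b (r + 2 * m + 2) = -b (r + 2 * m + 1) := by
    intro m
    have h1 := step (r + 2 * m)
    have h2 := hall (m + 1)
    rw [show r + 2 * (m + 1) + 1 = r + 2 * m + 3 by ring,
      show r + 2 * (m + 1) = r + 2 * m + 2 by ring] at h2
    rw [hall m, h2] at h1
    rcases Int.units_eq_one_or (b (r + 2 * m + 2)) with hs | hs <;>
      rcases Int.units_eq_one_or (b (r + 2 * m + 1)) with hs' | hs' <;> rw [hs, hs'] at h1 ⊢ <;>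
      simp at h1 ⊢
    all_goals
      have h0 : (2 : GaussianInt) * d = 0 := by first | linear_combination h1 | linear_combination -h1
      exact hd.ne_zero ((mul_eq_zero.1 h0).resolve_left (by decide))
  obtain ⟨q, hq⟩ := hb 2
  have h1 := hq.alternate
  have h2 := (toep_succ_iff.1 hq).2.alternate
  -- Each pair joins an odd place to an even place relative to `q`. Choose a pair whose even place
  -- is twice an odd number. A shift by `4` preserves the value at the odd place but flips that at
  -- the even place.
  rcases Int.even_or_odd' (r - q) with ⟨m, hm | hm⟩
  · have e1 := hprod (-m + 0)
    rw [show r + 2 * (-m + 0) + 2 = q + 2 * (2 * 0 + 1) by linarith,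
      show r + 2 * (-m + 0) + 1 = q + (2 * 0 + 1) by linarith] at e1
    have e3 := hprod (-m + 2)
    rw [show r + 2 * (-m + 2) + 2 = q + 2 * (2 * 0 + 3) by linarith,
      show r + 2 * (-m + 2) + 1 = q + (2 * 1 + 3) by linarith, h1, h2, e1,
      show (2 : ℤ) * 1 + 1 = 2 * 0 + 3 by rfl, h1] at e3
    simp at e3
  · have e1 := hprod (-m + 0)
    rw [show r + 2 * (-m + 0) + 1 = q + 2 * (2 * 0 + 1) by linarith,
      show r + 2 * (-m + 0) + 2 = q + (2 * 0 + 3) by linarith] at e1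
    have e3 := hprod (-m + 2)
    rw [show r + 2 * (-m + 2) + 1 = q + 2 * (2 * 0 + 3) by linarith,
      show r + 2 * (-m + 2) + 2 = q + (2 * 2 + 3) by linarith, h1, h2,
      show (2 : ℤ) * 2 + 1 = 2 * 1 + 3 by rfl, h1,
      show (2 : ℤ) * 1 + 1 = 2 * 0 + 3 by rfl, e1] at e3
    simp at e3

/-! ### Catching walks by repeated unfolding -/

/-- A walk of segments of type `e`. -/
def Walk (e : GaussianInt) (f : ℕ → GaussianInt × GaussianInt) : Prop :=
  (∀ i, IsSeg e (f i)) ∧ ∀ i, Near (f i) (f (i + 1))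

theorem Walk.tail {e : GaussianInt} {f : ℕ → GaussianInt × GaussianInt} (h : Walk e f) :
    Walk e fun i => f (i + 1) :=
  ⟨fun i => h.1 (i + 1), fun i => h.2 (i + 1)⟩

theorem shift_shift (u v : GaussianInt) (A : GaussianInt × GaussianInt) :
    shift u (shift v A) = shift (v + u) A := by
  simp [shift, add_assoc]

theorem Near.shift {A B : GaussianInt × GaussianInt} (h : Near A B) (u : GaussianInt) :
    Near (shift u A) (shift u B) := by
  have opp : ∀ {A B : GaussianInt × GaussianInt}, Opp A B → Opp (Paperfolding.shift u A)
      (Paperfolding.shift u B) := by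
    rintro A B ⟨s, h1, h2⟩
    refine ⟨s, ?_, ?_⟩ <;> simp only [Paperfolding.shift]
    · linear_combination h1
    · linear_combination h2
  rcases h with rfl | h | h | h | h
  · exact Or.inl rfl
  · exact Or.inr (Or.inl (by simp [Paperfolding.shift, h]))
  · exact Or.inr (Or.inr (Or.inl (by simp [Paperfolding.shift, h])))
  · exact Or.inr (Or.inr (Or.inr (Or.inl (opp h))))
  · exact Or.inr (Or.inr (Or.inr (Or.inr (opp h))))

/-- The translation `β` is applied before taking parents, since parents depend on the position
modulo `2`. A translation `u` of the parents then lifts to `β + ϖ * u`. -/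
theorem Folds.exists_walk {e c z₀ β : GaussianInt} {x x' : ℤ → GaussianInt}
    {f : ℕ → GaussianInt × GaussianInt} (h : Folds e x c z₀ x') (hf : Walk e f) (hβ : ϖ ∣ β) :
    ∃ g, Walk (z₀ - c) g ∧ (∀ i, Par c z₀ (shift β (f i)) (g i)) ∧
      ∀ i u, ϖ ∣ u → On x' (shift u (g i)) → On x (shift (β + ϖ * u) (f i)) := by
  choose g hg using fun i => exists_par h.1 ((hf.1 i).shift hβ)
  refine ⟨g, ⟨fun i => (hg i).isSeg ((hf.1 i).shift hβ), fun i => (hg i).near ((hf.1 i).shift hβ)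
    ((hf.1 (i + 1)).shift hβ) (hg (i + 1)) ((hf.2 i).shift β)⟩, hg, fun i u hu hon => ?_⟩
  rw [← shift_shift]
  exact h.2.2 _ _ (((hf.1 i).shift hβ).shift (dvd_mul_right _ _)) ((hg i).shift hu) hon

/-- The first `m + 1` segments of each walk can be translated into each folding curve. -/
def Catch (m : ℕ) : Prop := ∀ e x f, FC e x → Walk e f →
  ∃ u, ϖ ∣ u ∧ ∀ i ≤ m, On x (shift u (f i))

theorem catch_zero : Catch 0 := by
  intro e x f hx hf
  obtain ⟨k, hk⟩ := hx.exists_direction (hf.1 0).1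
  obtain ⟨b, -, -, hseg⟩ := hx
  refine ⟨x k - (f 0).1, ?_, fun i hi => ?_⟩
  · rw [← two_dvd_mul_varpi]
    have := dvd_sub (hseg k).2 (hf.1 0).2
    convert this using 1
    simp only [ϖ]
    linear_combination (-1) * hk
  · obtain rfl : i = 0 := by omega
    refine ⟨k, ?_⟩
    ext1 <;> simp only [shift]
    · ring
    · linear_combination (-1) * hk

theorem Catch.of_eq {m : ℕ} (h : Catch m) {e : GaussianInt} {x : ℤ → GaussianInt}
    {f : ℕ → GaussianInt × GaussianInt} (hx : FC e x) (hf : Walk e f) (h01 : f 0 = f 1) :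
    ∃ u, ϖ ∣ u ∧ ∀ i ≤ m + 1, On x (shift u (f i)) := by
  obtain ⟨u, hu, H⟩ := h e x _ hx hf.tail
  refine ⟨u, hu, fun i hi => ?_⟩
  cases i with
  | zero => rw [h01]; exact H 0 (by omega)
  | succ i => exact H i (by omega)

theorem exists_shift_of_lift {m : ℕ} {β : GaussianInt} {x x' : ℤ → GaussianInt}
    {f g : ℕ → GaussianInt × GaussianInt} (hβ : ϖ ∣ β)
    (hlift : ∀ i u, ϖ ∣ u → On x' (shift u (g i)) → On x (shift (β + ϖ * u) (f i)))
    (hg : ∃ u, ϖ ∣ u ∧ ∀ i ≤ m + 1, On x' (shift u (g i))) :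
    ∃ u, ϖ ∣ u ∧ ∀ i ≤ m + 1, On x (shift u (f i)) := by
  obtain ⟨u, hu, H⟩ := hg
  exact ⟨β + ϖ * u, dvd_add hβ (dvd_mul_right _ _), fun i hi => hlift i u hu (H i hi)⟩

/-- A translation by `0` or `ϖ` makes `sgn z₀` agree with the turn between the first two segments,
so that they have the same parent and the walk of parents is effectively shorter. -/
theorem Catch.of_follow_of_dvd {m : ℕ} (h : Catch m) {e c z₀ : GaussianInt}
    {x x' : ℤ → GaussianInt} {f : ℕ → GaussianInt × GaussianInt} (hx : Folds e x c z₀ x')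
    (hf : Walk e f) (h01 : ((f 0).2 = (f 1).1 ∧ ϖ ∣ (f 0).2 - z₀) ∨
      ((f 1).2 = (f 0).1 ∧ ϖ ∣ (f 1).2 - z₀)) :
    ∃ u, ϖ ∣ u ∧ ∀ i ≤ m + 1, On x (shift u (f i)) := by
  obtain ⟨β, hβ, H⟩ : ∃ β, ϖ ∣ β ∧ ∀ P Q, Par c z₀ (shift β (f 0)) P →
      Par c z₀ (shift β (f 1)) Q → P = Q := by
    rcases h01 with ⟨h1, h2⟩ | ⟨h1, h2⟩
    · exact exists_shift_par_eq c (hf.1 0) (hf.1 1) h1 h2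
    · obtain ⟨β, hβ, H⟩ := exists_shift_par_eq c (hf.1 1) (hf.1 0) h1 h2
      exact ⟨β, hβ, fun P Q hP hQ => (H Q P hQ hP).symm⟩
  obtain ⟨g, hg, hpar, hlift⟩ := hx.exists_walk hf hβ
  exact exists_shift_of_lift hβ hlift
    (h.of_eq hx.2.1 hg (H _ _ (hpar 0) (hpar 1)))

theorem Catch.of_follow {m : ℕ} (h : Catch m) {e : GaussianInt} {x : ℤ → GaussianInt}
    {f : ℕ → GaussianInt × GaussianInt} (hx : FC e x) (hf : Walk e f)
    (h01 : (f 0).2 = (f 1).1 ∨ (f 1).2 = (f 0).1) :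
    ∃ u, ϖ ∣ u ∧ ∀ i ≤ m + 1, On x (shift u (f i)) := by
  obtain ⟨c, z₀, x', hF⟩ := hx.exists_folds
  obtain ⟨c', z₀', x'', hF'⟩ := hF.2.1.exists_folds
  -- A vertex that survives the first unfolding can be moved, by `0` or `ϖ`, into the folded class
  -- of the second one, where the two segments merge.
  have choice : ∀ v, ¬ ϖ ∣ v - z₀ → ∃ β, ϖ ∣ β ∧ ∀ p, c + ϖ * p = v + β → ϖ ∣ p - z₀' := by
    intro v hv
    have h1 := dvd_sub_of_not_dvd hv hF.1
    rw [sub_sub_sub_cancel_right] at h1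
    obtain ⟨w, hw⟩ := h1
    by_cases h2 : ϖ ∣ w - z₀'
    · refine ⟨0, dvd_zero _, fun p hp => ?_⟩
      rwa [show p = w from eq_of_varpi_mul (c := c) (by rw [hp, ← hw]; ring)]
    · refine ⟨ϖ, dvd_rfl, fun p hp => ?_⟩
      rw [show p = w + 1 from eq_of_varpi_mul (c := c) (by rw [hp, mul_add, ← hw]; ring)]
      rw [add_sub_right_comm]
      exact dvd_add_of_not_dvd h2 (IsDirection.not_dvd (Or.inl rfl))
  have hodd : ∀ {v β : GaussianInt}, ¬ ϖ ∣ v - z₀ → ϖ ∣ β → ¬ ϖ ∣ v + β - z₀ := by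
    intro v β hv hβ
    rwa [add_sub_right_comm, dvd_add_left hβ]
  rcases h01 with h01 | h01
  · by_cases hz : ϖ ∣ (f 0).2 - z₀
    · exact h.of_follow_of_dvd hF hf (Or.inl ⟨h01, hz⟩)
    obtain ⟨β, hβ, H⟩ := choice _ hz
    obtain ⟨g, hg, hpar, hlift⟩ := hF.exists_walk hf hβ
    obtain ⟨h1, h2⟩ := (hpar 0).of_follow_of_not_dvd ((hf.1 0).shift hβ) ((hf.1 1).shift hβ) (hpar 1)
      (by simp [shift, h01]) (hodd hz hβ)
    exact exists_shift_of_lift hβ hlift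
      (h.of_follow_of_dvd hF' hg (Or.inl ⟨h2, H _ h1⟩))
  · by_cases hz : ϖ ∣ (f 1).2 - z₀
    · exact h.of_follow_of_dvd hF hf (Or.inr ⟨h01, hz⟩)
    obtain ⟨β, hβ, H⟩ := choice _ hz
    obtain ⟨g, hg, hpar, hlift⟩ := hF.exists_walk hf hβ
    obtain ⟨h1, h2⟩ := (hpar 1).of_follow_of_not_dvd ((hf.1 1).shift hβ) ((hf.1 0).shift hβ) (hpar 0)
      (by simp [shift, h01]) (hodd hz hβ)
    exact exists_shift_of_lift hβ hlift
      (h.of_follow_of_dvd hF' hg (Or.inr ⟨h2, H _ h1⟩))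

theorem catch_all (m : ℕ) : Catch m := by
  induction m with
  | zero => exact catch_zero
  | succ m ih =>
    intro e x f hx hf
    -- One unfolding makes opposite sides consecutive, which reduces to the preceding case.
    have opp : Opp (f 0) (f 1) ∨ Opp (f 1) (f 0) →
        ∃ u, ϖ ∣ u ∧ ∀ i ≤ m + 1, On x (shift u (f i)) := by
      intro h
      obtain ⟨c, z₀, x', hF⟩ := hx.exists_folds
      obtain ⟨g, hg, hpar, hlift⟩ := hF.exists_walk hf (dvd_zero ϖ)
      have hsh : ∀ A : GaussianInt × GaussianInt, shift 0 A = A := by simp [shift]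
      simp only [hsh] at hpar
      refine exists_shift_of_lift (dvd_zero ϖ) hlift (ih.of_follow hF.2.1 hg ?_)
      rcases h with h | h
      · exact (hpar 0).of_opp (hf.1 0) (hf.1 1) (hpar 1) h
      · exact ((hpar 1).of_opp (hf.1 1) (hf.1 0) (hpar 0) h).symm
    rcases hf.2 0 with h | h | h | h | h
    · exact ih.of_eq hx hf h
    · exact ih.of_follow hx hf (Or.inl h)
    · exact ih.of_follow hx hf (Or.inr h)
    · exact opp (Or.inl h)
    · exact opp (Or.inr h)

/-! ### Walks through bounded sets of segments -/

/-- There is a walk of segments of type `e` from `A` to `B`. -/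
def Joins (e : GaussianInt) : GaussianInt × GaussianInt → GaussianInt × GaussianInt → Prop :=
  Relation.ReflTransGen fun A B => IsSeg e B ∧ Near A B

/-- Two segments both leaving `v`, or both arriving there, are linked through a segment of the other
kind. -/
theorem joins_of_common {e v : GaussianInt} {A B : GaussianInt × GaussianInt} (hA : IsSeg e A)
    (hB : IsSeg e B) (h1 : A.1 = v ∨ A.2 = v) (h2 : B.1 = v ∨ B.2 = v) : Joins e A B := by
  rcases h1 with h1 | h1 <;> rcases h2 with h2 | h2
  · obtain ⟨p, hp⟩ := exists_isSeg_to hA.odd v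
    exact (Relation.ReflTransGen.single ⟨hp, Or.inr (Or.inr (Or.inl h1.symm))⟩).tail
      ⟨hB, Or.inr (Or.inl h2.symm)⟩
  · exact Relation.ReflTransGen.single ⟨hB, Or.inr (Or.inr (Or.inl (h2.trans h1.symm)))⟩
  · exact Relation.ReflTransGen.single ⟨hB, Or.inr (Or.inl (h1.trans h2.symm))⟩
  · have hC := (isSeg_next_iff (e := e) (z := A.1) (d := A.2 - A.1) 1).2 (by simpa using hA)
    rw [add_sub_cancel] at hC
    exact (Relation.ReflTransGen.single ⟨hC, Or.inr (Or.inl rfl)⟩).tail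
      ⟨hB, Or.inr (Or.inr (Or.inl (h2.trans h1.symm)))⟩

theorem joins_of_isSeg {e : GaussianInt} {A : GaussianInt × GaussianInt} (hA : IsSeg e A) (z : GaussianInt) :
    ∀ B, IsSeg e B → B.1 = z ∨ B.2 = z → Joins e A B := by
  let Q : GaussianInt → Prop := fun z => ∀ B, IsSeg e B → B.1 = z ∨ B.2 = z → Joins e A B
  have step : ∀ z d, IsDirection d → Q z → Q (z + d) := by
    intro z d hd hz B hB hv
    rcases isSeg_or_isSeg (z := z) hA.odd hd with h | h
    · exact (hz _ h (Or.inl rfl)).trans (joins_of_common h hB (Or.inr rfl) hv)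
    · exact (hz _ h (Or.inr rfl)).trans (joins_of_common h hB (Or.inl rfl) hv)
  have base : Q A.1 := fun B hB hv => joins_of_common hA hB (Or.inl rfl) hv
  have key : ∀ d, IsDirection d → ∀ n : ℤ, ∀ z, Q z → Q (z + n * d) := by
    intro d hd n
    induction n using Int.induction_on with
    | zero => simp
    | succ n ih =>
      intro z hz
      convert step _ d hd (ih z hz) using 1
      push_cast
      ring
    | pred n ih =>
      intro z hz
      convert step _ _ hd.neg (ih z hz) using 1
      push_cast
      ring
  have := key 1 (Or.inl rfl) (z - A.1).re _ (key I (Or.inr (Or.inr (Or.inl rfl))) (z - A.1).im _ base)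
  convert this using 1
  ext <;> simp

theorem Walk.extend {e : GaussianInt} {f : ℕ → GaussianInt × GaussianInt} (hf : Walk e f) (m : ℕ)
    {B : GaussianInt × GaussianInt} (h : Joins e (f m) B) :
    ∃ g m', Walk e g ∧ (∀ i ≤ m, g i = f i) ∧ m ≤ m' ∧ g m' = B := by
  induction h with
  | refl => exact ⟨f, m, hf, fun _ _ => rfl, le_rfl, rfl⟩
  | tail _ hBC ih =>
    obtain ⟨g, m', hg, hgf, hm, hgm⟩ := ih
    rename_i B C _
    refine ⟨fun i => if i ≤ m' then g i else C, m' + 1, ⟨fun i => ?_, fun i => ?_⟩, fun i hi => ?_,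
      by omega, by simp⟩
    · simp only
      split_ifs
      · exact hg.1 i
      · exact hBC.1
    · simp only
      rcases lt_trichotomy i m' with h | rfl | h
      · rw [if_pos h.le, if_pos (Nat.succ_le_of_lt h)]
        exact hg.2 i
      · rw [if_pos le_rfl, if_neg (by omega), hgm]
        exact hBC.2
      · rw [if_neg (by omega), if_neg (by omega)]
        exact Or.inl rfl
    · simp only
      rw [if_pos (hi.trans hm), hgf i hi]

theorem exists_walk_of_finset {e : GaussianInt} {A₀ : GaussianInt × GaussianInt} (h₀ : IsSeg e A₀)
    (F : Finset (GaussianInt × GaussianInt)) (hF : ∀ A ∈ F, IsSeg e A) :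
    ∃ f m, Walk e f ∧ ∀ A ∈ F, ∃ i ≤ m, f i = A := by
  classical
  induction F using Finset.induction_on with
  | empty => exact ⟨fun _ => A₀, 0, ⟨fun _ => h₀, fun _ => Or.inl rfl⟩, by simp⟩
  | insert B F _ ih =>
    obtain ⟨f, m, hf, H⟩ := ih fun A hA => hF A (Finset.mem_insert_of_mem hA)
    have hB := hF B (Finset.mem_insert_self _ _)
    obtain ⟨g, m', hg, hgf, hm, hgm⟩ := hf.extend m
      (joins_of_isSeg (hf.1 m) B.1 B hB (Or.inl rfl))
    refine ⟨g, m', hg, fun A hA => ?_⟩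
    rcases Finset.mem_insert.1 hA with rfl | hA
    · exact ⟨m', le_rfl, hgm⟩
    · obtain ⟨i, hi, h⟩ := H A hA
      exact ⟨i, hi.trans hm, by rw [hgf i hi, h]⟩

/-- A complete folding curve contains a translate of each bounded set of segments of its type. -/
theorem FC.exists_shift_on {e : GaussianInt} {x : ℤ → GaussianInt} (hx : FC e x)
    (F : Finset (GaussianInt × GaussianInt)) (hF : ∀ A ∈ F, IsSeg e A) :
    ∃ u, ϖ ∣ u ∧ ∀ A ∈ F, On x (shift u A) := by
  obtain ⟨b, hb, hc, hseg⟩ := id hx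
  obtain ⟨f, m, hf, H⟩ := exists_walk_of_finset (hseg 0) F hF
  obtain ⟨u, hu, hon⟩ := catch_all m e x f hx hf
  refine ⟨u, hu, fun A hA => ?_⟩
  obtain ⟨i, hi, rfl⟩ := H A hA
  exact hon i hi

/-! ### Coverings with the local isomorphism property -/

/-- The segments of the covering `𝒞` are the segments of type `e`, and both curves through a vertex
`z` turn there according to `t z`. -/
def Models (𝒞 : Set (ℤ → GaussianInt)) (e : GaussianInt) (t : GaussianInt → ℤˣ) : Prop :=
  ¬ ϖ ∣ e ∧ (∀ A, IsSegment 𝒞 A ↔ IsSeg e A) ∧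
    ∀ A B, IsConsecutive 𝒞 A B ↔
      IsSeg e A ∧ B = (A.2, A.2 + ((t A.2 : ℤ) : GaussianInt) * I * (A.2 - A.1))

theorem finite_inSquare (c : GaussianInt) (s : ℕ) : {z | InSquare c s z}.Finite := by
  apply Set.Finite.subset (((Set.finite_Icc c.re (c.re + s)).prod
    (Set.finite_Icc c.im (c.im + s))).image fun p : ℤ × ℤ => (⟨p.1, p.2⟩ : GaussianInt))
  rintro z ⟨h1, h2, h3, h4⟩
  exact ⟨(z.re, z.im), ⟨⟨h1, h2⟩, ⟨h3, h4⟩⟩, rfl⟩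

theorem CoversPlane.exists_of_isDirection {𝒞 : Set (ℤ → GaussianInt)} (h : CoversPlane 𝒞)
    (z : GaussianInt) {d : GaussianInt} (hd : IsDirection d) :
    ∃! p : (ℤ → GaussianInt) × ℤ, p.1 ∈ 𝒞 ∧ s(p.1 p.2, p.1 (p.2 + 1)) = s(z, z + d) := by
  rcases hd with rfl | rfl | rfl | rfl
  · exact h z 1 (Or.inl rfl)
  · have := h (z + -1) 1 (Or.inl rfl)
    rwa [neg_add_cancel_right, Sym2.eq_swap (a := z + -1)] at this
  · exact h z I (Or.inr rfl)
  · have := h (z + -I) I (Or.inr rfl)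
    rwa [neg_add_cancel_right, Sym2.eq_swap (a := z + -I)] at this

theorem CoversPlane.eq_of_sym2 {𝒞 : Set (ℤ → GaussianInt)} (h : CoversPlane 𝒞)
    {x y : ℤ → GaussianInt} (hx : x ∈ 𝒞) (hy : y ∈ 𝒞) {k l : ℤ}
    (hd : IsDirection (x (k + 1) - x k)) (hs : s(y l, y (l + 1)) = s(x k, x (k + 1))) :
    y = x ∧ l = k := by
  have := (h.exists_of_isDirection (x k) hd).unique (y₁ := (y, l)) (y₂ := (x, k))
    ⟨hy, by simpa using hs⟩ ⟨hx, by simp⟩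
  simpa using this

theorem CoversPlane.eq_of_eq {𝒞 : Set (ℤ → GaussianInt)} (h : CoversPlane 𝒞)
    {x y : ℤ → GaussianInt} (hx : x ∈ 𝒞) (hy : y ∈ 𝒞) {k l : ℤ}
    (hd : IsDirection (x (k + 1) - x k)) (h1 : y l = x k) (h2 : y (l + 1) = x (k + 1)) :
    y = x ∧ l = k := h.eq_of_sym2 hx hy hd (by rw [h1, h2])

theorem IsCompleteFoldingCurve.exists_crv {x : ℤ → GaussianInt} (h : IsCompleteFoldingCurve x) :
    ∃ b, CF b ∧ Crv b x := by
  obtain ⟨a, ha, hx⟩ := h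
  exact ⟨_, ha.cf.shift (-1), hx.crv⟩

/-- In a covering with the local isomorphism property, each bounded set of curves has a translate
contained in a given curve. -/
theorem exists_copy_on {𝒞 : Set (ℤ → GaussianInt)} (h𝒞 : IsFoldingCovering 𝒞)
    (hloc : LocalIsomorphismProperty 𝒞) {x : ℤ → GaussianInt} (hx : x ∈ 𝒞) {e : GaussianInt}
    (hfc : FC e x) (F : Finset (GaussianInt × GaussianInt)) (hF : ∀ A ∈ F, IsSegment 𝒞 A) :
    ∃ u, IsCopy 𝒞 𝒞 F u ∧ ∀ A ∈ F, On x (shift u A) := by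
  obtain ⟨s, hs⟩ := hloc F hF
  -- All type `e` segments of a square of side `s`: once `x` contains a translate of them, it runs
  -- along every edge of that square, including those of the copy of `F` supplied there by `hs`.
  have hfin : {A | IsSeg e A ∧ InSquare 0 s A.1 ∧ InSquare 0 s A.2}.Finite :=
    ((finite_inSquare 0 s).prod (finite_inSquare 0 s)).subset fun A hA => hA.2
  obtain ⟨c, hc, hon⟩ := hfc.exists_shift_on hfin.toFinset fun A hA => (hfin.mem_toFinset.1 hA).1
  obtain ⟨u, hu, hsq⟩ := hs c
  refine ⟨u, hu, fun A hA => ?_⟩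
  obtain ⟨y, hy, l, hyl⟩ := hu.1 A hA
  obtain ⟨h1, h2⟩ := hsq A hA
  rw [hyl] at h1 h2 ⊢
  have hsub : ∀ {z}, InSquare c s z → InSquare 0 s (z - c) := by
    rintro z ⟨h1, h2, h3, h4⟩
    refine ⟨?_, ?_, ?_, ?_⟩ <;> simp <;> linarith
  have hadd : ∀ p q, shift c (p - c, q - c) = (p, q) := by simp [shift]
  obtain ⟨b, -, hby⟩ := (h𝒞.1 y hy).exists_crv
  obtain ⟨b', -, hbx⟩ := (h𝒞.1 x hx).exists_crv
  have hodd : ¬ ϖ ∣ e := by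
    obtain ⟨b, -, -, h⟩ := hfc
    exact (h 0).odd
  have hd := (hby l).1
  rcases isSeg_or_isSeg (z := y l - c) hodd hd with h | h
  · rw [show y l - c + (y (l + 1) - y l) = y (l + 1) - c by ring] at h
    have := hon _ (hfin.mem_toFinset.2 ⟨h, hsub h1, hsub h2⟩)
    rwa [hadd] at this
  · rw [show y l - c + (y (l + 1) - y l) = y (l + 1) - c by ring] at h
    obtain ⟨k, hk⟩ := hon _ (hfin.mem_toFinset.2 ⟨h, hsub h2, hsub h1⟩)
    rw [hadd] at hk
    simp only [Prod.mk.injEq] at hk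
    -- Here `x` runs along the edge in the other direction; uniqueness of supports still identifies
    -- the two segments.
    obtain ⟨rfl, rfl⟩ := h𝒞.2.eq_of_sym2 hx hy (hbx k).1 (by rw [← hk.1, ← hk.2, Sym2.eq_swap])
    exact ⟨l, rfl⟩

theorem FC.of_crv {b : ℤ → ℤˣ} {x : ℤ → GaussianInt} (hb : CF b) (hx : Crv b x) :
    FC (x 1 + I * x 0) x :=
  ⟨b, hb, hx, hx.isSeg (k := 0) ⟨(hx 0).1, by simp⟩⟩

/-- Two distinct segments of the same type arriving at `v` are antiparallel. Opposite turns would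
make both curves leave along the same edge, against the uniqueness of supports. -/
theorem exists_turn_function {𝒞 : Set (ℤ → GaussianInt)} (h𝒞 : IsFoldingCovering 𝒞)
    {e : GaussianInt} (he : ¬ ϖ ∣ e) (hseg : ∀ A, IsSegment 𝒞 A ↔ IsSeg e A) (v : GaussianInt) :
    ∃ s : ℤˣ, ∀ y ∈ 𝒞, ∀ k, y (k + 1) = v →
      y (k + 2) - y (k + 1) = ((s : ℤ) : GaussianInt) * I * (y (k + 1) - y k) := by
  obtain ⟨p, hp⟩ := exists_isSeg_to he v
  obtain ⟨x, hx, k, hk⟩ := (hseg _).2 hp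
  simp only [Prod.mk.injEq] at hk
  obtain ⟨rfl, rfl⟩ := hk
  obtain ⟨b, -, hb⟩ := (h𝒞.1 x hx).exists_crv
  refine ⟨b (k + 1), fun y hy l hl => ?_⟩
  obtain ⟨b', -, hb'⟩ := (h𝒞.1 y hy).exists_crv
  have hyl : IsSeg e (y l, x (k + 1)) := by
    rw [← hl]
    exact (hseg _).1 ⟨y, hy, l, rfl⟩
  rcases hp.start_eq hyl with h | h
  · obtain ⟨rfl, rfl⟩ := h𝒞.2.eq_of_eq hx hy (hb k).1 h hl
    exact (hb _).2
  · rw [(hb' l).2]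
    by_cases hbb : b' (l + 1) = b (k + 1)
    · rw [hbb]
    exfalso
    have hneg : b' (l + 1) = -b (k + 1) := by
      rcases Int.units_eq_one_or (b' (l + 1)) with h1 | h1 <;>
        rcases Int.units_eq_one_or (b (k + 1)) with h2 | h2 <;> simp_all
    have h1 := (hb' l).2
    have h2 := (hb k).2
    rw [hneg, hl] at h1
    push_cast at h1
    have h3 : y (l + 2) = x (k + 2) := by
      linear_combination h1 - h2 - ((b (k + 1) : ℤ) : GaussianInt) * I * h
    have hd : IsDirection (x (k + 1 + 1) - x (k + 1)) := (hb (k + 1)).1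
    obtain ⟨rfl, h4⟩ := h𝒞.2.eq_of_eq hx hy (k := k + 1) (l := l + 1) hd hl
      (by rw [add_assoc, add_assoc]; exact h3)
    obtain rfl : l = k := by linarith
    have h0 : (2 : GaussianInt) * (y (l + 1) - y l) = 0 := by linear_combination h
    exact (hb l).1.ne_zero ((mul_eq_zero.1 h0).resolve_left (by decide))

/-- A bounded set of curves which determines the turns at given vertices. -/
theorem Models.exists_pattern {𝒞 : Set (ℤ → GaussianInt)} {e : GaussianInt}
    {t : GaussianInt → ℤˣ} (h : Models 𝒞 e t) (V : Finset GaussianInt) :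
    ∃ F : Finset (GaussianInt × GaussianInt), (∀ A ∈ F, IsSegment 𝒞 A) ∧
      (∀ v ∈ V, ∃ A ∈ F, A.2 = v) ∧
      ∀ (𝒟 : Set (ℤ → GaussianInt)) (e' : GaussianInt) (t' : GaussianInt → ℤˣ) (u : GaussianInt),
        Models 𝒟 e' t' → IsCopy 𝒞 𝒟 F u →
          ∀ v ∈ V, t' (v + u) = t v ∧ 2 ∣ e' - e - ϖ * u := by
  classical
  choose p hp using exists_isSeg_to h.1
  refine ⟨V.image (fun v => (p v, v)) ∪
    V.image (fun v => (v, v + ((t v : ℤ) : GaussianInt) * I * (v - p v))), ?_, ?_, ?_⟩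
  · intro A hA
    rw [h.2.1]
    rcases Finset.mem_union.1 hA with hA | hA
    · obtain ⟨v, -, rfl⟩ := Finset.mem_image.1 hA
      exact hp v
    · obtain ⟨v, -, rfl⟩ := Finset.mem_image.1 hA
      have := (isSeg_next_iff (e := e) (z := p v) (d := v - p v) (t v)).2 (by simpa using hp v)
      rwa [add_sub_cancel] at this
  · exact fun v hv => ⟨_, Finset.mem_union_left _ (Finset.mem_image_of_mem _ hv), rfl⟩
  · intro 𝒟 e' t' u h𝒟 hcopy v hv
    have h1 := (hcopy.2 _ (Finset.mem_union_left _ (Finset.mem_image_of_mem _ hv)) _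
      (Finset.mem_union_right _ (Finset.mem_image_of_mem _ hv))).1 ((h.2.2 _ _).2 ⟨hp v, rfl⟩)
    obtain ⟨h2, h3⟩ := (h𝒟.2.2 _ _).1 h1
    constructor
    · simp only [shift, Prod.mk.injEq, true_and] at h3
      apply sign_cancel (hp v).1.ne_zero
      linear_combination -h3
    · rw [isSeg_shift_iff] at h2
      have := (hp v).two_dvd_sub h2
      convert this using 1
      ring

/-- Everything is transported from one curve `x` of the covering: each pattern has a copy on `x`,
where the type is constant and the turns follow a Toeplitz function at every level. -/
theorem exists_models {𝒞 : Set (ℤ → GaussianInt)} (h𝒞 : IsFoldingCovering 𝒞)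
    (hloc : LocalIsomorphismProperty 𝒞) :
    ∃ e t, Models 𝒞 e t ∧ ∀ n, ∃ c, PT n c t := by
  obtain ⟨⟨x, k⟩, ⟨hx, -⟩, -⟩ := h𝒞.2 0 1 (Or.inl rfl)
  simp only at hx
  obtain ⟨b, hb, hcrv⟩ := (h𝒞.1 x hx).exists_crv
  have hfc := FC.of_crv hb hcrv
  set e := x 1 + I * x 0 with he
  obtain ⟨-, -, -, hxseg⟩ := id hfc
  have hodd := (hxseg 0).odd
  have hseg1 : ∀ A, IsSegment 𝒞 A → IsSeg e A := by
    intro A hA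
    classical
    -- Adding a reference segment of `x` to the pattern shows that the translation `u` preserves the
    -- type, hence that `A` has type `e`.
    obtain ⟨u, -, hu⟩ := exists_copy_on h𝒞 hloc hx hfc {(x 0, x (0 + 1)), A} (by
      intro B hB
      rcases Finset.mem_insert.1 hB with rfl | hB
      · exact ⟨x, hx, 0, rfl⟩
      · rw [Finset.mem_singleton.1 hB]
        exact hA)
    obtain ⟨k, hk⟩ := hu (x 0, x (0 + 1)) (by simp)
    obtain ⟨l, hl⟩ := hu A (by simp)
    have h1 : IsSeg e (shift u (x 0, x (0 + 1))) := hk ▸ hxseg k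
    have h2 : IsSeg e (shift u A) := hl ▸ hxseg l
    rw [isSeg_shift_iff] at h1 h2
    exact h2.congr (h1.two_dvd_sub (hxseg 0))
  have hseg : ∀ A, IsSegment 𝒞 A ↔ IsSeg e A := by
    refine fun A => ⟨hseg1 A, fun hA => ?_⟩
    obtain ⟨⟨y, l⟩, ⟨hy, hyl⟩, -⟩ := h𝒞.2.exists_of_isDirection A.1 hA.1
    rw [add_sub_cancel] at hyl
    simp only at hy hyl
    rcases Sym2.eq_iff.1 hyl with ⟨h1, h2⟩ | ⟨h1, h2⟩
    · exact ⟨y, hy, l, Prod.ext h1.symm h2.symm⟩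
    · have := hseg1 _ ⟨y, hy, l, rfl⟩
      rw [h1, h2] at this
      exact absurd this hA.not_swap
  choose t ht using exists_turn_function h𝒞 hodd hseg
  have hM : Models 𝒞 e t := by
    refine ⟨hodd, hseg, fun A B => ⟨?_, ?_⟩⟩
    · rintro ⟨y, hy, l, rfl, rfl⟩
      refine ⟨(hseg _).1 ⟨y, hy, l, rfl⟩, ?_⟩
      simp only [Prod.mk.injEq, true_and]
      rw [← ht _ y hy l rfl]
      ring
    · rintro ⟨hA, rfl⟩
      obtain ⟨y, hy, l, rfl⟩ := (hseg _).2 hA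
      refine ⟨y, hy, l, rfl, ?_⟩
      simp only [Prod.mk.injEq, true_and]
      rw [← ht _ y hy l rfl]
      ring
  refine ⟨e, t, hM, fun n => ?_⟩
  have htb : ∀ k, t (x k) = b k :=
    congrFun (Crv.turn_unique (fun k => ⟨(hcrv k).1, ht _ x hx k rfl⟩) hcrv)
  obtain ⟨r, hr⟩ := hb n
  obtain ⟨t', ht', htt'⟩ := (hcrv.shift r).exists_pt hr
  -- Compactness again: a copy of the square of radius `R` on `x` yields a centre, reducible modulo
  -- `2 ^ n` and hence modulo `ϖ ^ n` into a fixed finite box; one centre then serves every `R`. The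
  -- multiples of `ϖ ^ n` about `c` are excluded because level `n` says nothing there.
  obtain ⟨c, -, hc⟩ := exists_forall_of_antitone {c | InSquare 0 (2 ^ n) c} (finite_inSquare _ _)
    (fun R c => ∃ t'', PT n c t'' ∧ ∀ v, InSquare ⟨-R, -R⟩ (2 * R) v → ¬ ϖ ^ n ∣ v - c → t v = t'' v)
    (by
      rintro R R' c hR ⟨t'', h1, h2⟩
      refine ⟨t'', h1, fun v hv => h2 v ?_⟩
      obtain ⟨h1, h2, h3, h4⟩ := hv
      have : (R : ℤ) ≤ R' := by exact_mod_cast hR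
      push_cast at h1 h2 h3 h4
      refine ⟨?_, ?_, ?_, ?_⟩ <;> push_cast <;> linarith)
    (by
      intro R
      obtain ⟨F, hF1, hF2, hF3⟩ := hM.exists_pattern (finite_inSquare ⟨-R, -R⟩ (2 * R)).toFinset
      obtain ⟨u, hu1, hu2⟩ := exists_copy_on h𝒞 hloc hx hfc F hF1
      set c₀ := x (r + 0) - u with hc₀
      let c : GaussianInt := ⟨c₀.re % 2 ^ n, c₀.im % 2 ^ n⟩
      have hcc : ϖ ^ n ∣ c - c₀ := by
        refine (varpi_pow_dvd_two_pow n).trans ⟨⟨-(c₀.re / 2 ^ n), -(c₀.im / 2 ^ n)⟩, ?_⟩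
        have h2 : (2 : GaussianInt) ^ n = ((2 ^ n : ℤ) : GaussianInt) := by push_cast; rfl
        have e1 := Int.mul_ediv_add_emod c₀.re (2 ^ n)
        have e2 := Int.mul_ediv_add_emod c₀.im (2 ^ n)
        rw [h2]
        ext
        · rw [Zsqrtd.re_sub, Zsqrtd.re_smul]
          simp only [c]
          linarith
        · rw [Zsqrtd.im_sub, Zsqrtd.im_smul]
          simp only [c]
          linarith
      refine ⟨c, ?_, fun z => t' (z + u), (ht'.translate u).congr_centre hcc, fun v hv hvc => ?_⟩
      · have hpos : (0 : ℤ) < 2 ^ n := by positivity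
        refine ⟨Int.emod_nonneg _ hpos.ne', ?_, Int.emod_nonneg _ hpos.ne', ?_⟩
        · have := Int.emod_lt_of_pos c₀.re hpos
          simp [c]
          exact this.le
        · have := Int.emod_lt_of_pos c₀.im hpos
          simp [c]
          exact this.le
      · have hv' := (finite_inSquare ⟨-R, -R⟩ (2 * R)).mem_toFinset.2 hv
        obtain ⟨A, hA, rfl⟩ := hF2 v hv'
        obtain ⟨k, hk⟩ := hu2 A hA
        have hk2 : A.2 + u = x (r + (k + 1 - r)) := by
          rw [add_sub_cancel]
          exact congrArg Prod.snd hk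
        rw [← (hF3 𝒞 e t u hM hu1 _ hv').1]
        simp only
        rw [hk2, htt', htb]
        rw [← hk2]
        intro hd
        apply hvc
        have := dvd_sub hd hcc
        convert this using 1
        rw [hc₀]
        ring)
  refine ⟨c, fun j hj w => ?_⟩
  let m : ℤ := |(c + ϖ ^ j * (1 + ϖ * w)).re| + |(c + ϖ ^ j * (1 + ϖ * w)).im| +
    |(c + ϖ ^ j).re| + |(c + ϖ ^ j).im|
  obtain ⟨t'', h1, h2⟩ := hc m.toNat
  have hm : (m.toNat : ℤ) = m := Int.toNat_of_nonneg (by positivity)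
  have hsq : ∀ z : GaussianInt, |z.re| + |z.im| ≤ m → InSquare ⟨-m.toNat, -m.toNat⟩ (2 * m.toNat) z := by
    intro z hz
    have a1 := abs_le.1 (le_refl |z.re|)
    have a2 := abs_le.1 (le_refl |z.im|)
    have a3 := abs_nonneg z.re
    have a4 := abs_nonneg z.im
    refine ⟨?_, ?_, ?_, ?_⟩ <;> push_cast <;> rw [hm] <;> linarith
  have b1 := abs_nonneg (c + ϖ ^ j * (1 + ϖ * w)).re
  have b2 := abs_nonneg (c + ϖ ^ j * (1 + ϖ * w)).im
  have b3 := abs_nonneg (c + ϖ ^ j).re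
  have b4 := abs_nonneg (c + ϖ ^ j).im
  rw [h2 _ (hsq _ (by simp only [m]; linarith)), h2 _ (hsq _ (by simp only [m]; linarith)), h1 j hj]
  · rw [add_sub_cancel_left]
    simpa using not_pow_dvd hj 0
  · rw [add_sub_cancel_left]
    exact not_pow_dvd hj w

/-! ### The covering associated to a Toeplitz function -/

section Orbits

variable (e : GaussianInt) (t : GaussianInt → ℤˣ)

/-- The complete curves of type `e` with turns given by `t`. -/
def Orbits : Set (ℤ → GaussianInt) :=
  {x | Crv (fun k => t (x k)) x ∧ ∀ k, IsSeg e (x k, x (k + 1))}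

/-- The next segment. -/
def succSeg : Equiv.Perm (GaussianInt × GaussianInt) where
  toFun A := (A.2, A.2 + ((t A.2 : ℤ) : GaussianInt) * I * (A.2 - A.1))
  invFun A := (A.1 + ((t A.1 : ℤ) : GaussianInt) * I * (A.2 - A.1), A.1)
  left_inv A := by
    ext1
    · simp only
      linear_combination (A.2 - A.1) * ((t A.2 : ℤ) : GaussianInt) * ((t A.2 : ℤ) : GaussianInt) *
        I_mul_I - (A.2 - A.1) * sign_mul_self (t A.2)
    · rfl
  right_inv A := by
    ext1
    · rfl
    · simp only
      linear_combination (A.1 - A.2) * ((t A.1 : ℤ) : GaussianInt) * ((t A.1 : ℤ) : GaussianInt) *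
        I_mul_I - (A.1 - A.2) * sign_mul_self (t A.1)

variable {e t}

theorem succSeg_apply_of_crv {x : ℤ → GaussianInt} (hx : Crv (fun k => t (x k)) x) (k : ℤ) :
    succSeg t (x k, x (k + 1)) = (x (k + 1), x (k + 1 + 1)) := by
  have := (hx k).2
  simp only [succSeg, Equiv.coe_fn_mk, Prod.mk.injEq, true_and]
  rw [← this, add_sub_cancel, add_assoc, one_add_one_eq_two]

theorem succSeg_zpow_of_crv {x : ℤ → GaussianInt} (hx : Crv (fun k => t (x k)) x) (k m : ℤ) :
    (succSeg t ^ m) (x k, x (k + 1)) = (x (k + m), x (k + m + 1)) := by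
  induction m using Int.induction_on with
  | zero => simp
  | succ m ih =>
    rw [add_comm (m : ℤ) 1, zpow_one_add, Equiv.Perm.mul_apply, ih, succSeg_apply_of_crv hx,
      show k + (1 + m) = k + (m : ℤ) + 1 by ring]
  | pred m ih =>
    rw [sub_eq_neg_add, zpow_add, zpow_neg_one, Equiv.Perm.mul_apply, ih, Equiv.Perm.inv_eq_iff_eq,
      show k + (-1 + -(m : ℤ)) = k + -m - 1 by ring, succSeg_apply_of_crv hx, sub_add_cancel]

theorem exists_orbit {A : GaussianInt × GaussianInt} (hA : IsSeg e A) :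
    ∃ x ∈ Orbits e t, x 0 = A.1 ∧ x 1 = A.2 := by
  have hsnd : ∀ k : ℤ, ((succSeg t ^ k) A).2 = ((succSeg t ^ (k + 1)) A).1 := by
    intro k
    rw [add_comm k 1, zpow_one_add, Equiv.Perm.mul_apply]
    rfl
  have hnext : ∀ k : ℤ, ((succSeg t ^ (k + 2)) A).1 = ((succSeg t ^ (k + 1)) A).1 +
      ((t ((succSeg t ^ (k + 1)) A).1 : ℤ) : GaussianInt) * I *
        (((succSeg t ^ (k + 1)) A).1 - ((succSeg t ^ k) A).1) := by
    intro k
    rw [show k + 2 = k + 1 + 1 by ring, ← hsnd (k + 1), ← hsnd k, add_comm k 1, zpow_one_add,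
      Equiv.Perm.mul_apply]
    rfl
  have hdir : ∀ k : ℤ, IsSeg e (((succSeg t ^ k) A).1, ((succSeg t ^ (k + 1)) A).1) := by
    have step : ∀ k : ℤ, IsSeg e (((succSeg t ^ (k + 1)) A).1, ((succSeg t ^ (k + 2)) A).1) ↔
        IsSeg e (((succSeg t ^ k) A).1, ((succSeg t ^ (k + 1)) A).1) := by
      intro k
      have := isSeg_next_iff (e := e) (z := ((succSeg t ^ k) A).1)
        (d := ((succSeg t ^ (k + 1)) A).1 - ((succSeg t ^ k) A).1)
        (t ((succSeg t ^ (k + 1)) A).1)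
      rwa [add_sub_cancel, ← hnext k] at this
    intro k
    induction k using Int.induction_on with
    | zero =>
      rw [← hsnd 0]
      simpa using hA
    | succ k ih => simpa [add_assoc] using (step _).2 ih
    | pred k ih =>
      apply (step _).1
      convert ih using 5 <;> ring
  refine ⟨fun k => ((succSeg t ^ k) A).1, ⟨fun k => ⟨(hdir k).1, ?_⟩, hdir⟩, by simp, ?_⟩
  · simp only
    rw [hnext k, add_sub_cancel_left]
  · simp only
    rw [← zero_add (1 : ℤ), ← hsnd 0]
    simp

theorem orbit_eq {x y : ℤ → GaussianInt} (hx : x ∈ Orbits e t) (hy : y ∈ Orbits e t) {k l : ℤ}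
    (h1 : y l = x k) (h2 : y (l + 1) = x (k + 1)) (m : ℤ) : y (l + m) = x (k + m) := by
  have e1 := succSeg_zpow_of_crv hx.1 k m
  have e2 := succSeg_zpow_of_crv hy.1 l m
  rw [h1, h2, e1] at e2
  exact (congrArg Prod.fst e2).symm

/-- Equality of curves up to the numbering of their segments. -/
def renumbering (e : GaussianInt) (t : GaussianInt → ℤˣ) : Setoid (Orbits e t) where
  r x y := ∃ m : ℤ, ∀ k, y.1 k = x.1 (k + m)
  iseqv :=
    { refl := fun x => ⟨0, by simp⟩
      symm := by
        rintro x y ⟨m, h⟩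
        exact ⟨-m, fun k => by rw [h]; simp⟩
      trans := by
        rintro x y z ⟨m, h⟩ ⟨m', h'⟩
        exact ⟨m' + m, fun k => by rw [h', h, add_assoc]⟩ }

/-- The set of complete curves of type `e` with turns given by `t`, each of them being numbered in
one way. -/
noncomputable def orbitCovering (e : GaussianInt) (t : GaussianInt → ℤˣ) : Set (ℤ → GaussianInt) :=
  Set.range fun q : Quotient (renumbering e t) => q.out.1

theorem orbits_of_mem {x : ℤ → GaussianInt} (h : x ∈ orbitCovering e t) : x ∈ Orbits e t := by
  obtain ⟨q, rfl⟩ := h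
  exact q.out.2

theorem exists_mem_orbitCovering {x : ℤ → GaussianInt} (h : x ∈ Orbits e t) :
    ∃ y ∈ orbitCovering e t, ∃ m : ℤ, ∀ k, y k = x (k + m) := by
  let q : Quotient (renumbering e t) := Quotient.mk _ ⟨x, h⟩
  have hq : (renumbering e t) ⟨x, h⟩ q.out := Quotient.exact (Quotient.out_eq q).symm
  obtain ⟨m, hm⟩ := hq
  exact ⟨q.out.1, ⟨q, rfl⟩, m, hm⟩

theorem orbitCovering_eq {x y : ℤ → GaussianInt} (hx : x ∈ orbitCovering e t)
    (hy : y ∈ orbitCovering e t) (h : ∃ m : ℤ, ∀ k, y k = x (k + m)) : x = y := by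
  obtain ⟨p, rfl⟩ := hx
  obtain ⟨q, rfl⟩ := hy
  have h' : (renumbering e t) p.out q.out := h
  have : p = q := by
    rw [← Quotient.out_eq p, ← Quotient.out_eq q]
    exact Quotient.sound h'
  rw [this]

theorem cf_of_mem_orbits (ht : ∀ n, ∃ c, PT n c t) {x : ℤ → GaussianInt} (hx : x ∈ Orbits e t) :
    CF fun k => t (x k) := by
  intro n
  obtain ⟨c, hc⟩ := ht n
  obtain ⟨r, -, hr⟩ := hx.1.exists_toep hc
  exact ⟨r, hr⟩

/-- An edge has one orientation of type `e`, and the turns determine the curve through it, up to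
numbering, in both directions. The index is unique because folding sequences are not periodic. -/
theorem isFoldingCovering_orbitCovering (he : ¬ ϖ ∣ e) (ht : ∀ n, ∃ c, PT n c t) :
    IsFoldingCovering (orbitCovering e t) := by
  constructor
  · intro x hx
    have hx := orbits_of_mem hx
    exact ⟨_, isCompleteFolding_of_cf ((cf_of_mem_orbits ht hx).shift 1), hx.1.isCompleteCurveOf⟩
  · intro z d hd
    have hd : IsDirection d := by
      rcases hd with rfl | rfl
      · exact Or.inl rfl
      · exact Or.inr (Or.inr (Or.inl rfl))
    obtain ⟨p, q, hpq, hseg⟩ : ∃ p q, s(p, q) = s(z, z + d) ∧ IsSeg e (p, q) := by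
      rcases isSeg_or_isSeg (z := z) he hd with h | h
      · exact ⟨_, _, rfl, h⟩
      · exact ⟨_, _, Sym2.eq_swap, h⟩
    rw [← hpq]
    have honly : ∀ (y : (ℤ → GaussianInt) × ℤ), y.1 ∈ orbitCovering e t ∧
        s(y.1 y.2, y.1 (y.2 + 1)) = s(p, q) → y.1 y.2 = p ∧ y.1 (y.2 + 1) = q := by
      rintro ⟨y, l⟩ ⟨hy, hs⟩
      rcases Sym2.eq_iff.1 hs with h | ⟨h1, h2⟩
      · exact h
      · have := (orbits_of_mem hy).2 l
        simp only at h1 h2 this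
        rw [h1, h2] at this
        exact absurd this hseg.not_swap
    obtain ⟨x, hx, hx0, hx1⟩ := exists_orbit (t := t) hseg
    obtain ⟨y, hy, m, hm⟩ := exists_mem_orbitCovering hx
    refine ⟨(y, -m), ⟨hy, ?_⟩, ?_⟩
    · simp only
      rw [hm, hm, neg_add_cancel, show -m + 1 + m = 1 by ring, hx0, hx1]
    · rintro ⟨w, l⟩ hw
      obtain ⟨h1, h2⟩ := honly _ hw
      obtain ⟨hw, -⟩ := hw
      simp only at h1 h2 hw
      have hy1 : y (-m) = p := by rw [hm, neg_add_cancel, hx0]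
      have hy2 : y (-m + 1) = q := by rw [hm, show -m + 1 + m = 1 by ring, hx1]
      have key := orbit_eq (orbits_of_mem hy) (orbits_of_mem hw) (h1.trans hy1.symm)
        (h2.trans hy2.symm)
      obtain rfl : y = w := orbitCovering_eq hy hw ⟨-m - l, fun k => by
        have := key (k - l)
        rw [add_sub_cancel] at this
        rw [this]
        congr 1
        ring⟩
      have hper := (cf_of_mem_orbits ht (orbits_of_mem hy)).not_periodic (N := -m - l) (by
        intro k
        have := key (k - l)
        rw [add_sub_cancel] at this
        rw [this]
        congr 2
        ring)
      simp only [Prod.mk.injEq, true_and]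
      linarith

theorem models_orbitCovering (he : ¬ ϖ ∣ e) : Models (orbitCovering e t) e t := by
  have hex : ∀ A, IsSeg e A → ∃ y ∈ orbitCovering e t, ∃ k : ℤ, y k = A.1 ∧ y (k + 1) = A.2 := by
    intro A hA
    obtain ⟨x, hx, hx0, hx1⟩ := exists_orbit (t := t) hA
    obtain ⟨y, hy, m, hm⟩ := exists_mem_orbitCovering hx
    exact ⟨y, hy, -m, by rw [hm, neg_add_cancel, hx0],
      by rw [hm, show -m + 1 + m = 1 by ring, hx1]⟩
  refine ⟨he, fun A => ⟨?_, ?_⟩, fun A B => ⟨?_, ?_⟩⟩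
  · rintro ⟨x, hx, k, rfl⟩
    exact (orbits_of_mem hx).2 k
  · intro hA
    obtain ⟨y, hy, k, h1, h2⟩ := hex A hA
    exact ⟨y, hy, k, by rw [h1, h2]⟩
  · rintro ⟨x, hx, k, rfl, rfl⟩
    refine ⟨(orbits_of_mem hx).2 k, ?_⟩
    have := ((orbits_of_mem hx).1 k).2
    simp only [Prod.mk.injEq, true_and]
    rw [← this]
    ring
  · rintro ⟨hA, rfl⟩
    obtain ⟨y, hy, k, h1, h2⟩ := hex A hA
    refine ⟨y, hy, k, by rw [h1, h2], ?_⟩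
    have := ((orbits_of_mem hy).1 k).2
    rw [Prod.mk.injEq, ← h1, ← h2]
    refine ⟨rfl, ?_⟩
    rw [← this]
    ring

end Orbits

/-! ### Copies and turn functions -/

theorem Models.isCopy {𝒞 𝒟 : Set (ℤ → GaussianInt)} {e e' : GaussianInt}
    {t t' : GaussianInt → ℤˣ} (h : Models 𝒞 e t) (h' : Models 𝒟 e' t')
    {F : Finset (GaussianInt × GaussianInt)} (hF : ∀ A ∈ F, IsSegment 𝒞 A) {u : GaussianInt}
    (hu : 2 ∣ e' - e - ϖ * u) (ht : ∀ A ∈ F, t' (A.2 + u) = t A.2) : IsCopy 𝒞 𝒟 F u := by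
  have hseg : ∀ A ∈ F, IsSeg e' (shift u A) := by
    intro A hA
    rw [isSeg_shift_iff]
    refine ((h.2.1 A).1 (hF A hA)).congr ?_
    convert hu using 1
    ring
  refine ⟨fun A hA => (h'.2.1 _).2 (hseg A hA), fun A hA B hB => ?_⟩
  rw [h.2.2, h'.2.2]
  refine and_congr (iff_of_true ((h.2.1 A).1 (hF A hA)) (hseg A hA)) ?_
  simp only [shift]
  rw [ht A hA, Prod.ext_iff, Prod.ext_iff]
  simp only
  constructor
  · rintro ⟨h1, h2⟩
    exact ⟨by rw [h1], by rw [h2]; ring⟩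
  · rintro ⟨h1, h2⟩
    exact ⟨by linear_combination h1, by linear_combination h2⟩

theorem Models.exists_turns {𝒞 𝒟 : Set (ℤ → GaussianInt)} {e e' : GaussianInt}
    {t t' : GaussianInt → ℤˣ} (h : Models 𝒞 e t) (hD : Models 𝒟 e' t')
    (hiso : ∀ F : Finset (GaussianInt × GaussianInt), (∀ A ∈ F, IsSegment 𝒞 A) →
      ∃ u, IsCopy 𝒞 𝒟 F u) (V : Finset GaussianInt) :
    ∃ u, ∀ v ∈ V, t' (v + u) = t v ∧ 2 ∣ e' - e - ϖ * u := by
  obtain ⟨F, hF, -, H⟩ := h.exists_pattern V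
  obtain ⟨u, hu⟩ := hiso F hF
  exact ⟨u, H 𝒟 e' t' u hD hu⟩

/-- The levels of finitely many nonzero Gaussian integers are bounded. -/
theorem exists_level (V : Finset GaussianInt) :
    ∃ n, 1 ≤ n ∧ ∀ v ∈ V, v ≠ 0 → ∃ j w, j + 2 ≤ n ∧ v = ϖ ^ j * (1 + ϖ * w) := by
  classical
  induction V using Finset.induction_on with
  | empty => exact ⟨1, le_rfl, by simp⟩
  | insert a V _ ih =>
    obtain ⟨n, hn, H⟩ := ih
    by_cases ha : a = 0
    · refine ⟨n, hn, fun v hv hv0 => ?_⟩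
      rcases Finset.mem_insert.1 hv with rfl | hv
      · exact absurd ha hv0
      · exact H v hv hv0
    · obtain ⟨j, w, hjw⟩ := exists_eq_of_ne_zero ha
      refine ⟨n + (j + 2), by omega, fun v hv hv0 => ?_⟩
      rcases Finset.mem_insert.1 hv with rfl | hv
      · exact ⟨j, w, by omega, hjw⟩
      · obtain ⟨j', w', h1, h2⟩ := H v hv hv0
        exact ⟨j', w', by omega, h2⟩

/-- Both signs occur at exact level `n`. A point of high level can therefore imitate the centre,
whatever the turn there. -/
theorem PT.exists_eq {n : ℕ} {c : GaussianInt} {t : GaussianInt → ℤˣ} (h : PT (n + 1) c t)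
    (s : ℤˣ) : ∃ w, t (c + ϖ ^ n * (1 + ϖ * w)) = s := by
  by_cases h0 : t (c + ϖ ^ n) = s
  · exact ⟨0, by simpa using h0⟩
  · refine ⟨1, ?_⟩
    rw [h n (by omega), show χ 1 = -1 from rfl]
    rcases Int.units_eq_one_or s with h1 | h1 <;>
      rcases Int.units_eq_one_or (t (c + ϖ ^ n)) with h2 | h2 <;> simp_all

theorem PT.periodic_zero {n j : ℕ} {t : GaussianInt → ℤˣ} (h : PT n 0 t) (hj : j < n)
    (w : GaussianInt) {y : GaussianInt} (hy : ϖ ^ (j + 2) ∣ y) :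
    t (ϖ ^ j * (1 + ϖ * w) + y) = t (ϖ ^ j * (1 + ϖ * w)) := by
  have := h.periodic hj w hy
  rwa [zero_add] at this

theorem exists_multiple {K : ℤ} (hK : 0 < K) (a : ℤ) : ∃ q, a ≤ K * q ∧ K * q ≤ a + K := by
  refine ⟨a / K + 1, ?_, ?_⟩
  · have := Int.lt_mul_ediv_self_add (x := a) hK
    linarith
  · have := Int.mul_ediv_self_le (x := a) hK.ne'
    linarith

/-- A covering with a centre has the local isomorphism property. -/
theorem Models.localIsomorphismProperty {𝒟 : Set (ℤ → GaussianInt)} {e : GaussianInt}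
    {t : GaussianInt → ℤˣ} (h : Models 𝒟 e t) (ht : ∀ n, PT n 0 t) :
    LocalIsomorphismProperty 𝒟 := by
  classical
  intro F hF
  -- The nonzero vertices of `F` have levels at most `M - 2`, so translation by a multiple of `ϖ ^
  -- M` preserves their turns; `u₀` is such a multiple with the same turn as `0`.
  obtain ⟨M, hM, hlev⟩ := exists_level (F.image Prod.snd)
  obtain ⟨w₀, hw₀⟩ := (ht (M + 1)).exists_eq (t 0)
  rw [zero_add] at hw₀
  set u₀ := ϖ ^ M * (1 + ϖ * w₀) with hu₀
  let size : GaussianInt → ℕ := fun z => z.re.natAbs + z.im.natAbs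
  let B := F.sup fun A => size (A.1 + u₀) + size (A.2 + u₀)
  -- After translation by `u₀` the pattern has coordinates at most `B` in absolute value, and it may
  -- be moved further by any multiple of `2 ^ (M + 2)`.
  refine ⟨2 * B + 2 ^ (M + 2), fun c => ?_⟩
  have hK : (0 : ℤ) < 2 ^ (M + 2) := by positivity
  obtain ⟨q, hq1, hq2⟩ := exists_multiple hK (c.re + B)
  obtain ⟨r, hr1, hr2⟩ := exists_multiple hK (c.im + B)
  have hcast : (2 : GaussianInt) ^ (M + 2) = ((2 ^ (M + 2) : ℤ) : GaussianInt) := by push_cast; rfl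
  have hy : ϖ ^ (M + 2) ∣ 2 ^ (M + 2) * (⟨q, r⟩ : GaussianInt) :=
    (varpi_pow_dvd_two_pow _).mul_right _
  have hMu : ϖ ^ M ∣ u₀ + 2 ^ (M + 2) * (⟨q, r⟩ : GaussianInt) :=
    dvd_add (dvd_mul_right _ _) ((pow_dvd_pow ϖ (by omega)).trans hy)
  refine ⟨u₀ + 2 ^ (M + 2) * ⟨q, r⟩, h.isCopy h hF ?_ ?_, fun A hA => ?_⟩
  · rw [sub_self, zero_sub, dvd_neg, two_dvd_mul_varpi]
    exact (dvd_pow_self ϖ (by omega)).trans hMu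
  · intro A hA
    by_cases h0 : A.2 = 0
    · rw [h0, zero_add, hu₀, (ht (M + 1)).periodic_zero (Nat.lt_succ_self M) _ hy, hw₀]
    · obtain ⟨j, w, hj, hjw⟩ := hlev A.2 (Finset.mem_image_of_mem _ hA) h0
      rw [hjw]
      exact (ht (j + 1)).periodic_zero (Nat.lt_succ_self j) w ((pow_dvd_pow ϖ hj).trans hMu)
  · have hB : size (A.1 + u₀) + size (A.2 + u₀) ≤ B :=
      Finset.le_sup (f := fun A => size (A.1 + u₀) + size (A.2 + u₀)) hA
    have hin : ∀ z : GaussianInt, size (z + u₀) ≤ B →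
        InSquare c (2 * B + 2 ^ (M + 2)) (z + (u₀ + 2 ^ (M + 2) * ⟨q, r⟩)) := by
      intro z hz
      have e1 : (z + (u₀ + 2 ^ (M + 2) * ⟨q, r⟩)).re = (z + u₀).re + 2 ^ (M + 2) * q := by
        rw [hcast, ← add_assoc, Zsqrtd.re_add, Zsqrtd.re_smul]
      have e2 : (z + (u₀ + 2 ^ (M + 2) * ⟨q, r⟩)).im = (z + u₀).im + 2 ^ (M + 2) * r := by
        rw [hcast, ← add_assoc, Zsqrtd.im_add, Zsqrtd.im_smul]
      simp only [size] at hz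
      rw [InSquare, e1, e2]
      push_cast
      generalize (2 : ℤ) ^ (M + 2) * q = Q at *
      generalize (2 : ℤ) ^ (M + 2) * r = R at *
      generalize (2 : ℤ) ^ (M + 2) = K at *
      refine ⟨?_, ?_, ?_, ?_⟩ <;> omega
    exact ⟨hin A.1 (by omega), hin A.2 (by omega)⟩

/-! ### Coverings generated by an infinite folding curve -/

/-- The complete sequence `(bar S, η, S)`, with `η` at the place `0`. -/
def joinSeq (a : ℕ → ℤˣ) (η : ℤˣ) (k : ℤ) : ℤˣ :=
  if 0 < k then a (k - 1).toNat else if k = 0 then η else -a (-k - 1).toNat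

theorem joinSeq_succ (a : ℕ → ℤˣ) (η : ℤˣ) (k : ℕ) : joinSeq a η (k + 1) = a k := by
  rw [joinSeq, if_pos (by positivity)]
  simp

theorem joinSeq_neg (a : ℕ → ℤˣ) (η : ℤˣ) (k : ℕ) : joinSeq a η (-(k + 1)) = -a k := by
  rw [joinSeq, if_neg (by linarith), if_neg (by linarith)]
  simp

theorem joinSeq_zero (a : ℕ → ℤˣ) (η : ℤˣ) : joinSeq a η 0 = η := by simp [joinSeq]

theorem joined_natCast (h : ℕ → GaussianInt) (η σ : ℤˣ) (k : ℕ) :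
    joined h η σ k = h 0 + ((σ : ℤ) : GaussianInt) * (h k - h 0) := by
  rw [joined, if_pos (by positivity)]
  simp

theorem joined_zero (h : ℕ → GaussianInt) (η σ : ℤˣ) : joined h η σ 0 = h 0 := by
  simpa using joined_natCast h η σ 0

theorem joined_neg (h : ℕ → GaussianInt) (η σ : ℤˣ) (k : ℕ) :
    joined h η σ (-k) = h 0 +
      ((η : ℤ) : GaussianInt) * I * ((σ : ℤ) : GaussianInt) * (h k - h 0) := by
  cases k with
  | zero => simp [joined_zero]
  | succ k =>
    rw [joined, if_neg (by push_cast; linarith)]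
    simp

theorem int_cases (k : ℤ) : (∃ n : ℕ, k = n) ∨ k = -1 ∨ ∃ n : ℕ, k = -(n + 2) := by
  rcases lt_or_ge k 0 with h | h
  · rcases eq_or_lt_of_le (Int.le_sub_one_of_lt h) with h | h
    · exact Or.inr (Or.inl (by simpa using h))
    · obtain ⟨n, hn⟩ := Int.eq_ofNat_of_zero_le (a := -k - 2) (by linarith)
      exact Or.inr (Or.inr ⟨n, by linarith⟩)
  · exact Or.inl (Int.eq_ofNat_of_zero_le h)

theorem IsDirection.sign_mul {d : GaussianInt} (h : IsDirection d) (s : ℤˣ) :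
    IsDirection (((s : ℤ) : GaussianInt) * d) := by
  rcases Int.units_eq_one_or s with rfl | rfl
  · simpa using h
  · simpa using h.neg

theorem crv_joined {a : ℕ → ℤˣ} {h : ℕ → GaussianInt} (hh : IsInftyCurveOf a h) (η σ : ℤˣ) :
    Crv (joinSeq a η) (joined h η σ) := by
  intro k
  rcases int_cases k with ⟨n, rfl⟩ | rfl | ⟨n, rfl⟩
  · have e1 := joined_natCast h η σ (n + 1)
    have e2 := joined_natCast h η σ (n + 2)
    push_cast at e1 e2
    rw [joined_natCast, e1, e2, joinSeq_succ]
    obtain ⟨h1, h2⟩ := hh n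
    constructor
    · convert h1.sign_mul σ using 1
      ring
    · linear_combination ((σ : ℤ) : GaussianInt) * h2
  · have e1 := joined_natCast h η σ 1
    have e2 := joined_neg h η σ 1
    push_cast at e1 e2
    rw [neg_add_cancel, show (-1 : ℤ) + 2 = 1 by rfl, joined_zero, joinSeq_zero, e1, e2]
    obtain ⟨h1, -⟩ := hh 0
    rw [zero_add] at h1
    constructor
    · convert ((h1.sign_mul σ).turn η).neg using 1
      ring
    · linear_combination (-((σ : ℤ) : GaussianInt)) * (h 1 - h 0) * (sign_mul_self η -
        ((η : ℤ) : GaussianInt) * ((η : ℤ) : GaussianInt) * I_mul_I)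
  · have e0 := joined_neg h η σ n
    have e1 := joined_neg h η σ (n + 1)
    have e2 := joined_neg h η σ (n + 2)
    push_cast at e1 e2
    rw [show -((n : ℤ) + 2) + 1 = -(n + 1) by ring, show -((n : ℤ) + 2) + 2 = -n by ring, e0, e1, e2,
      joinSeq_neg]
    obtain ⟨h1, h2⟩ := hh n
    have h3 := (hh (n + 1)).1
    constructor
    · convert ((h3.sign_mul σ).turn η).neg using 1
      ring
    · push_cast
      generalize ((η : ℤ) : GaussianInt) * I * ((σ : ℤ) : GaussianInt) = c
      have hs := sign_mul_self (a n)
      generalize ((a n : ℤ) : GaussianInt) = s at *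
      linear_combination (-(c * s * I)) * h2 - c * (h (n + 1) - h n) * (s * s * I_mul_I - hs)

/-- Places of finite level are nonzero, so `η` plays no part. A long prefix of `a` agrees with a
Toeplitz sequence, whose antisymmetry accounts for the negative places. -/
theorem toep_joinSeq {a : ℕ → ℤˣ} (ha : IsInftyFolding a) (η : ℤˣ) (n : ℕ) :
    Toep n (joinSeq a η) := by
  intro j hj m
  obtain ⟨N, hN, hNn⟩ : ∃ N : ℕ, (2 ^ j * (2 * m + 1)).natAbs + 2 ^ j < 2 ^ N ∧ n ≤ N := by
    refine ⟨(2 ^ j * (2 * m + 1)).natAbs + 2 ^ j + n, ?_, Nat.le_add_left _ _⟩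
    exact (Nat.le_add_right _ n).trans_lt Nat.lt_two_pow_self
  obtain ⟨f, hf, hfa⟩ := ha.toep_prefix N
  have key : ∀ k : ℤ, k ≠ 0 → k.natAbs < 2 ^ N → joinSeq a η k = f k := by
    intro k hk hkN
    rcases lt_or_gt_of_ne hk with h | h
    · obtain ⟨i, hi⟩ := Int.eq_ofNat_of_zero_le (a := -k - 1) (by linarith)
      obtain rfl : k = -(i + 1) := by linarith
      rw [joinSeq_neg, hf.neg_apply, hfa i (by omega)]
      intro hd
      have := Int.le_of_dvd (by positivity) hd
      have h3 : ((2 ^ N : ℕ) : ℤ) = 2 ^ N := by push_cast; rfl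
      omega
    · obtain ⟨i, hi⟩ := Int.eq_ofNat_of_zero_le (a := k - 1) (by linarith)
      obtain rfl : k = i + 1 := by linarith
      rw [joinSeq_succ, hfa i (by omega)]
  have hpos : (0 : ℤ) < 2 ^ j := by positivity
  rw [key _ (mul_ne_zero hpos.ne' (by omega)) ((Nat.le_add_right _ _).trans_lt hN),
    key _ hpos.ne' ?_]
  · exact hf j (by omega) m
  · rw [Int.natAbs_pow]
    exact (Nat.le_add_left _ _).trans_lt hN

/-- The turns of a generated covering are centred at the origin of the generating curve. -/
theorem IsGeneratedBy.pt {𝒟 : Set (ℤ → GaussianInt)} {h : ℕ → GaussianInt}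
    (hh : IsInftyFoldingCurve h) (hgen : IsGeneratedBy 𝒟 h) {e : GaussianInt}
    {t : GaussianInt → ℤˣ} (hM : Models 𝒟 e t) (ht : ∀ n, ∃ c, PT n c t) (n : ℕ) : PT n (h 0) t := by
  obtain ⟨a, ha, hcurve⟩ := hh
  obtain ⟨-, -, η, H⟩ := hgen
  obtain ⟨y, hy, m, hym⟩ := H 1
  have hjoin : ∀ k, joined h η 1 k = y (-m + k) := by
    intro k
    rw [hym]
    congr 1
    ring
  have hcrv := crv_joined hcurve η 1
  have hcrv' : Crv (fun k => t (joined h η 1 k)) (joined h η 1) := by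
    intro k
    refine ⟨(hcrv k).1, ?_⟩
    have h1 : IsConsecutive 𝒟 (joined h η 1 k, joined h η 1 (k + 1))
        (joined h η 1 (k + 1), joined h η 1 (k + 2)) := by
      simp only [hjoin, ← add_assoc]
      exact ⟨y, hy, -m + k, rfl, rfl⟩
    have h2 := congrArg Prod.snd ((hM.2.2 _ _).1 h1).2
    simp only at h2
    rw [h2, add_sub_cancel_left]
  -- One extra level is needed to compare centres: it gives `2 ^ n ∣ r` for the centre `r` read on
  -- the curve, hence `ϖ ^ n` divides the displacement from the origin.
  have hT := toep_joinSeq ha η (n + 1)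
  rw [hcrv.turn_unique hcrv'] at hT
  obtain ⟨c, hc⟩ := ht n
  obtain ⟨r, hr, hTr⟩ := hcrv'.exists_toep hc
  have h1 := hT.dvd_of_shift hTr
  have h2 := (hcrv'.pow_dvd_iff (hT.mono (Nat.le_succ n)) r).2 h1
  rw [joined_zero] at h2
  refine hc.congr_centre ?_
  have := dvd_sub hr h2
  convert this using 1
  ring

/-- Uniqueness of the turns of a generated covering. -/
theorem eq_of_locally_isomorphic {e₁ e₂ X₁ X₂ : GaussianInt} {t₁ t₂ : GaussianInt → ℤˣ}
    (h₁ : ∀ n, PT n X₁ t₁) (h₂ : ∀ n, PT n X₂ t₂)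
    (hiso : ∀ V : Finset GaussianInt,
      ∃ u, ∀ v ∈ V, t₂ (v + u) = t₁ v ∧ 2 ∣ e₂ - e₁ - ϖ * u) :
    2 ∣ e₂ - e₁ - ϖ * (X₂ - X₁) ∧ ∀ z, z ≠ 0 → t₂ (X₂ + z) = t₁ (X₁ + z) := by
  classical
  have main : ∀ (n : ℕ) (z : GaussianInt), ∃ u, 2 ∣ e₂ - e₁ - ϖ * u ∧ ϖ ^ n ∣ X₁ + u - X₂ ∧
      t₂ (X₁ + u + z) = t₁ (X₁ + z) := by
    intro n z
    -- The finite test points that detect a centre at level `n`; the copied set consists of them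
    -- together with `X₁ + z`.
    let W : Finset GaussianInt := {0, I, ϖ, I + ϖ}
    obtain ⟨u, hu⟩ := hiso (insert (X₁ + z) (((Finset.range n) ×ˢ W).image
      fun p => X₁ + ϖ ^ p.1 * (1 + ϖ * p.2)))
    have hz := hu (X₁ + z) (Finset.mem_insert_self _ _)
    refine ⟨u, hz.2, (h₂ (n + 1)).dvd_of_local fun j hj w hw => ?_, ?_⟩
    · have hmem : ∀ w ∈ W, t₂ (X₁ + u + ϖ ^ j * (1 + ϖ * w)) = t₁ (X₁ + ϖ ^ j * (1 + ϖ * w)) := by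
        intro w hw
        rw [← (hu (X₁ + ϖ ^ j * (1 + ϖ * w)) (Finset.mem_insert_of_mem (Finset.mem_image.2
          ⟨(j, w), Finset.mem_product.2 ⟨Finset.mem_range.2 hj, hw⟩, rfl⟩))).1]
        congr 1
        ring
      have h0 := hmem 0 (by simp [W])
      rw [mul_zero, add_zero, mul_one] at h0
      rw [h0, hmem w (by simpa [W] using hw), h₁ (j + 1) j (by omega)]
    · rw [← hz.1]
      congr 1
      ring
  constructor
  · obtain ⟨u, h1, h2, -⟩ := main 1 0
    rw [pow_one, ← two_dvd_mul_varpi] at h2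
    have := dvd_add h1 h2
    convert this using 1
    ring
  · intro z hz
    obtain ⟨j, w, rfl⟩ := exists_eq_of_ne_zero hz
    obtain ⟨u, -, h2, h3⟩ := main (j + 2) (ϖ ^ j * (1 + ϖ * w))
    rw [← h3, ← (h₂ (j + 1)).periodic (Nat.lt_succ_self j) w h2]
    congr 1
    ring

/-! ### The limit covering and local isomorphism -/

/-- The limit of a Toeplitz function at its centres. -/
theorem exists_limit {t : GaussianInt → ℤˣ} {c : ℕ → GaussianInt} (hc : ∀ n, PT n (c n) t) :
    ∃ t' : GaussianInt → ℤˣ, ∀ j w n, j + 2 ≤ n →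
      t (c n + ϖ ^ j * (1 + ϖ * w)) = t' (ϖ ^ j * (1 + ϖ * w)) := by
  have hcc : ∀ m n, m ≤ n → ϖ ^ m ∣ c m - c n := by
    intro m n hmn
    rcases eq_or_lt_of_le hmn with rfl | h
    · simp
    · exact ((hc n).mono h).dvd_centre (hc m)
  have stable : ∀ j w n, j + 2 ≤ n →
      t (c n + ϖ ^ j * (1 + ϖ * w)) = t (c (j + 2) + ϖ ^ j * (1 + ϖ * w)) := by
    intro j w n hn
    rw [← (hc n).periodic (by omega) w (hcc _ _ hn)]
    congr 1
    ring
  have hex : ∀ z, ∃ s, ∀ j w n, z = ϖ ^ j * (1 + ϖ * w) → j + 2 ≤ n → t (c n + z) = s := by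
    intro z
    by_cases hz : ∃ j w, z = ϖ ^ j * (1 + ϖ * w)
    · obtain ⟨j, w, hjw⟩ := hz
      refine ⟨t (c (j + 2) + z), fun j' w' n hjw' hn => ?_⟩
      have a1 := stable j' w' n hn
      have a2 := stable j' w' (n + (j + 2)) (by omega)
      have a3 := stable j w (n + (j + 2)) (by omega)
      rw [← hjw'] at a1 a2
      rw [← hjw] at a3
      rw [a1, ← a2, a3]
    -- Only `z = 0` arises here; the turn at the limit centre is arbitrary.
    · exact ⟨1, fun j w n hjw => absurd ⟨j, w, hjw⟩ hz⟩
  choose t' ht' using hex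
  exact ⟨t', fun j w n hn => ht' _ j w n rfl hn⟩

/-- Since `I - 1 = ϖ * I`, a quarter turn adds to a point of level `j` an odd multiple of `ϖ ^ (j +
1)`. -/
theorem PT.apply_I_mul {t : GaussianInt → ℤˣ} (ht : ∀ n, PT n 0 t) {z : GaussianInt} (hz : z ≠ 0) :
    t (I * z) = -t z := by
  obtain ⟨j, w, rfl⟩ := exists_eq_of_ne_zero hz
  have := (ht (j + 1)).apply_add (Nat.lt_succ_self j) w (I * (1 + ϖ * w))
  rw [χ_of_not_dvd, neg_one_mul, zero_add] at this
  · rw [← this]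
    congr 1
    simp only [ϖ]
    linear_combination (-((1 + I) ^ j * (1 + (1 + I) * w))) * I_mul_I
  · intro h
    have := dvd_mul_of_dvd_right h (-I)
    rw [show -I * (I * (1 + ϖ * w)) = 1 + ϖ * w by
      linear_combination (-(1 + ϖ * w)) * I_mul_I] at this
    exact not_dvd_one_add w this

theorem PT.apply_sign_mul {t : GaussianInt → ℤˣ} (ht : ∀ n, PT n 0 t) (s : ℤˣ) (z : GaussianInt) :
    t (((s : ℤ) : GaussianInt) * z) = t z := by
  rcases Int.units_eq_one_or s with rfl | rfl
  · simp
  · by_cases hz : z = 0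
    · simp [hz]
    · have h1 := PT.apply_I_mul ht (mul_ne_zero (by decide : I ≠ 0) hz)
      rw [PT.apply_I_mul ht hz, neg_neg, ← mul_assoc, I_mul_I] at h1
      simpa using h1

/-- A function centred at `0` gives a covering generated by an infinite folding curve. -/
theorem exists_isGeneratedBy {e : GaussianInt} {t : GaussianInt → ℤˣ} (he : ¬ ϖ ∣ e)
    (ht : ∀ n, PT n 0 t) :
    ∃ h, IsInftyFoldingCurve h ∧ IsGeneratedBy (orbitCovering e t) h := by
  obtain ⟨d, hd⟩ : ∃ d, IsSeg e (0, d) := by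
    rcases isSeg_or_isSeg (z := 0) he (d := 1) (Or.inl rfl) with h | h
    · exact ⟨_, h⟩
    · have h1 := (isSeg_next_iff (e := e) (z := 1) (d := -1) 1).2 (by simpa using h)
      exact ⟨_, by simpa using h1⟩
  obtain ⟨x, hx, hx0, hx1⟩ := exists_orbit (t := t) hd
  simp only at hx0 hx1
  have hcurve : IsInftyCurveOf (fun k : ℕ => t (x (k + 1))) fun k : ℕ => x k := by
    intro k
    have := hx.1 k
    push_cast
    exact this
  -- The curve starts at the common centre of all levels, so its sequence is Toeplitz about the
  -- index `0` at every level.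
  have hT : ∀ n, Toep n fun k => t (x k) := fun n => hx.1.toep_of_pt (hx0 ▸ ht n)
  have hinj : ∀ k : ℤ, k ≠ 0 → x k ≠ 0 := by
    intro k hk hxk
    obtain ⟨n, hn⟩ : ∃ n : ℕ, k.natAbs < 2 ^ n := ⟨_, Nat.lt_two_pow_self⟩
    have h1 := (hx.1.pow_dvd_iff (hT n) k).1 (by rw [hxk, hx0]; simp)
    have h2 := Int.natAbs_dvd_natAbs.2 h1
    rw [Int.natAbs_pow] at h2
    have := Nat.le_of_dvd (by omega) h2
    simp at this
    omega
  have hmodels := models_orbitCovering (t := t) he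
  refine ⟨fun k : ℕ => x k, ⟨_, isInftyFolding_of_toep hT, hcurve⟩,
    isFoldingCovering_orbitCovering he fun n => ⟨0, ht n⟩, hmodels.localIsomorphismProperty ht,
    t 0, fun σ => ?_⟩
  apply exists_mem_orbitCovering
  have hcrv := crv_joined hcurve (t 0) σ
  set y := joined (fun k : ℕ => x k) (t 0) σ with hy
  -- On the backward half, the sign from `bar` matches the sign that a quarter turn gives to `t`;
  -- half turns change nothing.
  have hturn : joinSeq (fun k : ℕ => t (x (k + 1))) (t 0) = fun k => t (y k) := by
    funext k
    rcases lt_trichotomy k 0 with h | rfl | h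
    · obtain ⟨i, hi⟩ := Int.eq_ofNat_of_zero_le (a := -k - 1) (by linarith)
      obtain rfl : k = -(i + 1) := by linarith
      have := joined_neg (fun k : ℕ => x k) (t 0) σ (i + 1)
      push_cast at this
      rw [joinSeq_neg, hy, this, hx0, zero_add, sub_zero, mul_assoc, mul_assoc,
        PT.apply_sign_mul ht, PT.apply_I_mul ht, PT.apply_sign_mul ht]
      exact mul_ne_zero (by rcases Int.units_eq_one_or σ with rfl | rfl <;> decide)
        (hinj _ (by linarith))
    · rw [joinSeq_zero, hy, joined_zero]
      simp [hx0]
    · obtain ⟨i, hi⟩ := Int.eq_ofNat_of_zero_le (a := k - 1) (by linarith)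
      obtain rfl : k = i + 1 := by linarith
      have := joined_natCast (fun k : ℕ => x k) (t 0) σ (i + 1)
      push_cast at this
      rw [joinSeq_succ, hy, this, hx0, zero_add, sub_zero, PT.apply_sign_mul ht]
  rw [hturn] at hcrv
  refine ⟨hcrv, hcrv.isSeg (k := 0) ?_⟩
  have h0 : y 0 = 0 := by
    rw [hy, joined_zero]
    exact_mod_cast hx0
  have h1 : y (0 + 1) = ((σ : ℤ) : GaussianInt) * d := by
    have := joined_natCast (fun k : ℕ => x k) (t 0) σ 1
    push_cast at this
    rw [zero_add, hy, this, hx0, hx1]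
    ring
  rw [h0, h1]
  refine ⟨?_, ?_⟩
  · have := hd.1.sign_mul σ
    simpa using this
  · have h2 := two_dvd_sign_add_one (-σ) d
    have h3 := dvd_sub hd.2 h2
    convert h3 using 1
    push_cast
    ring

/-- A covering is locally isomorphic to the covering obtained at the limit of its centres. -/
theorem locallyIsomorphic_of_limit {𝒞 𝒟 : Set (ℤ → GaussianInt)} {e : GaussianInt}
    {t t' : GaussianInt → ℤˣ} {c : ℕ → GaussianInt} (hc : ∀ n, PT n (c n) t)
    (hlim : ∀ j w n, j + 2 ≤ n → t (c n + ϖ ^ j * (1 + ϖ * w)) = t' (ϖ ^ j * (1 + ϖ * w)))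
    (ht' : ∀ n, PT n 0 t') (h𝒞 : Models 𝒞 e t) (h𝒟 : Models 𝒟 (e - ϖ * c 1) t') :
    LocallyIsomorphic 𝒞 𝒟 := by
  classical
  have hcc : ∀ m n, m ≤ n → ϖ ^ m ∣ c m - c n := by
    intro m n hmn
    rcases eq_or_lt_of_le hmn with rfl | h
    · simp
    · exact ((hc n).mono h).dvd_centre (hc m)
  -- Hence `ϖ * c n` is constant modulo `2` for `n ≥ 1`, and `e - ϖ * c 1` is the type after
  -- translation by any of these `-c n`.
  have hone : ∀ n, 1 ≤ n → ϖ ∣ c 1 - c n := fun n hn => by simpa using hcc 1 n hn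
  constructor
  · intro F hF
    let V := F.image Prod.snd
    obtain ⟨n, hn, hlev⟩ := exists_level ((V ×ˢ V).image fun p => p.1 - p.2)
    -- Differences of distinct vertices have level at most `n - 2`, so at most one vertex lies in `c
    -- n + (ϖ ^ n)`. If there is one, it is sent to a point of level `n` with the prescribed turn.
    -- Otherwise all levels about `c (n + 2)` are below `n`, and this centre can be sent to `0`.
    by_cases hex : ∃ v₀ ∈ V, ϖ ^ n ∣ v₀ - c n
    · obtain ⟨v₀, hv₀, hdvd⟩ := hex
      obtain ⟨w₀, hw₀⟩ := (ht' (n + 1)).exists_eq (t v₀)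
      rw [zero_add] at hw₀
      refine ⟨ϖ ^ n * (1 + ϖ * w₀) - v₀, h𝒞.isCopy h𝒟 hF ?_ ?_⟩
      · have h1 := hone n hn
        have h2 := (dvd_pow_self ϖ (by omega : n ≠ 0)).trans hdvd
        have h3 : ϖ ∣ ϖ ^ n * (1 + ϖ * w₀) := (dvd_pow_self ϖ (by omega : n ≠ 0)).mul_right _
        have h4 := two_dvd_mul_varpi.2 (dvd_sub (dvd_sub h2 h1) h3)
        convert h4 using 1
        ring
      · intro A hA
        have hAV : A.2 ∈ V := Finset.mem_image_of_mem _ hA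
        by_cases h0 : A.2 = v₀
        · rw [h0, add_sub_cancel, hw₀]
        · obtain ⟨j, w, hj, hjw⟩ := hlev (A.2 - v₀)
            (Finset.mem_image.2 ⟨(A.2, v₀), Finset.mem_product.2 ⟨hAV, hv₀⟩, rfl⟩)
            (sub_ne_zero.2 h0)
          rw [show A.2 + (ϖ ^ n * (1 + ϖ * w₀) - v₀) =
            ϖ ^ j * (1 + ϖ * w) + ϖ ^ n * (1 + ϖ * w₀) by linear_combination hjw,
            (ht' (j + 1)).periodic_zero (Nat.lt_succ_self j) w
              ((pow_dvd_pow ϖ hj).mul_right _), ← hlim j w n hj,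
            ← (hc n).periodic (by omega) w ((pow_dvd_pow ϖ hj).trans hdvd)]
          congr 1
          linear_combination -hjw
    · push Not at hex
      refine ⟨-c (n + 2), h𝒞.isCopy h𝒟 hF ?_ ?_⟩
      · have h4 := two_dvd_mul_varpi.2 (hone (n + 2) (by omega))
        rw [← dvd_neg] at h4
        convert h4 using 1
        ring
      · intro A hA
        rcases dvd_or_eq n (A.2 - c (n + 2)) with hd | ⟨j, hj, w, hjw⟩
        · refine absurd ?_ (hex A.2 (Finset.mem_image_of_mem _ hA))
          have := dvd_sub hd (hcc n (n + 2) (by omega))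
          convert this using 1
          ring
        · rw [← sub_eq_add_neg, hjw, ← hlim j w (n + 2) (by omega), ← hjw, add_sub_cancel]
  · intro F hF
    obtain ⟨n, hn, hlev⟩ := exists_level (F.image Prod.snd)
    obtain ⟨w₀, hw₀⟩ := (hc (n + 1)).exists_eq (t' 0)
    -- The centre `0` goes to a point of level `n` about `c (n + 1)` with turn `t' 0`; the other
    -- vertices have lower level and keep their turns by periodicity.
    refine ⟨c (n + 1) + ϖ ^ n * (1 + ϖ * w₀), h𝒟.isCopy h𝒞 hF ?_ ?_⟩
    · have h3 : ϖ ∣ ϖ ^ n * (1 + ϖ * w₀) := (dvd_pow_self ϖ (by omega : n ≠ 0)).mul_right _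
      have h4 := two_dvd_mul_varpi.2 (dvd_sub (hone (n + 1) (by omega)) h3)
      convert h4 using 1
      ring
    · intro A hA
      by_cases h0 : A.2 = 0
      · rw [h0, zero_add, hw₀]
      · obtain ⟨j, w, hj, hjw⟩ := hlev A.2 (Finset.mem_image_of_mem _ hA) h0
        rw [hjw, ← hlim j w (n + 1) (by omega), ← (hc (n + 1)).periodic (by omega) w
          ((pow_dvd_pow ϖ hj).mul_right (1 + ϖ * w₀))]
        congr 1
        ring

end Paperfolding

open Paperfolding
theorem theorem4 (𝒞 : Set (ℤ → GaussianInt)) (h𝒞 : IsFoldingCovering 𝒞)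
    (hloc : LocalIsomorphismProperty 𝒞) :
    (∃ (h : ℕ → GaussianInt) (𝒟 : Set (ℤ → GaussianInt)),
      IsInftyFoldingCurve h ∧ IsGeneratedBy 𝒟 h ∧ LocallyIsomorphic 𝒞 𝒟) ∧
    ∀ (h₁ h₂ : ℕ → GaussianInt) (𝒟₁ 𝒟₂ : Set (ℤ → GaussianInt)),
      IsInftyFoldingCurve h₁ → IsGeneratedBy 𝒟₁ h₁ → LocallyIsomorphic 𝒞 𝒟₁ →
      IsInftyFoldingCurve h₂ → IsGeneratedBy 𝒟₂ h₂ → LocallyIsomorphic 𝒞 𝒟₂ →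
      EqualUpToConnectionsAt 𝒟₁ 𝒟₂ (h₂ 0 - h₁ 0) (h₁ 0) := by
  classical
  obtain ⟨e, t, hM, hPT⟩ := exists_models h𝒞 hloc
  constructor
  · choose c hc using hPT
    obtain ⟨t', ht'⟩ := exists_limit hc
    have hPT' : ∀ n, PT n 0 t' := by
      intro n j hj w
      have h0 := ht' j 0 (j + 2) le_rfl
      rw [mul_zero, add_zero, mul_one] at h0
      rw [zero_add, zero_add, ← ht' j w (j + 2) le_rfl, ← h0]
      exact hc (j + 2) j (by omega) w
    have he : ¬ ϖ ∣ e - ϖ * c 1 := by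
      rw [dvd_sub_left (dvd_mul_right _ _)]
      exact hM.1
    obtain ⟨h, hh, hgen⟩ := exists_isGeneratedBy he hPT'
    exact ⟨h, _, hh, hgen, locallyIsomorphic_of_limit hc ht' hPT' hM (models_orbitCovering he)⟩
  · intro h₁ h₂ 𝒟₁ 𝒟₂ hh₁ hg₁ hl₁ hh₂ hg₂ hl₂
    obtain ⟨e₁, t₁, hM₁, hPT₁⟩ := exists_models hg₁.1 hg₁.2.1
    obtain ⟨e₂, t₂, hM₂, hPT₂⟩ := exists_models hg₂.1 hg₂.2.1
    have hp₁ := hg₁.pt hh₁ hM₁ hPT₁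
    have hp₂ := hg₂.pt hh₂ hM₂ hPT₂
    obtain ⟨htype, hturn⟩ := eq_of_locally_isomorphic (e₁ := e₁) (e₂ := e₂) hp₁ hp₂ (by
      intro V
      -- The comparison of `𝒟₁` with `𝒟₂` passes through `𝒞`, composing two translations.
      obtain ⟨u, hu⟩ := hM₁.exists_turns hM hl₁.2 V
      obtain ⟨u', hu'⟩ := hM.exists_turns hM₂ hl₂.1 (V.image (· + u))
      refine ⟨u + u', fun v hv => ?_⟩
      obtain ⟨a1, a2⟩ := hu v hv
      obtain ⟨b1, b2⟩ := hu' (v + u) (Finset.mem_image_of_mem _ hv)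
      refine ⟨by rw [← add_assoc, b1, a1], ?_⟩
      have := dvd_add a2 b2
      convert this using 1
      ring)
    have hseg : ∀ A, IsSeg e₁ A ↔ IsSeg e₂ (shift (h₂ 0 - h₁ 0) A) := by
      intro A
      rw [isSeg_shift_iff]
      have h1 : 2 ∣ e₂ - ϖ * (h₂ 0 - h₁ 0) - e₁ := by
        convert htype using 1
        ring
      exact ⟨fun h => h.congr h1, fun h => h.congr (by rwa [← dvd_neg, neg_sub])⟩
    refine ⟨fun A => by rw [hM₁.2.1, hM₂.2.1, hseg], fun A B hA => ?_⟩
    rw [hM₁.2.2, hM₂.2.2, hseg]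
    refine and_congr_right fun _ => ?_
    have h1 := hturn (A.2 - h₁ 0) (sub_ne_zero.2 hA)
    rw [add_sub_cancel, show h₂ 0 + (A.2 - h₁ 0) = A.2 + (h₂ 0 - h₁ 0) by ring] at h1
    simp only [shift]
    rw [h1, Prod.ext_iff, Prod.ext_iff]
    simp only
    constructor
    · rintro ⟨h2, h3⟩
      exact ⟨by rw [h2], by rw [h3]; ring⟩
    · rintro ⟨h2, h3⟩
      exact ⟨by linear_combination h2, by linear_combination h3⟩
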